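/- Let $\mathbb K$ be an algebraically closed field of characteristic $0$ and let $\mathfrak g$ be a root-reductive Lie algebra over $\mathbb K$, that is, a union of a chain $\mathfrak g_1\subseteq\mathfrak g_2\subseteq\cdots$ of finite-dimensional reductive subalgebras having Cartan subalgebras $\mathfrak h_n\subseteq\mathfrak g_n$ with $\mathfrak h_n=\mathfrak h_{n+1}\cap\mathfrak g_n$ such that every $\mathfrak h_n$-root space of $\mathfrak g_n$ is an $\mathfrak h_{n+1}$-root space of $\mathfrak g_{n+1}$. Let $\mathfrak h$ be a splitting maximal toral subalgebra of $\mathfrak g$ (so $\mathfrak g=\mathfrak h\oplus\bigoplus_{\alpha\in\Phi}\mathfrak g^\alpha$) and let $\mathfrak b=\mathfrak h\oplus\bigoplus_{\alpha\in\Phi^+}\mathfrak g^\alpha$, $\Phi=\Phi^+\sqcup-\Phi^+$, be a Dynkin Borel subalgebra containing $\mathfrak h$, i.e. one that is generated by $\mathfrak h$ and its simple root spaces. Put $\mathfrak n=[\mathfrak b,\mathfrak b]$. Let $\overline{\mathcal O}$ be the category of $\mathfrak g$-modules that are direct sums of their $\mathfrak h$-weight spaces, have finite-dimensional weight spaces,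 and are locally $U(\mathfrak n)$-finite. Fix an involutive linear map $\tau:\mathfrak g\to\mathfrak g$ with $\tau[x,y]=[\tau y,\tau x]$ and $\tau|_{\mathfrak h}=\mathrm{id}$ (a transpose map, such as the one given by a Chevalley basis). For a weight module $M$ let $M^\vee=\bigoplus_{\mu}(M^\mu)^*$ with $(xf)(m)=f(\tau(x)m)$. For $\lambda\in\mathfrak h^*$ let $\Delta(\lambda)=U(\mathfrak g)\otimes_{U(\mathfrak b)}\mathbb K_\lambda$ be the Verma module and $\nabla(\lambda)=\Delta(\lambda)^\vee$. A generalized standard (resp. costandard) filtration of $M$ is a family $(M_j)_{j\in J}$ of submodules of $M$ indexed by a totally ordered set $J$ such that: $M_j\subsetneq M_k$ whenever $j\prec k$; $\bigcap_j M_j=0$ and $\bigcup_j M_j=M$; for every $j$ that is not the least element of $J$, the quotient $M_j/\bigcup_{k\prec j}M_k$ is isomorphic to $\Delta(\mu)$ (resp. $\nabla(\mu)$) for some $\mu\in\mathfrak h^*$; and for every nonzero $m\in M$ there is $j\in J$ with $m\in M_j\setminus\bigcup_{k\prec j}M_k$. **Theorem.** Let $M\in\overline{\mathcal O}$ and $\lambda\in\mathfrak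 h^*$. 1. For every generalized standard filtration $(M_j)_{j\in J}$ of $M$, the number $\{M:\Delta(\lambda)\}$ of indices $j$ with $M_j/\bigcup_{k\prec j}M_k\cong\Delta(\lambda)$ is finite, $\operatorname{Hom}_{\mathfrak g}(M,\nabla(\lambda))$ is finite-dimensional, and $$\{M:\Delta(\lambda)\}=\dim\operatorname{Hom}_{\mathfrak g}\big(M,\nabla(\lambda)\big).$$ 2. For every generalized costandard filtration $(M_j)_{j\in J}$ of $M$, the number $\{M:\nabla(\lambda)\}$ of indices $j$ with $M_j/\bigcup_{k\prec j}M_k\cong\nabla(\lambda)$ is finite, $\operatorname{Hom}_{\mathfrak g}(M^\vee,\nabla(\lambda))$ is finite-dimensional, and $$\{M:\nabla(\lambda)\}=\dim\operatorname{Hom}_{\mathfrak g}\big(M^\vee,\nabla(\lambda)\big).$$ In particular, neither number depends on the choice of the filtration. -/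

import Mathlib

noncomputable section

namespace RootReductive

section LieTheory

variable {K : Type*} [Field K] {g : Type*} [LieRing g] [LieAlgebra K g]

/-- The `h`-weight space `M^μ = {m | t m = μ(t) m for all t in h}` of a `g`-module `M`. -/
def weightSpace (h : LieSubalgebra K g) (M : Type*) [AddCommGroup M] [Module K M]
    [LieRingModule g M] [LieModule K g M] (μ : Module.Dual K h) : Submodule K M where
  carrier := {m | ∀ t : h, ⁅(t : g), m⁆ = μ t • m}
  zero_mem' := by intro t; simp
  add_mem' := by
    intro a c ha hc t
    rw [lie_add, ha t, hc t, smul_add]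
  smul_mem' := by
    intro a m hm t
    rw [lie_smul, hm t, smul_comm]

/-- The `h`-weight space `g^α` of `g` under the adjoint action (a root space if `α ≠ 0`). -/
abbrev rootSpace (h : LieSubalgebra K g) (α : Module.Dual K h) : Submodule K g :=
  weightSpace h g α

/-- `α` is an `h`-root of `g`. -/
def IsRoot (h : LieSubalgebra K g) (α : Module.Dual K h) : Prop :=
  α ≠ 0 ∧ rootSpace h α ≠ ⊥

variable (K g) in
/-- A root-reductive Lie algebra: the union of a chain `G 0 ≤ G 1 ≤ ...` of finite-dimensional
reductive subalgebras with Cartan subalgebras `H n` of `G n` such that `H n = H (n+1) ∩ G n` and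
every root space of `(G n, H n)` is a root space of `(G (n+1), H (n+1))`. -/
def IsRootReductive : Prop :=
  ∃ G H : ℕ → LieSubalgebra K g,
    (∀ n, G n ≤ G (n + 1)) ∧
    (∀ x : g, ∃ n, x ∈ G n) ∧
    (∀ n, FiniteDimensional K (G n)) ∧
    (∀ n, LieAlgebra.HasCentralRadical K (G n)) ∧
    (∀ n, H n ≤ G n) ∧
    (∀ n, ((H n).comap (G n).incl).IsCartanSubalgebra) ∧
    (∀ n, H n = H (n + 1) ⊓ G n) ∧
    (∀ n, ∀ α : Module.Dual K (H n), α ≠ 0 →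
      rootSpace (H n) α ⊓ (G n).toSubmodule ≠ ⊥ →
      ∃ β : Module.Dual K (H (n + 1)), β ≠ 0 ∧
        rootSpace (H n) α ⊓ (G n).toSubmodule =
          rootSpace (H (n + 1)) β ⊓ (G (n + 1)).toSubmodule)

/-- A subalgebra is toral if each of its elements is `ad`-semisimple, i.e. (over an algebraically
closed field) acts diagonalizably on `g`. -/
def IsToral (h : LieSubalgebra K g) : Prop :=
  ∀ x ∈ h, ⨆ c : K, Module.End.eigenspace (LieAlgebra.ad K g x) c = ⊤

/-- A maximal toral subalgebra `h` is splitting if `g` is the sum of `h` and the root spaces. -/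
structure IsSplittingMaximalToral (h : LieSubalgebra K g) : Prop where
  maximal : Maximal IsToral h
  splitting : h.toSubmodule ⊔ ⨆ α : Module.Dual K h, ⨆ _ : IsRoot h α, rootSpace h α = ⊤

/-- `α` is a `b`-positive root. -/
def IsPosRoot (h b : LieSubalgebra K g) (α : Module.Dual K h) : Prop :=
  IsRoot h α ∧ rootSpace h α ≤ b.toSubmodule

/-- `α` is a `b`-simple root: a positive root that is not the sum of two positive roots. -/
def IsSimpleRoot (h b : LieSubalgebra K g) (α : Module.Dual K h) : Prop :=
  IsPosRoot h b α ∧ ¬ ∃ β γ, IsPosRoot h b β ∧ IsPosRoot h b γ ∧ α = β + γ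

/-- `b` is a Borel subalgebra containing `h`: `b = h ⊕ ⨁_{α ∈ Φ⁺} g^α` for a triangular
decomposition `Φ = Φ⁺ ⊔ -Φ⁺` of the set of roots. -/
structure IsBorel (h b : LieSubalgebra K g) : Prop where
  eq_sum : b.toSubmodule =
    h.toSubmodule ⊔ ⨆ α : Module.Dual K h, ⨆ _ : IsPosRoot h b α, rootSpace h α
  triangular : ∀ α, IsRoot h α → Xor (IsPosRoot h b α) (IsPosRoot h b (-α))

/-- A Dynkin Borel subalgebra: a Borel subalgebra containing `h` that is generated by `h` and the
simple root spaces. -/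
structure IsDynkinBorel (h b : LieSubalgebra K g) : Prop extends IsBorel h b where
  generated : b = LieSubalgebra.lieSpan K g
    ((h : Set g) ∪ ⋃ α ∈ {α : Module.Dual K h | IsSimpleRoot h b α}, (rootSpace h α : Set g))

/-- The subalgebra `n = [b, b]`. -/
def nilPart (b : LieSubalgebra K g) : LieSubalgebra K g :=
  LieSubalgebra.lieSpan K g {z | ∃ x ∈ b, ∃ y ∈ b, ⁅x, y⁆ = z}

/-- Objects of the extended category `O` of `(g, b)`: `h`-weight modules with finite-dimensional
weight spaces which are locally `U(n)`-finite, i.e. every vector lies in a finite-dimensional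
`n`-stable subspace. -/
structure InCategoryO (h b : LieSubalgebra K g) (M : Type*) [AddCommGroup M] [Module K M]
    [LieRingModule g M] [LieModule K g M] : Prop where
  weight : ⨆ μ : Module.Dual K h, weightSpace h M μ = ⊤
  finite : ∀ μ : Module.Dual K h, FiniteDimensional K (weightSpace h M μ)
  locally_finite : ∀ m : M, ∃ W : Submodule K M, FiniteDimensional K W ∧ m ∈ W ∧
    ∀ x ∈ nilPart b, ∀ w ∈ W, ⁅x, w⁆ ∈ W

/-- The left ideal of `U(g)` generated by `n` and by the elements `t - lam(t)` for `t` in `h`. -/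
def vermaIdeal (h b : LieSubalgebra K g) (lam : Module.Dual K h) :
    Submodule (UniversalEnvelopingAlgebra K g) (UniversalEnvelopingAlgebra K g) :=
  Submodule.span (UniversalEnvelopingAlgebra K g)
    ({u | ∃ x ∈ nilPart b, u = UniversalEnvelopingAlgebra.ι K x} ∪
      {u | ∃ t : h, u = UniversalEnvelopingAlgebra.ι K (t : g) -
        algebraMap K (UniversalEnvelopingAlgebra K g) (lam t)})

/-- The Verma module `Δ(lam) = U(g) ⊗_{U(b)} K_lam`, realized as the quotient of `U(g)` by the left
ideal generated by `n` and by `t - lam(t)` for `t` in `h`. -/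
def Verma (h b : LieSubalgebra K g) (lam : Module.Dual K h) :=
  UniversalEnvelopingAlgebra K g ⧸ vermaIdeal h b lam

namespace Verma

variable (h b : LieSubalgebra K g) (lam : Module.Dual K h)

instance : AddCommGroup (Verma h b lam) :=
  inferInstanceAs (AddCommGroup (UniversalEnvelopingAlgebra K g ⧸ vermaIdeal h b lam))

instance : Module (UniversalEnvelopingAlgebra K g) (Verma h b lam) :=
  inferInstanceAs (Module (UniversalEnvelopingAlgebra K g)
    (UniversalEnvelopingAlgebra K g ⧸ vermaIdeal h b lam))

instance : Module K (Verma h b lam) :=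
  inferInstanceAs (Module K (UniversalEnvelopingAlgebra K g ⧸ vermaIdeal h b lam))

instance : IsScalarTower K (UniversalEnvelopingAlgebra K g) (Verma h b lam) :=
  inferInstanceAs (IsScalarTower K (UniversalEnvelopingAlgebra K g)
    (UniversalEnvelopingAlgebra K g ⧸ vermaIdeal h b lam))

/-- `x` in `g` acts as the corresponding element of `U(g)`. -/
instance : LieRingModule g (Verma h b lam) where
  bracket x v := UniversalEnvelopingAlgebra.ι K x • v
  add_lie x y v := by
    change UniversalEnvelopingAlgebra.ι K (x + y) • v = _
    rw [map_add, add_smul]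
  lie_add x v w := smul_add _ _ _
  leibniz_lie x y v := by
    change UniversalEnvelopingAlgebra.ι K x • (UniversalEnvelopingAlgebra.ι K y • v) =
      UniversalEnvelopingAlgebra.ι K ⁅x, y⁆ • v +
      UniversalEnvelopingAlgebra.ι K y • (UniversalEnvelopingAlgebra.ι K x • v)
    let : LieRing (UniversalEnvelopingAlgebra K g) := LieRing.ofAssociativeRing
    have hxy : UniversalEnvelopingAlgebra.ι K ⁅x, y⁆ =
        UniversalEnvelopingAlgebra.ι K x * UniversalEnvelopingAlgebra.ι K y -
          UniversalEnvelopingAlgebra.ι K y * UniversalEnvelopingAlgebra.ι K x :=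
      LieHom.map_lie (UniversalEnvelopingAlgebra.ι K) x y
    rw [hxy, sub_smul, mul_smul, mul_smul, sub_add_cancel]

instance : LieModule K g (Verma h b lam) where
  smul_lie c x v := by
    change UniversalEnvelopingAlgebra.ι K (c • x) • v = c • (UniversalEnvelopingAlgebra.ι K x • v)
    rw [map_smul, smul_assoc]
  lie_smul c x v := by
    change UniversalEnvelopingAlgebra.ι K x • (c • v) = c • (UniversalEnvelopingAlgebra.ι K x • v)
    rw [← algebraMap_smul (UniversalEnvelopingAlgebra K g) c v,
      ← algebraMap_smul (UniversalEnvelopingAlgebra K g) c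
        (UniversalEnvelopingAlgebra.ι K x • v), ← mul_smul, ← mul_smul, Algebra.commutes]

end Verma

/-- A transpose map of `(g, h)`: an anti-involution of `g` fixing `h` pointwise. It interchanges
`g^α` and `g^{-α}`; e.g. the map fixing `h` and sending `x_α` to `x_{-α}` for a Chevalley basis. -/
structure Transpose (h : LieSubalgebra K g) where
  /-- the underlying linear map -/
  toFun : g →ₗ[K] g
  map_lie : ∀ x y, toFun ⁅x, y⁆ = ⁅toFun y, toFun x⁆
  involutive : ∀ x, toFun (toFun x) = x
  fixes : ∀ t ∈ h, toFun t = t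

/-- The full dual of a `g`-module `M`, on which `g` acts by `(x f)(m) = f(τ(x) m)`. -/
def TwistedDual {h : LieSubalgebra K g} (_τ : Transpose h) (M : Type*) [AddCommGroup M]
    [Module K M] := Module.Dual K M

namespace TwistedDual

variable {h : LieSubalgebra K g} (τ : Transpose h) (M : Type*) [AddCommGroup M] [Module K M]
  [LieRingModule g M] [LieModule K g M]

instance : AddCommGroup (TwistedDual τ M) := inferInstanceAs (AddCommGroup (Module.Dual K M))

instance : Module K (TwistedDual τ M) := inferInstanceAs (Module K (Module.Dual K M))

instance : FunLike (TwistedDual τ M) M K := inferInstanceAs (FunLike (Module.Dual K M) M K)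

instance : LieRingModule g (TwistedDual τ M) where
  bracket x f := LinearMap.comp (show M →ₗ[K] K from f) (LieModule.toEnd K g M (τ.toFun x))
  add_lie x y f := by
    refine LinearMap.ext fun m => ?_
    change (show M →ₗ[K] K from f) ⁅τ.toFun (x + y), m⁆ =
      (show M →ₗ[K] K from f) ⁅τ.toFun x, m⁆ + (show M →ₗ[K] K from f) ⁅τ.toFun y, m⁆
    rw [map_add, add_lie, map_add]
  lie_add x f f' := LinearMap.ext fun m => rfl
  leibniz_lie x y f := by
    refine LinearMap.ext fun m => ?_
    change (show M →ₗ[K] K from f) ⁅τ.toFun y, ⁅τ.toFun x, m⁆⁆ =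
      (show M →ₗ[K] K from f) ⁅τ.toFun ⁅x, y⁆, m⁆ +
      (show M →ₗ[K] K from f) ⁅τ.toFun x, ⁅τ.toFun y, m⁆⁆
    rw [τ.map_lie, ← map_add, ← leibniz_lie]

instance : LieModule K g (TwistedDual τ M) where
  smul_lie c x f := by
    refine LinearMap.ext fun m => ?_
    change (show M →ₗ[K] K from f) ⁅τ.toFun (c • x), m⁆ =
      c • (show M →ₗ[K] K from f) ⁅τ.toFun x, m⁆
    rw [map_smul, smul_lie, map_smul]
  lie_smul c x f := LinearMap.ext fun m => rfl

end TwistedDual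

variable {h : LieSubalgebra K g}

/-- The copy of `(M^μ)^*` in the dual of an `h`-weight module `M`: the functionals vanishing on
every weight space `M^ν` with `ν ≠ μ`. -/
def dualComponent (τ : Transpose h) (M : Type*) [AddCommGroup M] [Module K M]
    [LieRingModule g M] [LieModule K g M] (μ : Module.Dual K h) :
    Submodule K (TwistedDual τ M) where
  carrier := {f | ∀ ν, ν ≠ μ → ∀ m ∈ weightSpace h M ν, f m = 0}
  zero_mem' := by intro ν _ m _; rfl
  add_mem' := by
    intro a c ha hc ν hν m hm
    change a m + c m = 0
    rw [ha ν hν m hm, hc ν hν m hm, add_zero]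
  smul_mem' := by
    intro a f hf ν hν m hm
    change a • f m = 0
    rw [hf ν hν m hm, smul_zero]

/-- A transpose map sends `g^α` to `g^{-α}`. -/
theorem Transpose.mem_rootSpace_neg (τ : Transpose h) {α : Module.Dual K h} {x : g}
    (hx : x ∈ rootSpace h α) : τ.toFun x ∈ rootSpace h (-α) := by
  intro t
  have h1 : τ.toFun ⁅(t : g), x⁆ = ⁅τ.toFun x, (t : g)⁆ := by
    rw [τ.map_lie, τ.fixes t t.2]
  rw [hx t, map_smul] at h1
  rw [← lie_skew, ← h1, LinearMap.neg_apply, neg_smul]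

theorem lie_mem_weightSpace {M : Type*} [AddCommGroup M] [Module K M]
    [LieRingModule g M] [LieModule K g M] {α ν : Module.Dual K h} {x : g} {m : M}
    (hx : x ∈ rootSpace h α) (hm : m ∈ weightSpace h M ν) :
    ⁅x, m⁆ ∈ weightSpace h M (α + ν) := by
  intro t
  rw [leibniz_lie, hx t, hm t, smul_lie, lie_smul, LinearMap.add_apply, add_smul]

theorem lie_mem_dualComponent (τ : Transpose h) {M : Type*} [AddCommGroup M] [Module K M]
    [LieRingModule g M] [LieModule K g M] {α μ : Module.Dual K h} {x : g}
    {f : TwistedDual τ M} (hx : x ∈ rootSpace h α) (hf : f ∈ dualComponent τ M μ) :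
    ⁅x, f⁆ ∈ dualComponent τ M (α + μ) := by
  intro ν hν m hm
  refine hf (-α + ν) ?_ _ (lie_mem_weightSpace (τ.mem_rootSpace_neg hx) hm)
  rintro rfl
  exact hν (by abel)

theorem lie_mem_dualComponent_of_mem (τ : Transpose h) {M : Type*} [AddCommGroup M] [Module K M]
    [LieRingModule g M] [LieModule K g M] {μ : Module.Dual K h} {x : g}
    {f : TwistedDual τ M} (hx : x ∈ h) (hf : f ∈ dualComponent τ M μ) :
    ⁅x, f⁆ ∈ dualComponent τ M μ := by
  intro ν hν m hm
  change f ⁅τ.toFun x, m⁆ = 0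
  rw [τ.fixes x hx]
  exact hf ν hν _ (by rw [hm ⟨x, hx⟩]; exact Submodule.smul_mem _ _ hm)

/-- The dual `M^∨ = ⨁_μ (M^μ)^*` with the action `(x f)(m) = f(τ(x) m)`. -/
def dual (hh : IsSplittingMaximalToral h) (τ : Transpose h) (M : Type*) [AddCommGroup M]
    [Module K M] [LieRingModule g M] [LieModule K g M] : LieSubmodule K g (TwistedDual τ M) where
  toSubmodule := ⨆ μ : Module.Dual K h, dualComponent τ M μ
  lie_mem := by
    intro x f hf
    change f ∈ ⨆ μ : Module.Dual K h, dualComponent τ M μ at hf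
    change ⁅x, f⁆ ∈ ⨆ μ : Module.Dual K h, dualComponent τ M μ
    have key : ∀ y : g, (∀ μ, ∀ f' ∈ dualComponent τ M μ, ∃ ν, ⁅y, f'⁆ ∈ dualComponent τ M ν) →
        ⁅y, f⁆ ∈ ⨆ μ : Module.Dual K h, dualComponent τ M μ := by
      intro y hy
      induction hf using Submodule.iSup_induction' with
      | mem μ f hf =>
        obtain ⟨ν, hν⟩ := hy μ f hf
        exact Submodule.mem_iSup_of_mem ν hν
      | zero => rw [lie_zero]; exact Submodule.zero_mem _
      | add f f' _ _ h1 h2 => rw [lie_add]; exact Submodule.add_mem _ h1 h2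
    have hle : (⊤ : Submodule K g) ≤ Submodule.comap
        ((LieModule.toEnd K g (TwistedDual τ M) : g →ₗ[K] Module.End K (TwistedDual τ M)).flip f)
        (⨆ μ : Module.Dual K h, dualComponent τ M μ) := by
      rw [← hh.splitting]
      refine sup_le
        (fun y hy => key y fun μ f' hf' => ⟨μ, lie_mem_dualComponent_of_mem τ hy hf'⟩)
        (iSup_le fun α => iSup_le fun _ => fun y hy => key y fun μ f' hf' =>
          ⟨α + μ, lie_mem_dualComponent τ hy hf'⟩)
    exact hle (Submodule.mem_top (x := x))

/-- The co-Verma module `∇(lam) = Δ(lam)^∨`. -/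
abbrev CoVerma (hh : IsSplittingMaximalToral h) (b : LieSubalgebra K g) (τ : Transpose h)
    (lam : Module.Dual K h) : Type _ :=
  dual hh τ (Verma h b lam)

end LieTheory

section Filtrations

variable {K : Type*} [Field K] {g : Type*} [LieRing g] [LieAlgebra K g]
  {M : Type*} [AddCommGroup M] [Module K M] [LieRingModule g M] [LieModule K g M]
  {J : Type*} [LinearOrder J]

/-- The union of the members of a chain of submodules strictly before `j`. -/
def before (N : J → LieSubmodule K g M) (j : J) : LieSubmodule K g M :=
  ⨆ k, ⨆ _ : k < j, N k

/-- The quotient `N j / ⋃_{k < j} N k`. -/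
abbrev gradedPiece (N : J → LieSubmodule K g M) (j : J) : Type _ :=
  (N j) ⧸ (before N j).comap (N j).incl

/-- A generalized `F`-filtration of `M` indexed by the totally ordered set `J`, for a family `F` of
`g`-modules. The least element of `J` (if any) is exempt from the condition on quotients, since the
submodule at that place is zero. The field `no_gap` says that every nonzero vector is first met at
some place of the filtration, so that the quotients account for all of `M`. -/
structure IsGeneralizedFiltration {I : Type*} (F : I → Type*) [∀ i, AddCommGroup (F i)]
    [∀ i, Module K (F i)] [∀ i, LieRingModule g (F i)] [∀ i, LieModule K g (F i)]
    (N : J → LieSubmodule K g M) : Prop where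
  strictMono : StrictMono N
  iInf_eq_bot : ⨅ j, N j = ⊥
  iSup_eq_top : ⨆ j, N j = ⊤
  quotient : ∀ j, ¬ IsMin j → ∃ i, Nonempty (gradedPiece N j ≃ₗ⁅K,g⁆ F i)
  no_gap : ∀ m : M, m ≠ 0 → ∃ j, m ∈ N j ∧ m ∉ before N j

/-- The number (possibly infinite, a priori) of occurrences of `V` among the quotients
`N j / ⋃_{k < j} N k`. -/
def multiplicity (N : J → LieSubmodule K g M) (V : Type*) [AddCommGroup V] [Module K V]
    [LieRingModule g V] [LieModule K g V] : ℕ∞ :=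
  Set.encard {j | Nonempty (gradedPiece N j ≃ₗ⁅K,g⁆ V)}

end Filtrations

end RootReductive

end

set_option linter.unusedSectionVars false

/-! Order weights by ν ≤ μ when μ - ν lies in the cone generated by the simple roots. By the
universal property of Δ(λ) and the transpose map, a homomorphism X → ∇(λ) is the same as a
functional on X of weight λ that kills n⁻X, where n⁻ is the transpose of n (`hom_coVerma_equiv`).
The first claim therefore counts singular functionals on M.

Singular functionals are left exact, and along an extension of Δ(μ) by A they all extend from A,
which is the vanishing of Ext¹(Δ(μ), ∇(λ)). If μ ≥ λ, the extension splits after A is replaced by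
its image in ∇(λ), because no weight μ + α occurs in ∇(λ). If μ is not above λ, no weight λ + α
occurs in Δ(μ) and there is no obstruction. Since Δ(μ) carries one singular functional of weight λ
up to scalars when μ = λ and none otherwise, each subquotient Δ(λ) contributes exactly one
(`finrank_singFunctionals_add_verma`).

An arbitrary totally ordered index set is reduced to finitely many steps by weights. The λ-weight
space grows at finitely many places, the jumps. The weights of Δ(μ) are exactly those below μ, so at
a place that is not a jump no weight space of weight ≥ λ grows either. Only weights ≥ λ matter for
singular functionals, so an induction on the number of jumps suffices (`finrank_sing_unionOver`).

For the second claim, finite-dimensional weight spaces turn singular functionals on M^∨ into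
singular vectors of M (`singVectors_equiv_dual`). Here the induction descends from M to 0 and counts
vectors singular modulo a member of the chain. Passing from P' to P with P'/P ≅ ∇(μ) requires
correcting a vector singular modulo P' by an element of P', which is the vanishing of Ext¹(Δ(λ),
∇(μ)) (`exists_lift_singVectors`).

Two facts about Verma modules are needed: all weights below the highest one occur, and the cone is
pointed. Both come from a map of Δ(λ) to the polynomials in one variable on which each simple
lowering operator, suitably chosen, multiplies by a nonzero multiple of X. The map is built from an
explicit action of g on U(n⁻) instead of a PBW basis. Pointedness follows because a loop in the cone
would produce polynomials of unbounded degree inside one finite-dimensional weight space. -/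

namespace RootReductive

/-! ### Simultaneous eigenspaces of a family of operators. -/

section Eigenfamilies

variable {K : Type*} [Field K] {V : Type*} [AddCommGroup V] [Module K V]

/-- A subspace stable under a family of operators contains the components, in simultaneous
eigenspaces with distinct eigenvalues, of each of its elements. -/
theorem mem_of_sum_mem_of_eigen {ι Ω : Type*} (S : ι → Submodule K V) (T : Ω → Module.End K V)
    (ev : ι → Ω → K) (hS : ∀ i ω, ∀ v ∈ S i, T ω v = ev i ω • v)
    (sep : Function.Injective ev) (A : Submodule K V) (hA : ∀ ω, ∀ a ∈ A, T ω a ∈ A)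
    (s : Finset ι) : ∀ v : ι → V, (∀ i ∈ s, v i ∈ S i) → ∑ i ∈ s, v i ∈ A → ∀ i ∈ s, v i ∈ A := by
  classical
  induction s using Finset.induction_on with
  | empty => intro v _ _ i hi; simp at hi
  | insert i₀ s hi₀ ih =>
    intro v hv hsum
    have h1 : ∀ i ∈ s, v i ∈ A := by
      intro i hi
      have hne : i ≠ i₀ := fun h => hi₀ (h ▸ hi)
      -- An operator that separates `i` from `i₀`: subtracting the eigenvalue at `i₀` kills that
      -- term and rescales the `i`-th one by a nonzero factor, so the induction hypothesis applies.
      obtain ⟨ω, hω⟩ : ∃ ω, ev i ω ≠ ev i₀ ω := by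
        by_contra! hc
        exact hne (sep (funext hc))
      have h2 : ∑ j ∈ s, (ev j ω - ev i₀ ω) • v j ∈ A := by
        have h3 : T ω (∑ j ∈ insert i₀ s, v j) - ev i₀ ω • ∑ j ∈ insert i₀ s, v j =
            ∑ j ∈ s, (ev j ω - ev i₀ ω) • v j := by
          rw [map_sum, Finset.smul_sum, ← Finset.sum_sub_distrib, Finset.sum_insert hi₀,
            hS i₀ ω _ (hv i₀ (Finset.mem_insert_self _ _)), sub_self, zero_add]
          refine Finset.sum_congr rfl fun j hj => ?_
          rw [hS j ω _ (hv j (Finset.mem_insert_of_mem hj)), sub_smul]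
        rw [← h3]
        exact A.sub_mem (hA ω _ hsum) (A.smul_mem _ hsum)
      have h4 := ih (fun j => (ev j ω - ev i₀ ω) • v j)
        (fun j hj => (S j).smul_mem _ (hv j (Finset.mem_insert_of_mem hj))) h2 i hi
      exact (A.smul_mem_iff (sub_ne_zero.mpr hω)).mp h4
    intro i hi
    rcases Finset.mem_insert.mp hi with rfl | hi
    · rw [Finset.sum_insert hi₀] at hsum
      exact (A.add_mem_iff_left (A.sum_mem h1)).mp hsum
    · exact h1 i hi

/-- A linear relation is a sum lying in the zero subspace, which is stable under all operators, so
each of its terms is zero. -/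
theorem iSupIndep_of_eigen {ι Ω : Type*} (S : ι → Submodule K V) (T : Ω → Module.End K V)
    (ev : ι → Ω → K) (hS : ∀ i ω, ∀ v ∈ S i, T ω v = ev i ω • v)
    (sep : Function.Injective ev) : iSupIndep S := by
  classical
  rw [iSupIndep_iff_forall_dfinsupp]
  intro i x v hv
  by_contra hx
  have h1 : (v.erase i).sumAddHom (fun i => (S i).subtype.toAddMonoidHom) = (x : V) := hv
  rw [DFinsupp.sumAddHom_apply, DFinsupp.sum] at h1
  set w : ι → V := fun j => if j = i then -(x : V) else (v.erase i j : V) with hw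
  have h2 : ∑ j ∈ insert i (v.erase i).support, w j = 0 := by
    rw [Finset.sum_insert (by simp)]
    simp only [hw, if_pos]
    rw [neg_add_eq_zero, ← h1]
    refine Finset.sum_congr rfl fun j hj => ?_
    have : j ≠ i := by rintro rfl; simp at hj
    rw [if_neg this]; rfl
  have h3 := mem_of_sum_mem_of_eigen S T ev hS sep ⊥ (by simp) (insert i (v.erase i).support) w
    (by
      intro j _
      simp only [hw]
      split_ifs with hj
      · subst hj; exact (S j).neg_mem x.2
      · exact ((v.erase i) j).2) (by rw [h2]; exact zero_mem _) i (Finset.mem_insert_self _ _)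
  simp [hw] at h3
  exact hx h3

end Eigenfamilies

/-! ### Weight modules: components, functionals, sub- and quotient modules. -/

section Weights

variable {K : Type*} [Field K] {g : Type*} [LieRing g] [LieAlgebra K g] {h : LieSubalgebra K g}
  {M : Type*} [AddCommGroup M] [Module K M] [LieRingModule g M] [LieModule K g M]
  {B : Type*} [AddCommGroup B] [Module K B] [LieRingModule g B] [LieModule K g B]

/-- `M` is the sum of its `h`-weight spaces. -/
def IsWeight (h : LieSubalgebra K g) (M : Type*) [AddCommGroup M] [Module K M]
    [LieRingModule g M] [LieModule K g M] : Prop :=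
  ⨆ μ : Module.Dual K h, weightSpace h M μ = ⊤

variable (h M) in
theorem iSupIndep_weightSpace : iSupIndep (fun μ : Module.Dual K h => weightSpace h M μ) :=
  iSupIndep_of_eigen _ (fun t : h => LieModule.toEnd K g M t) (fun μ t => μ t)
    (fun _ t _ hv => hv t) (fun _ _ hμ => LinearMap.ext fun t => congrFun hμ t)

/-- A nonzero weight vector lying in a sum of weight spaces has one of the weights that occur. -/
theorem exists_eq_of_mem_iSup {I : Set (Module.Dual K h)} {μ : Module.Dual K h} {m : M}
    (hμ : m ∈ weightSpace h M μ) (hm : m ≠ 0) (hI : m ∈ ⨆ ν ∈ I, weightSpace h M ν) : μ ∈ I := by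
  by_contra hne
  have := (iSupIndep_weightSpace h M).disjoint_biSup (x := μ) (y := I) hne
  exact hm (Submodule.disjoint_def.mp this m hμ hI)

theorem IsWeight.exists_sum (hM : IsWeight h M) (m : M) :
    ∃ f : Module.Dual K h →₀ M, (∀ ν, f ν ∈ weightSpace h M ν) ∧ ∑ ν ∈ f.support, f ν = m := by
  have : m ∈ ⨆ μ : Module.Dual K h, weightSpace h M μ := by rw [hM]; trivial
  obtain ⟨f, hf, hs⟩ := (Submodule.mem_iSup_iff_exists_finsupp _ _).mp this
  exact ⟨f, hf, hs⟩

theorem IsWeight.induction (hM : IsWeight h M) {P : M → Prop} (h0 : P 0)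
    (hadd : ∀ x y, P x → P y → P (x + y)) (hw : ∀ ν, ∀ m ∈ weightSpace h M ν, P m) (m : M) :
    P m := by
  obtain ⟨f, hf, rfl⟩ := hM.exists_sum m
  exact Finset.sum_induction _ _ hadd h0 fun _ _ => hw _ _ (hf _)

theorem IsWeight.linearMap_ext {V : Type*} [AddCommGroup V] [Module K V] (hM : IsWeight h M)
    {F G : M →ₗ[K] V} (hFG : ∀ ν, ∀ m ∈ weightSpace h M ν, F m = G m) : F = G :=
  LinearMap.ext fun m => hM.induction (P := fun m => F m = G m) (by simp)
    (fun x y hx hy => by rw [map_add, map_add, hx, hy]) hFG m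

/-- A linear map on a weight module can be prescribed on the weight spaces. -/
theorem IsWeight.exists_linearMap {V : Type*} [AddCommGroup V] [Module K V] (hM : IsWeight h M)
    (f : Module.Dual K h → M →ₗ[K] V) :
    ∃ F : M →ₗ[K] V, ∀ ν, ∀ m ∈ weightSpace h M ν, F m = f ν m := by
  classical
  have hint := DirectSum.isInternal_submodule_of_iSupIndep_of_iSup_eq_top
    (iSupIndep_weightSpace h M) hM
  let e := LinearEquiv.ofBijective
    (DirectSum.coeLinearMap fun μ : Module.Dual K h => weightSpace h M μ) hint
  refine ⟨(DirectSum.toModule K _ V fun ν => (f ν).comp (weightSpace h M ν).subtype).comp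
    e.symm.toLinearMap, fun ν m hm => ?_⟩
  have : e (DirectSum.lof K _ (fun μ : Module.Dual K h => weightSpace h M μ) ν ⟨m, hm⟩) = m := by
    change DirectSum.coeLinearMap _ _ = m
    simp
  have h2 : e.symm m = DirectSum.lof K _ (fun μ : Module.Dual K h => weightSpace h M μ) ν ⟨m, hm⟩ :=
    e.symm_apply_eq.mpr this.symm
  change DirectSum.toModule K _ V _ (e.symm m) = _
  rw [h2, DirectSum.toModule_lof]
  rfl

/-- A linear map on one weight space extends by zero. -/
theorem IsWeight.exists_linearMap_single {V : Type*} [AddCommGroup V] [Module K V]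
    (hM : IsWeight h M) (μ : Module.Dual K h) (f : M →ₗ[K] V) :
    ∃ F : M →ₗ[K] V, (∀ m ∈ weightSpace h M μ, F m = f m) ∧
      ∀ ν, ν ≠ μ → ∀ m ∈ weightSpace h M ν, F m = 0 := by
  classical
  obtain ⟨F, hF⟩ := hM.exists_linearMap (fun ν => if ν = μ then f else 0)
  refine ⟨F, fun m hm => by simpa using hF μ m hm, fun ν hν m hm => ?_⟩
  simpa [hν] using hF ν m hm

theorem IsWeight.exists_dual_ne_zero (hM : IsWeight h M) {μ : Module.Dual K h} {m : M}
    (hm : m ∈ weightSpace h M μ) (h0 : m ≠ 0) :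
    ∃ F : Module.Dual K M, F m ≠ 0 ∧ ∀ ν, ν ≠ μ → ∀ m ∈ weightSpace h M ν, F m = 0 := by
  obtain ⟨f, hf⟩ : ∃ f : Module.Dual K M, f m ≠ 0 := by
    by_contra! hc
    exact h0 ((Module.forall_dual_apply_eq_zero_iff K m).mp hc)
  obtain ⟨F, h1, h2⟩ := hM.exists_linearMap_single μ f
  exact ⟨F, by rw [h1 m hm]; exact hf, h2⟩

theorem map_mem_weightSpace (p : B →ₗ⁅K,g⁆ M) {ν : Module.Dual K h} {x : B}
    (hx : x ∈ weightSpace h B ν) : p x ∈ weightSpace h M ν := fun t => by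
  rw [← LieModuleHom.map_lie, hx t, map_smul]

theorem mem_weightSpace_of_map_mem (p : B →ₗ⁅K,g⁆ M) (hp : Function.Injective p)
    {ν : Module.Dual K h} {x : B} (hx : p x ∈ weightSpace h M ν) : x ∈ weightSpace h B ν :=
  fun t => hp (by rw [LieModuleHom.map_lie, hx t, map_smul])

theorem IsWeight.of_surjective (hB : IsWeight h B) (p : B →ₗ⁅K,g⁆ M)
    (hp : Function.Surjective p) : IsWeight h M := by
  refine top_le_iff.mp fun m _ => ?_
  obtain ⟨x, rfl⟩ := hp m
  refine hB.induction (P := fun x => p x ∈ ⨆ μ : Module.Dual K h, weightSpace h M μ) ?_ ?_ ?_ x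
  · simp
  · intro x y hx hy
    rw [map_add]; exact Submodule.add_mem _ hx hy
  · intro ν x hx
    exact Submodule.mem_iSup_of_mem ν (map_mem_weightSpace p hx)

/-- Homomorphisms respect weight components, so the `ν`-component of `x` already has the image of
`x`. -/
theorem IsWeight.exists_of_map_mem (hB : IsWeight h B) (hM : IsWeight h M) (p : B →ₗ⁅K,g⁆ M)
    {ν : Module.Dual K h} {x : B} (hx : p x ∈ weightSpace h M ν) :
    ∃ y ∈ weightSpace h B ν, p y = p x := by
  obtain ⟨f, hf, rfl⟩ := hB.exists_sum x
  obtain ⟨G, hG1, hG2⟩ := hM.exists_linearMap_single ν LinearMap.id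
  refine ⟨f ν, hf ν, ?_⟩
  have h1 := hG1 _ hx
  rw [map_sum, map_sum, Finset.sum_eq_single ν] at h1
  · rw [hG1 _ (map_mem_weightSpace p (hf ν))] at h1
    rw [map_sum]; exact h1
  · intro κ _ hκ
    exact hG2 κ hκ _ (map_mem_weightSpace p (hf κ))
  · intro hν
    rw [Finsupp.notMem_support_iff.mp hν]; simp

theorem IsWeight.exists_of_surjective (hB : IsWeight h B) (p : B →ₗ⁅K,g⁆ M)
    (hp : Function.Surjective p) {ν : Module.Dual K h} {m : M} (hm : m ∈ weightSpace h M ν) :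
    ∃ x ∈ weightSpace h B ν, p x = m := by
  obtain ⟨x, rfl⟩ := hp m
  exact hB.exists_of_map_mem (hB.of_surjective p hp) p hm

/-- The image of `p` is stable under `h`, hence contains the weight components of each of its
elements; these pull back along `p`. -/
theorem IsWeight.of_injective (hM : IsWeight h M) (p : B →ₗ⁅K,g⁆ M)
    (hp : Function.Injective p) : IsWeight h B := by
  refine top_le_iff.mp fun b _ => ?_
  obtain ⟨f, hf, hs⟩ := hM.exists_sum (p b)
  have h1 := mem_of_sum_mem_of_eigen (fun μ : Module.Dual K h => weightSpace h M μ)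
    (fun t : h => LieModule.toEnd K g M t) (fun μ t => μ t)
    (fun _ t _ hv => hv t) (fun _ _ hμ => LinearMap.ext fun t => congrFun hμ t)
    (p : B →ₗ[K] M).range
    (by
      rintro t _ ⟨x, rfl⟩
      exact ⟨⁅(t : g), x⁆, LieModuleHom.map_lie p _ _⟩)
    f.support f (fun ν _ => hf ν) ⟨b, hs.symm⟩
  choose! x hx using h1
  have h2 : b = ∑ ν ∈ f.support, x ν := hp (by
    rw [map_sum, ← hs]
    exact Finset.sum_congr rfl fun ν hν => (hx ν hν).symm)
  rw [h2]
  refine Submodule.sum_mem _ fun ν hν => Submodule.mem_iSup_of_mem ν ?_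
  refine mem_weightSpace_of_map_mem p hp ?_
  have := hx ν hν
  change p (x ν) = f ν at this
  rw [this]
  exact hf ν

theorem IsWeight.lieSubmodule (hM : IsWeight h M) (A : LieSubmodule K g M) : IsWeight h A :=
  hM.of_injective A.incl Subtype.val_injective

theorem finite_weightSpace_of_injective (p : B →ₗ⁅K,g⁆ M) (hp : Function.Injective p)
    (ν : Module.Dual K h) [Module.Finite K (weightSpace h M ν)] :
    Module.Finite K (weightSpace h B ν) :=
  Module.Finite.of_injective ((p : B →ₗ[K] M).restrict fun _ hx => map_mem_weightSpace p hx)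
    fun _ _ hxy => Subtype.ext (hp (congrArg Subtype.val hxy))

theorem IsWeight.finite_weightSpace_of_surjective (hB : IsWeight h B) (p : B →ₗ⁅K,g⁆ M)
    (hp : Function.Surjective p) (ν : Module.Dual K h) [Module.Finite K (weightSpace h B ν)] :
    Module.Finite K (weightSpace h M ν) :=
  Module.Finite.of_surjective
    ((p : B →ₗ[K] M).restrict (q := weightSpace h M ν) fun _ hx => map_mem_weightSpace p hx)
    fun ⟨m, hm⟩ => by
      obtain ⟨x, hx, rfl⟩ := hB.exists_of_surjective p hp hm
      exact ⟨⟨x, hx⟩, rfl⟩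

end Weights

end RootReductive

namespace RootReductive

/-! ### Induced modules realized on an enveloping algebra, without a PBW basis. -/

section Enveloping

variable {K : Type*} [Field K] {g : Type*} [LieRing g] [LieAlgebra K g]

attribute [local instance] LieRing.ofAssociativeRing

/-- A subspace of `U(a)` that contains `1` and is stable under left multiplication by `a` is
everything. -/
theorem eq_top_of_one_mem_of_mul_mem {a : Type*} [LieRing a] [LieAlgebra K a]
    (S : Submodule K (UniversalEnvelopingAlgebra K a)) (h1 : 1 ∈ S)
    (hS : ∀ y : a, ∀ w ∈ S, UniversalEnvelopingAlgebra.ι K y * w ∈ S) : S = ⊤ := by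
  -- The multipliers of `S` form a subalgebra containing `a`; by the universal property it is all of
  -- `U(a)`, and multipliers are applied to `1`.
  let T : Subalgebra K (UniversalEnvelopingAlgebra K a) :=
    { carrier := {u | ∀ w ∈ S, u * w ∈ S}
      mul_mem' := fun {u v} hu hv w hw => by rw [mul_assoc]; exact hu _ (hv w hw)
      add_mem' := fun {u v} hu hv w hw => by rw [add_mul]; exact S.add_mem (hu w hw) (hv w hw)
      algebraMap_mem' := fun c w hw => by
        rw [← Algebra.smul_def]; exact S.smul_mem c hw }
  let f : a →ₗ⁅K⁆ T :=
    { toFun := fun y => ⟨UniversalEnvelopingAlgebra.ι K y, hS y⟩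
      map_add' := fun x y => Subtype.ext (map_add (UniversalEnvelopingAlgebra.ι K) x y)
      map_smul' := fun c x => Subtype.ext (map_smul (UniversalEnvelopingAlgebra.ι K) c x)
      map_lie' := fun {x y} => Subtype.ext (LieHom.map_lie (UniversalEnvelopingAlgebra.ι K) x y) }
  have h2 : T.val.comp (UniversalEnvelopingAlgebra.lift K f) =
      AlgHom.id K (UniversalEnvelopingAlgebra K a) := by
    apply UniversalEnvelopingAlgebra.hom_ext
    ext y
    change ((UniversalEnvelopingAlgebra.lift K f) (UniversalEnvelopingAlgebra.ι K y)).1 = _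
    rw [UniversalEnvelopingAlgebra.lift_ι_apply]
    rfl
  refine top_le_iff.mp fun u _ => ?_
  have h3 : u = ((UniversalEnvelopingAlgebra.lift K f) u).1 := (DFunLike.congr_fun h2 u).symm
  have h4 := ((UniversalEnvelopingAlgebra.lift K f) u).2 1 h1
  rw [← h3, mul_one] at h4
  exact h4

/-- If `g = a ⊕ b` for subalgebras `a` and `b`, then each character of `b` extends the left
multiplication of `a` on `U(a)` to an action of `g` in which `b` acts on `1` by the character. -/
theorem exists_induced_action {a b : LieSubalgebra K g}
    (hc : Codisjoint a.toSubmodule b.toSubmodule) (R₀ : g →ₗ[K] UniversalEnvelopingAlgebra K a)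
    (hR₀ : ∀ y : a, R₀ y = UniversalEnvelopingAlgebra.ι K y) (χ : g →ₗ[K] K)
    (hR₀b : ∀ x ∈ b, R₀ x = algebraMap K _ (χ x)) (hχ : ∀ x ∈ b, ∀ y ∈ b, χ ⁅x, y⁆ = 0) :
    ∃ ρ : g →ₗ⁅K⁆ Module.End K (UniversalEnvelopingAlgebra K a),
      (∀ (y : a) w, ρ y w = UniversalEnvelopingAlgebra.ι K y * w) ∧
      ∀ x ∈ b, ρ x 1 = algebraMap K _ (χ x) := by
  let U := UniversalEnvelopingAlgebra K a
  let : LieRingModule a U :=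
    { bracket := fun y w => UniversalEnvelopingAlgebra.ι K y * w
      add_lie := fun x y w => by
        change UniversalEnvelopingAlgebra.ι K (x + y) * w = _
        rw [map_add, add_mul]
      lie_add := fun x v w => mul_add _ _ _
      leibniz_lie := fun x y w => by
        change UniversalEnvelopingAlgebra.ι K x * (UniversalEnvelopingAlgebra.ι K y * w) =
          UniversalEnvelopingAlgebra.ι K ⁅x, y⁆ * w +
          UniversalEnvelopingAlgebra.ι K y * (UniversalEnvelopingAlgebra.ι K x * w)
        rw [LieHom.map_lie, LieRing.of_associative_ring_bracket, sub_mul, mul_assoc, mul_assoc,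
          sub_add_cancel] }
  have hbr : ∀ (y : a) (w : U), ⁅y, w⁆ = UniversalEnvelopingAlgebra.ι K y * w := fun _ _ => rfl
  let : LieModule K a U :=
    { smul_lie := fun c x w => by rw [hbr, hbr, map_smul, smul_mul_assoc]
      lie_smul := fun c x w => mul_smul_comm _ _ _ }
  -- The action of `x` on `w` is to be `R w x`. The relation x(yw) = y(xw) - [y,x]w says that `R`
  -- intertwines left multiplication by `a` with the natural action of `a` on linear maps `g → U`.
  -- So `R w` has to be `w` applied to `R₀`, the prescribed action on `1`.
  let A : U →ₐ[K] Module.End K (g →ₗ[K] U) :=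
    UniversalEnvelopingAlgebra.lift K (LieModule.toEnd K a (g →ₗ[K] U))
  have hA : ∀ (y : a) (f : g →ₗ[K] U) (x : g),
      A (UniversalEnvelopingAlgebra.ι K y) f x =
        UniversalEnvelopingAlgebra.ι K y * f x - f ⁅(y : g), x⁆ := by
    intro y f x
    have h1 : A (UniversalEnvelopingAlgebra.ι K y) = LieModule.toEnd K a (g →ₗ[K] U) y :=
      UniversalEnvelopingAlgebra.lift_ι_apply K _ y
    rw [h1]
    rfl
  let R : U →ₗ[K] (g →ₗ[K] U) := A.toLinearMap.flip R₀
  have hR1 : R 1 = R₀ := by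
    change A 1 R₀ = R₀
    rw [map_one]; rfl
  have hRmul : ∀ (y : a) (w : U) (x : g), R (UniversalEnvelopingAlgebra.ι K y * w) x =
      UniversalEnvelopingAlgebra.ι K y * R w x - R w ⁅(y : g), x⁆ := by
    intro y w x
    change A (UniversalEnvelopingAlgebra.ι K y * w) R₀ x = _
    rw [map_mul]
    exact hA y (A w R₀) x
  have hRa : ∀ (w : U) (y : a), R w y = UniversalEnvelopingAlgebra.ι K y * w := by
    let S : Submodule K U :=
      { carrier := {w | ∀ y : a, R w y = UniversalEnvelopingAlgebra.ι K y * w}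
        zero_mem' := fun y => by simp
        add_mem' := fun {u v} hu hv y => by
          rw [map_add, LinearMap.add_apply, hu y, hv y, mul_add]
        smul_mem' := fun c u hu y => by
          rw [map_smul, LinearMap.smul_apply, hu y, mul_smul_comm] }
    have hS : S = ⊤ := by
      refine eq_top_of_one_mem_of_mul_mem S (fun y => by rw [hR1, hR₀, mul_one]) ?_
      intro z w hw y
      have h1 : ⁅(z : g), (y : g)⁆ = ((⁅z, y⁆ : a) : g) := rfl
      rw [hRmul, hw y, h1, hw, LieHom.map_lie, LieRing.of_associative_ring_bracket, sub_mul,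
        mul_assoc, mul_assoc, sub_sub_cancel]
    exact fun w => (hS ▸ Submodule.mem_top : w ∈ S)
  -- The bracket relation propagates from `w` to `y * w` by the Jacobi identity. At `w = 1`, it
  -- holds by construction when one argument is in `a`, and for two elements of `b` because `χ`
  -- kills their bracket.
  have hlie : ∀ (w : U) (x x' : g), R w ⁅x, x'⁆ = R (R w x') x - R (R w x) x' := by
    let S : Submodule K U :=
      { carrier := {w | ∀ x x' : g, R w ⁅x, x'⁆ = R (R w x') x - R (R w x) x'}
        zero_mem' := fun x x' => by simp
        add_mem' := fun {u v} hu hv x x' => by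
          simp only [map_add, LinearMap.add_apply, hu x x', hv x x']; abel
        smul_mem' := fun c u hu x x' => by
          simp only [map_smul, LinearMap.smul_apply, hu x x', smul_sub] }
    have hS : S = ⊤ := by
      refine eq_top_of_one_mem_of_mul_mem S ?_ ?_
      · intro x x'
        have hmix : ∀ (y : a) (x : g) (w : U), R w ⁅(y : g), x⁆ = R (R w x) y - R (R w y) x := by
          intro y x w
          rw [hRa, hRa, hRmul, sub_sub_cancel]
        have hdec : ∀ x : g, ∃ (y : a) (z : b), x = (y : g) + z := by
          intro x
          obtain ⟨y, hy, z, hz, rfl⟩ := Submodule.mem_sup.mp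
            ((codisjoint_iff.mp hc).symm ▸ Submodule.mem_top : x ∈ a.toSubmodule ⊔ b.toSubmodule)
          exact ⟨⟨y, hy⟩, ⟨z, hz⟩, rfl⟩
        obtain ⟨y, z, rfl⟩ := hdec x
        obtain ⟨y', z', rfl⟩ := hdec x'
        have hzz : R 1 ⁅(z : g), (z' : g)⁆ = R (R 1 (z' : g)) z - R (R 1 (z : g)) z' := by
          rw [hR1, hR₀b _ (b.lie_mem z.2 z'.2), hχ _ z.2 _ z'.2, hR₀b _ z.2, hR₀b _ z'.2,
            Algebra.algebraMap_eq_smul_one, Algebra.algebraMap_eq_smul_one,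
            Algebra.algebraMap_eq_smul_one, map_smul, map_smul, hR1, LinearMap.smul_apply,
            LinearMap.smul_apply, hR₀b _ z.2, hR₀b _ z'.2, Algebra.algebraMap_eq_smul_one,
            Algebra.algebraMap_eq_smul_one, smul_smul, smul_smul, mul_comm, zero_smul, sub_self]
        have hzy : R 1 ⁅(z : g), (y' : g)⁆ = R (R 1 (y' : g)) z - R (R 1 (z : g)) y' := by
          rw [← lie_skew, map_neg, hmix]; abel
        rw [add_lie, lie_add, lie_add, map_add, map_add, map_add, hmix, hmix, hzz, hzy]
        simp only [map_add, LinearMap.add_apply]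
        abel
      · intro y w hw x x'
        have e1 : R (R (UniversalEnvelopingAlgebra.ι K y * w) x') x =
            UniversalEnvelopingAlgebra.ι K y * R (R w x') x - R (R w x') ⁅(y : g), x⁆ -
              R (R w ⁅(y : g), x'⁆) x := by
          rw [hRmul y w x', map_sub, LinearMap.sub_apply, hRmul]
        have e2 : R (R (UniversalEnvelopingAlgebra.ι K y * w) x) x' =
            UniversalEnvelopingAlgebra.ι K y * R (R w x) x' - R (R w x) ⁅(y : g), x'⁆ -
              R (R w ⁅(y : g), x⁆) x' := by
          rw [hRmul y w x, map_sub, LinearMap.sub_apply, hRmul]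
        rw [e1, e2, hRmul, hw x x', leibniz_lie, map_add, hw ⁅(y : g), x⁆ x',
            hw x ⁅(y : g), x'⁆, mul_sub]
        abel
    exact fun w => (hS ▸ Submodule.mem_top : w ∈ S)
  refine ⟨{ toLinearMap := R.flip, map_lie' := fun {x x'} => ?_ }, fun y w => hRa w y,
    fun x hx => ?_⟩
  · ext w
    exact hlie w x x'
  · change R 1 x = _
    rw [hR1, hR₀b x hx]

/-- If `g = a ⊕ b` for subalgebras `a` and `b`, and `χ` restricts to a character of `b`, then
`U(g)` maps to `U(a)` compatibly with left multiplication by `a` and with right multiplication by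
`b`, which acts through `χ`. -/
theorem exists_enveloping_projection {a b : LieSubalgebra K g}
    (hc : IsCompl a.toSubmodule b.toSubmodule) (χ : g →ₗ[K] K)
    (hχ : ∀ x ∈ b, ∀ y ∈ b, χ ⁅x, y⁆ = 0) :
    ∃ Ψ : UniversalEnvelopingAlgebra K g →ₗ[K] UniversalEnvelopingAlgebra K a, Ψ 1 = 1 ∧
      (∀ (y : a) u, Ψ (UniversalEnvelopingAlgebra.ι K (y : g) * u) =
        UniversalEnvelopingAlgebra.ι K y * Ψ u) ∧
      ∀ x ∈ b, ∀ u, Ψ (u * UniversalEnvelopingAlgebra.ι K x) = χ x • Ψ u := by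
  let pa : g →ₗ[K] a := Submodule.projectionOnto _ _ hc
  let R₀ : g →ₗ[K] UniversalEnvelopingAlgebra K a :=
    ((UniversalEnvelopingAlgebra.ι K : a →ₗ⁅K⁆ UniversalEnvelopingAlgebra K a) :
      a →ₗ[K] UniversalEnvelopingAlgebra K a).comp pa +
      (Algebra.linearMap K _).comp (χ.comp (b.toSubmodule.subtype.comp
        (Submodule.projectionOnto _ _ hc.symm)))
  obtain ⟨ρ, h1, h2⟩ := exists_induced_action hc.codisjoint R₀ (fun y => by
      change UniversalEnvelopingAlgebra.ι K (pa y) + algebraMap K _ (χ (b.toSubmodule.subtype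
        (Submodule.projectionOnto _ _ hc.symm (y : g)))) = _
      have e1 : pa (y : g) = y := Submodule.projectionOnto_apply_left hc y
      have e2 : Submodule.projectionOnto _ _ hc.symm (y : g) = 0 :=
        (Submodule.projectionOnto_apply_eq_zero_iff _).mpr y.2
      rw [e1, e2]; simp) χ (fun x hx => by
      change UniversalEnvelopingAlgebra.ι K (pa x) + algebraMap K _ (χ (b.toSubmodule.subtype
        (Submodule.projectionOnto _ _ hc.symm x))) = _
      have e1 : pa x = 0 := (Submodule.projectionOnto_apply_eq_zero_iff _).mpr hx
      have e2 : Submodule.projectionOnto _ _ hc.symm x = ⟨x, hx⟩ :=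
        Submodule.projectionOnto_apply_left hc.symm ⟨x, hx⟩
      rw [e1, e2, map_zero, zero_add]; rfl) hχ
  -- The projection sends `u` to the result of `u` acting on `1`.
  refine ⟨(UniversalEnvelopingAlgebra.lift K ρ).toLinearMap.flip 1, ?_, ?_, ?_⟩
  · change (UniversalEnvelopingAlgebra.lift K ρ 1 : Module.End K _) 1 = 1
    rw [map_one (UniversalEnvelopingAlgebra.lift K ρ)]; rfl
  · intro y u
    change (UniversalEnvelopingAlgebra.lift K ρ) (_ * u) 1 = _
    rw [map_mul, UniversalEnvelopingAlgebra.lift_ι_apply, Module.End.mul_apply, h1]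
    rfl
  · intro x hx u
    change (UniversalEnvelopingAlgebra.lift K ρ) (u * _) 1 = _
    rw [map_mul, UniversalEnvelopingAlgebra.lift_ι_apply, Module.End.mul_apply, h2 x hx,
      Algebra.algebraMap_eq_smul_one, map_smul]
    rfl

end Enveloping

end RootReductive

namespace RootReductive

/-! ### Structure of h, b, n and n⁻; the cone of simple roots; characters. -/

section Structure

variable {K : Type*} [Field K] {g : Type*} [LieRing g] [LieAlgebra K g] {h b : LieSubalgebra K g}

/-- A toral subalgebra is abelian. -/
theorem IsToral.lie_eq_zero (hT : IsToral h) {x y : g} (hx : x ∈ h) (hy : y ∈ h) :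
    ⁅x, y⁆ = 0 := by
  have hdec : ∀ x ∈ h, ∀ y : g, ∃ f : K →₀ g, (∀ c, ⁅x, f c⁆ = c • f c) ∧
      ∑ c ∈ f.support, f c = y := by
    intro x hx y
    have : y ∈ ⨆ c : K, Module.End.eigenspace (LieAlgebra.ad K g x) c := by rw [hT x hx]; trivial
    obtain ⟨f, hf, hs⟩ := (Submodule.mem_iSup_iff_exists_finsupp _ _).mp this
    exact ⟨f, fun c => Module.End.mem_eigenspace_iff.mp (hf c), hs⟩
  have key : ∀ x : g, ∀ A : Submodule K g, (∀ a ∈ A, ⁅x, a⁆ ∈ A) → ∀ (s : Finset K) (v : K → g),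
      (∀ c ∈ s, ⁅x, v c⁆ = c • v c) → ∑ c ∈ s, v c ∈ A → ∀ c ∈ s, v c ∈ A := by
    intro x A hA s v hv hs
    refine mem_of_sum_mem_of_eigen
      (fun c : K => Module.End.eigenspace (LieAlgebra.ad K g x) c)
      (fun _ : Unit => LieAlgebra.ad K g x) (fun c _ => c)
      (fun c _ v hv => Module.End.mem_eigenspace_iff.mp hv) (fun c d hcd => congrFun hcd ())
      A (fun _ a ha => hA a ha) s v
      (fun c hc => Module.End.mem_eigenspace_iff.mpr (hv c hc)) hs
  -- Since `h` is stable under `ad x`, the eigencomponents of `y` lie in `h` and are therefore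
  -- themselves `ad`-diagonalizable.
  obtain ⟨f, hf, hs⟩ := hdec x hx y
  have hfh := key x h.toSubmodule (fun a ha => h.lie_mem hx ha) f.support f (fun c _ => hf c)
    (by rw [hs]; exact hy)
  rw [← hs, lie_sum]
  refine Finset.sum_eq_zero fun c hc => ?_
  obtain ⟨e, he, hes⟩ := hdec (f c) (hfh c hc) x
  -- The bracket of an eigenvector `f c` with `x` is a multiple of `f c`, so `ad (f c)` squared
  -- kills `x`. A diagonalizable operator whose square kills `x` kills `x`.
  have h1 : ∑ d ∈ e.support, (d * d) • e d = 0 := by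
    have h2 : ⁅f c, ⁅f c, x⁆⁆ = 0 := by
      rw [← lie_skew (f c) x, hf c, lie_neg, lie_smul, lie_self, smul_zero, neg_zero]
    rw [← hes, lie_sum, lie_sum] at h2
    rw [← h2]
    refine Finset.sum_congr rfl fun d _ => ?_
    rw [he, lie_smul, he, smul_smul]
  have h3 := key (f c) ⊥ (by simp) e.support (fun d => (d * d) • e d)
    (fun d _ => by rw [lie_smul, he, smul_comm]) (by rw [h1]; exact zero_mem _)
  rw [← lie_skew, ← hes, lie_sum, neg_eq_zero]
  refine Finset.sum_eq_zero fun d hd => ?_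
  rw [he]
  have h4 := h3 d hd
  simp only [Submodule.mem_bot, smul_eq_zero, mul_self_eq_zero] at h4
  rwa [smul_eq_zero]

theorem IsSplittingMaximalToral.le_rootSpace_zero (hh : IsSplittingMaximalToral h) :
    h.toSubmodule ≤ rootSpace h 0 := fun x hx t => by
  rw [hh.maximal.prop.lie_eq_zero t.2 hx, LinearMap.zero_apply, zero_smul]

theorem IsSplittingMaximalToral.isWeight (hh : IsSplittingMaximalToral h) : IsWeight h g := by
  refine top_le_iff.mp ?_
  rw [← hh.splitting]
  exact sup_le (hh.le_rootSpace_zero.trans (le_iSup (fun α => rootSpace h α) 0))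
    (iSup_le fun α => iSup_le fun _ => le_iSup (fun α => rootSpace h α) α)

/-- By the splitting, an element of weight zero is an element of `h` plus a sum of root vectors;
that sum has weight zero, so independence of weight spaces makes it vanish. -/
theorem IsSplittingMaximalToral.rootSpace_zero (hh : IsSplittingMaximalToral h) :
    rootSpace h (0 : Module.Dual K h) = h.toSubmodule := by
  refine le_antisymm (fun x hx => ?_) hh.le_rootSpace_zero
  obtain ⟨t, ht, r, hr, hs⟩ := Submodule.mem_sup.mp
    (hh.splitting.symm ▸ Submodule.mem_top : x ∈ h.toSubmodule ⊔ _)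
  by_cases h0 : r = 0
  · rw [← hs, h0, add_zero]; exact ht
  · have h1 : r ∈ rootSpace h (0 : Module.Dual K h) := by
      rw [← add_sub_cancel_left t r, hs]
      exact Submodule.sub_mem _ hx (hh.le_rootSpace_zero ht)
    exact absurd rfl (exists_eq_of_mem_iSup (I := {α | IsRoot h α}) h1 h0 hr).1

/-- Brackets of sums of root spaces. -/
theorem lie_mem_of_mem_iSup {S T : Set (Module.Dual K h)} {R : Submodule K g}
    (H : ∀ α ∈ S, ∀ β ∈ T, ∀ x ∈ rootSpace h α, ∀ y ∈ rootSpace h β, ⁅x, y⁆ ∈ R) {x y : g}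
    (hx : x ∈ ⨆ α ∈ S, rootSpace h α) (hy : y ∈ ⨆ β ∈ T, rootSpace h β) : ⁅x, y⁆ ∈ R := by
  have h1 : ∀ α ∈ S, ∀ x ∈ rootSpace h α, ⁅x, y⁆ ∈ R := by
    intro α hα x hx
    have : ⨆ β ∈ T, rootSpace h β ≤ R.comap (LieAlgebra.ad K g x) :=
      iSup₂_le fun β hβ y hy => H α hα β hβ x hx y hy
    exact this hy
  have : ⨆ α ∈ S, rootSpace h α ≤ R.comap (LieAlgebra.ad K g y) :=
    iSup₂_le fun α hα x hx => by
      change ⁅y, x⁆ ∈ R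
      rw [← lie_skew]
      exact R.neg_mem (h1 α hα x hx)
  have h2 : ⁅y, x⁆ ∈ R := this hx
  rw [← lie_skew]
  exact R.neg_mem h2

theorem IsPosRoot.ne_zero {α : Module.Dual K h} (hα : IsPosRoot h b α) : α ≠ 0 := hα.1.1

theorem IsBorel.toSubmodule_eq (hh : IsSplittingMaximalToral h) (hb : IsBorel h b) :
    b.toSubmodule = ⨆ α ∈ {α : Module.Dual K h | α = 0 ∨ IsPosRoot h b α}, rootSpace h α := by
  rw [hb.eq_sum, ← hh.rootSpace_zero]
  refine le_antisymm (sup_le ?_ (iSup₂_le fun α hα => ?_)) (iSup₂_le fun α hα => ?_)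
  · exact le_iSup₂_of_le (f := fun (α : Module.Dual K h)
      (_ : α ∈ {α : Module.Dual K h | α = 0 ∨ IsPosRoot h b α}) => rootSpace h α) 0 (Or.inl rfl)
      le_rfl
  · exact le_iSup₂_of_le (f := fun (α : Module.Dual K h)
      (_ : α ∈ {α : Module.Dual K h | α = 0 ∨ IsPosRoot h b α}) => rootSpace h α) α (Or.inr hα)
      le_rfl
  · rcases hα with rfl | hα
    · exact le_sup_left
    · exact le_sup_of_le_right (le_iSup₂_of_le (f := fun (α : Module.Dual K h)
        (_ : IsPosRoot h b α) => rootSpace h α) α hα le_rfl)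

theorem IsBorel.not_isPosRoot_neg (hb : IsBorel h b) {α : Module.Dual K h}
    (hα : IsPosRoot h b α) : ¬ IsPosRoot h b (-α) := by
  rcases hb.triangular α hα.1 with h1 | h1
  · exact h1.2
  · exact absurd hα h1.2

theorem IsBorel.isPosRoot_of_mem (hh : IsSplittingMaximalToral h) (hb : IsBorel h b)
    {α : Module.Dual K h} {x : g} (hx : x ∈ rootSpace h α) (h0 : x ≠ 0) (hxb : x ∈ b)
    (hα : α ≠ 0) : IsPosRoot h b α := by
  have : x ∈ b.toSubmodule := hxb
  rw [hb.toSubmodule_eq hh] at this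
  exact (exists_eq_of_mem_iSup hx h0 this).resolve_left hα

theorem IsBorel.isPosRoot_add (hh : IsSplittingMaximalToral h) (hb : IsBorel h b)
    {α β : Module.Dual K h} {x y : g} (hα : IsPosRoot h b α) (hβ : IsPosRoot h b β)
    (hx : x ∈ rootSpace h α) (hy : y ∈ rootSpace h β) (h0 : ⁅x, y⁆ ≠ 0) :
    IsPosRoot h b (α + β) := by
  refine hb.isPosRoot_of_mem hh (lie_mem_weightSpace hx hy) h0
    (b.lie_mem (hα.2 hx) (hβ.2 hy)) fun h1 => ?_
  rw [eq_neg_of_add_eq_zero_left h1] at hα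
  exact hb.not_isPosRoot_neg hβ hα

/-- A root vector is recovered from its bracket with some `t` in `h` on which the root is nonzero.
-/
theorem IsBorel.rootSpace_le_nilPart (hb : IsBorel h b)
    {α : Module.Dual K h} (hα : IsPosRoot h b α) : rootSpace h α ≤ (nilPart b).toSubmodule := by
  intro x hx
  obtain ⟨t, ht⟩ : ∃ t : h, α t ≠ 0 := by
    by_contra! hc
    exact hα.ne_zero (LinearMap.ext hc)
  have htb : (t : g) ∈ b := by
    have : (t : g) ∈ b.toSubmodule := by rw [hb.eq_sum]; exact Submodule.mem_sup_left t.2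
    exact this
  have h1 : ⁅(t : g), x⁆ ∈ (nilPart b).toSubmodule :=
    LieSubalgebra.subset_lieSpan ⟨_, htb, _, hα.2 hx, rfl⟩
  rw [hx t] at h1
  exact (Submodule.smul_mem_iff _ ht).mp h1

/-- The positive root spaces span a subalgebra, since two positive roots never sum to zero, and `h`
is abelian; so every bracket from `b` lands in it. -/
theorem IsBorel.nilPart_eq (hh : IsSplittingMaximalToral h) (hb : IsBorel h b) :
    (nilPart b).toSubmodule = ⨆ α ∈ {α : Module.Dual K h | IsPosRoot h b α}, rootSpace h α := by
  refine le_antisymm ?_ (iSup₂_le fun α hα => hb.rootSpace_le_nilPart hα)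
  have hpos : ∀ α, IsPosRoot h b α → rootSpace h α ≤
      ⨆ α ∈ {α : Module.Dual K h | IsPosRoot h b α}, rootSpace h α := fun α hα =>
    le_iSup₂_of_le (f := fun (α : Module.Dual K h)
      (_ : α ∈ {α : Module.Dual K h | IsPosRoot h b α}) => rootSpace h α) α hα le_rfl
  have hadd : ∀ α, IsPosRoot h b α → ∀ β, IsPosRoot h b β → ∀ x ∈ rootSpace h α,
      ∀ y ∈ rootSpace h β, ⁅x, y⁆ ∈
        ⨆ α ∈ {α : Module.Dual K h | IsPosRoot h b α}, rootSpace h α := by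
    intro α hα β hβ x hx y hy
    by_cases h0 : ⁅x, y⁆ = 0
    · rw [h0]; exact zero_mem _
    · exact hpos _ (hb.isPosRoot_add hh hα hβ hx hy h0) (lie_mem_weightSpace hx hy)
  let P : LieSubalgebra K g :=
    { toSubmodule := ⨆ α ∈ {α : Module.Dual K h | IsPosRoot h b α}, rootSpace h α
      lie_mem' := fun hx hy => lie_mem_of_mem_iSup hadd hx hy }
  refine (LieSubalgebra.lieSpan_le (K := P)).mpr ?_
  rintro _ ⟨x, hx, y, hy, rfl⟩
  change ⁅x, y⁆ ∈ ⨆ α ∈ {α : Module.Dual K h | IsPosRoot h b α}, rootSpace h α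
  have hx' : x ∈ b.toSubmodule := hx
  have hy' : y ∈ b.toSubmodule := hy
  rw [hb.toSubmodule_eq hh] at hx' hy'
  refine lie_mem_of_mem_iSup ?_ hx' hy'
  rintro α hα β hβ x hx y hy
  rcases hα with rfl | hα
  · rcases hβ with rfl | hβ
    · rw [hh.rootSpace_zero] at hx hy
      rw [hh.maximal.prop.lie_eq_zero hx hy]
      exact zero_mem _
    · have := lie_mem_weightSpace hx hy
      rw [zero_add] at this
      exact hpos _ hβ this
  · rcases hβ with rfl | hβ
    · have := lie_mem_weightSpace hx hy
      rw [add_zero] at this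
      exact hpos _ hα this
    · exact hadd α hα β hβ x hx y hy

/-- The opposite nilpotent subalgebra, the image of `[b, b]` under the transpose map. -/
def negPart (τ : Transpose h) (b : LieSubalgebra K g) : LieSubalgebra K g where
  toSubmodule := (nilPart b).toSubmodule.comap τ.toFun
  lie_mem' := fun {x y} hx hy => by
    change τ.toFun ⁅x, y⁆ ∈ nilPart b
    rw [τ.map_lie]
    exact (nilPart b).lie_mem hy hx

theorem mem_negPart {τ : Transpose h} {x : g} : x ∈ negPart τ b ↔ τ.toFun x ∈ nilPart b := Iff.rfl

theorem Transpose.mem_rootSpace (τ : Transpose h) {α : Module.Dual K h} {x : g}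
    (hx : x ∈ rootSpace h (-α)) : τ.toFun x ∈ rootSpace h α := by
  have := τ.mem_rootSpace_neg hx
  rwa [neg_neg] at this

theorem IsBorel.rootSpace_neg_le_negPart (hb : IsBorel h b)
    (τ : Transpose h) {α : Module.Dual K h} (hα : IsPosRoot h b α) :
    rootSpace h (-α) ≤ (negPart τ b).toSubmodule := fun _ hx =>
  hb.rootSpace_le_nilPart hα (τ.mem_rootSpace hx)

theorem IsBorel.negPart_eq (hh : IsSplittingMaximalToral h) (hb : IsBorel h b)
    (τ : Transpose h) : (negPart τ b).toSubmodule =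
      ⨆ α ∈ {α : Module.Dual K h | IsPosRoot h b (-α)}, rootSpace h α := by
  refine le_antisymm (fun x hx => ?_) (iSup₂_le fun α hα => ?_)
  · have h1 : τ.toFun x ∈ (nilPart b).toSubmodule := hx
    rw [hb.nilPart_eq hh] at h1
    have h2 : ⨆ α ∈ {α : Module.Dual K h | IsPosRoot h b α}, rootSpace h α ≤
        (⨆ α ∈ {α : Module.Dual K h | IsPosRoot h b (-α)}, rootSpace h α).comap τ.toFun := by
      refine iSup₂_le fun α hα y hy => ?_
      refine le_iSup₂_of_le (f := fun (α : Module.Dual K h)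
        (_ : α ∈ {α : Module.Dual K h | IsPosRoot h b (-α)}) => rootSpace h α) (-α) ?_ le_rfl
        (τ.mem_rootSpace_neg hy)
      simpa using hα
    have h3 : τ.toFun (τ.toFun x) ∈
        ⨆ α ∈ {α : Module.Dual K h | IsPosRoot h b (-α)}, rootSpace h α := h2 h1
    rwa [τ.involutive] at h3
  · have := hb.rootSpace_neg_le_negPart τ hα
    rwa [neg_neg] at this

/-- Replaces the triangular decomposition of `g`: each root is positive or the negative of a
positive root, never both, and weight spaces are independent. -/
theorem IsBorel.isCompl_negPart (hh : IsSplittingMaximalToral h) (hb : IsBorel h b)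
    (τ : Transpose h) : IsCompl (negPart τ b).toSubmodule b.toSubmodule := by
  constructor
  · rw [hb.negPart_eq hh, hb.toSubmodule_eq hh]
    refine (iSupIndep_weightSpace h g).disjoint_biSup_biSup ?_
    rw [Set.disjoint_left]
    rintro α hα (rfl | hα')
    · exact hα.ne_zero neg_zero
    · exact hb.not_isPosRoot_neg hα' hα
  · rw [codisjoint_iff_le_sup, ← hh.splitting]
    refine sup_le (le_sup_of_le_right (by rw [hb.eq_sum]; exact le_sup_left))
      (iSup₂_le fun α hα => ?_)
    rcases hb.triangular α hα with h1 | h1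
    · exact le_sup_of_le_right h1.1.2
    · refine le_sup_of_le_left ?_
      rw [← neg_neg α]
      exact hb.rootSpace_neg_le_negPart τ h1.1

/-- The cone generated by the simple roots. -/
def cone (h b : LieSubalgebra K g) : AddSubmonoid (Module.Dual K h) :=
  AddSubmonoid.closure {α | IsSimpleRoot h b α}

/-- The Dynkin hypothesis enters here: the weight spaces of `g` with weight in the cone span a
subalgebra containing all generators of `b`. -/
theorem IsDynkinBorel.mem_cone (hh : IsSplittingMaximalToral h) (hb : IsDynkinBorel h b)
    {α : Module.Dual K h} (hα : IsPosRoot h b α) : α ∈ cone h b := by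
  have hle : ∀ γ ∈ (cone h b : Set (Module.Dual K h)), rootSpace h γ ≤
      ⨆ γ ∈ (cone h b : Set (Module.Dual K h)), rootSpace h γ := fun γ hγ =>
    le_iSup₂_of_le (f := fun (γ : Module.Dual K h)
      (_ : γ ∈ (cone h b : Set (Module.Dual K h))) => rootSpace h γ) γ hγ le_rfl
  let P : LieSubalgebra K g :=
    { toSubmodule := ⨆ γ ∈ (cone h b : Set (Module.Dual K h)), rootSpace h γ
      lie_mem' := fun hx hy => lie_mem_of_mem_iSup
        (fun α hα β hβ x hx y hy =>
          hle (α + β) ((cone h b).add_mem hα hβ) (lie_mem_weightSpace hx hy)) hx hy }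
  have hP : b ≤ P := by
    rw [hb.generated, LieSubalgebra.lieSpan_le]
    rintro x (hx | hx)
    · exact hle 0 (cone h b).zero_mem (hh.le_rootSpace_zero hx)
    · obtain ⟨α, hα, hx⟩ := Set.mem_iUnion₂.mp hx
      exact hle α (AddSubmonoid.subset_closure hα) hx
  obtain ⟨x, hx, h0⟩ := (Submodule.ne_bot_iff _).mp hα.1.2
  exact exists_eq_of_mem_iSup hx h0 (hP (hα.2 hx))

/-- A weight of `h` extends to a functional on `g` that vanishes on `[b, b]`. -/
theorem IsBorel.exists_character (hh : IsSplittingMaximalToral h) (hb : IsBorel h b)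
    (lam : Module.Dual K h) : ∃ χ : g →ₗ[K] K, (∀ t : h, χ t = lam t) ∧
      ∀ x ∈ nilPart b, χ x = 0 := by
  obtain ⟨f, hf⟩ := LinearMap.exists_extend (p := h.toSubmodule) lam
  obtain ⟨χ, h1, h2⟩ := hh.isWeight.exists_linearMap_single 0 f
  refine ⟨χ, fun t => ?_, fun x hx => ?_⟩
  · rw [h1 _ (hh.le_rootSpace_zero t.2)]
    exact LinearMap.congr_fun hf t
  · have hx' : x ∈ (nilPart b).toSubmodule := hx
    rw [hb.nilPart_eq hh] at hx'
    have : ⨆ α ∈ {α : Module.Dual K h | IsPosRoot h b α}, rootSpace h α ≤ LinearMap.ker χ :=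
      iSup₂_le fun α hα x hx => h2 α hα.ne_zero x hx
    exact this hx'

/-- There is a character of the opposite nilpotent subalgebra that is nonzero on each of the
root spaces `g^{-α}` with `α` simple. -/
theorem IsBorel.exists_generic_character (hh : IsSplittingMaximalToral h) (hb : IsBorel h b)
    (τ : Transpose h) : ∃ ξ : g →ₗ[K] K,
      (∀ α, IsSimpleRoot h b α → ∃ y ∈ rootSpace h (-α), ξ y ≠ 0) ∧
      ∀ y ∈ negPart τ b, ∀ z ∈ negPart τ b, ξ ⁅y, z⁆ = 0 := by
  classical
  have h1 : ∀ α, IsSimpleRoot h b α → ∃ y ∈ rootSpace h (-α), ∃ f : g →ₗ[K] K, f y ≠ 0 := by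
    intro α hα
    obtain ⟨x, hx, h0⟩ := (Submodule.ne_bot_iff _).mp hα.1.1.2
    refine ⟨τ.toFun x, τ.mem_rootSpace_neg hx, ?_⟩
    by_contra! hc
    have := (Module.forall_dual_apply_eq_zero_iff K (τ.toFun x)).mp hc
    rw [← τ.involutive x, this, map_zero] at h0
    exact h0 rfl
  choose! y hy f hf using h1
  -- Supported on the root spaces of negatives of simple roots, with no condition linking different
  -- roots.
  obtain ⟨ξ, hξ⟩ := hh.isWeight.exists_linearMap
    (fun ν => if IsSimpleRoot h b (-ν) then f (-ν) else 0)
  refine ⟨ξ, fun α hα => ⟨y α, hy α hα, ?_⟩, fun u hu v hv => ?_⟩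
  · rw [hξ _ _ (hy α hα), neg_neg, if_pos hα]
    exact hf α hα
  · have hu' : u ∈ (negPart τ b).toSubmodule := hu
    have hv' : v ∈ (negPart τ b).toSubmodule := hv
    rw [hb.negPart_eq hh] at hu' hv'
    refine lie_mem_of_mem_iSup (R := LinearMap.ker ξ) ?_ hu' hv'
    intro α hα β hβ x hx y hy
    rw [LinearMap.mem_ker, hξ _ _ (lie_mem_weightSpace hx hy), if_neg]
    · rfl
    -- A bracket of two negative root vectors cannot meet the support of `ξ`: that would write a
    -- simple root as a sum of two positive roots.
    · rintro ⟨_, h2⟩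
      exact h2 ⟨-α, -β, hα, hβ, by rw [neg_add]⟩

end Structure

end RootReductive

namespace RootReductive

/-! ### Verma modules: universal property, weights, pointedness of the cone. -/

section VermaModules

variable {K : Type*} [Field K] {g : Type*} [LieRing g] [LieAlgebra K g] {h b : LieSubalgebra K g}
  {M : Type*} [AddCommGroup M] [Module K M] [LieRingModule g M] [LieModule K g M]

attribute [local instance] LieRing.ofAssociativeRing

theorem IsBorel.lie_mem_of_mem_negPart (hh : IsSplittingMaximalToral h) (hb : IsBorel h b)
    (τ : Transpose h) {S : Submodule K M} {m : M}
    (hS : ∀ α, IsPosRoot h b α → ∀ y ∈ rootSpace h (-α), ⁅y, m⁆ ∈ S) {y : g}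
    (hy : y ∈ negPart τ b) : ⁅y, m⁆ ∈ S := by
  have hy' : y ∈ (negPart τ b).toSubmodule := hy
  rw [hb.negPart_eq hh] at hy'
  have : ⨆ α ∈ {α : Module.Dual K h | IsPosRoot h b (-α)}, rootSpace h α ≤
      S.comap ((LieModule.toEnd K g M : g →ₗ[K] Module.End K M).flip m) :=
    iSup₂_le fun α hα y hy => hS (-α) hα y (by rwa [neg_neg])
  exact this hy'

theorem IsBorel.lie_mem_of_mem_nilPart (hh : IsSplittingMaximalToral h) (hb : IsBorel h b)
    {S : Submodule K M} {m : M}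
    (hS : ∀ α, IsPosRoot h b α → ∀ x ∈ rootSpace h α, ⁅x, m⁆ ∈ S) {x : g}
    (hx : x ∈ nilPart b) : ⁅x, m⁆ ∈ S := by
  have hx' : x ∈ (nilPart b).toSubmodule := hx
  rw [hb.nilPart_eq hh] at hx'
  have : ⨆ α ∈ {α : Module.Dual K h | IsPosRoot h b α}, rootSpace h α ≤
      S.comap ((LieModule.toEnd K g M : g →ₗ[K] Module.End K M).flip m) :=
    iSup₂_le fun α hα y hy => hS α hα y hy
  exact this hx'

namespace Verma

variable {lam : Module.Dual K h}

variable (h b lam) in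
/-- The image of `u ∈ U(g)` in the Verma module. -/
def mk (u : UniversalEnvelopingAlgebra K g) : Verma h b lam :=
  Submodule.Quotient.mk (p := vermaIdeal h b lam) u

variable (h b lam) in
/-- The canonical generator of the Verma module. -/
def gen : Verma h b lam := mk h b lam 1

theorem lie_mk (x : g) (u : UniversalEnvelopingAlgebra K g) :
    ⁅x, mk h b lam u⁆ = mk h b lam (UniversalEnvelopingAlgebra.ι K x * u) := rfl

theorem mk_surjective : Function.Surjective (mk h b lam) :=
  Submodule.Quotient.mk_surjective _

theorem mk_eq_zero {u : UniversalEnvelopingAlgebra K g} :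
    mk h b lam u = 0 ↔ u ∈ vermaIdeal h b lam :=
  Submodule.Quotient.mk_eq_zero _

theorem lie_gen_of_mem_nilPart {x : g} (hx : x ∈ nilPart b) : ⁅x, gen h b lam⁆ = 0 := by
  rw [gen, lie_mk, mul_one, mk_eq_zero]
  exact Submodule.subset_span (Or.inl ⟨x, hx, rfl⟩)

theorem gen_mem_weightSpace : gen h b lam ∈ weightSpace h (Verma h b lam) lam := by
  intro t
  have h1 : mk h b lam (UniversalEnvelopingAlgebra.ι K (t : g) -
      algebraMap K (UniversalEnvelopingAlgebra K g) (lam t)) = 0 :=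
    mk_eq_zero.mpr (Submodule.subset_span (Or.inr ⟨t, rfl⟩))
  have h2 : mk h b lam (UniversalEnvelopingAlgebra.ι K (t : g)) -
      mk h b lam (algebraMap K _ (lam t)) = 0 := h1
  rw [gen, lie_mk, mul_one, sub_eq_zero.mp h2, Algebra.algebraMap_eq_smul_one]
  rfl

/-- The Verma module is generated by its canonical generator. -/
theorem eq_top_of_gen_mem {S : Submodule K (Verma h b lam)} (h1 : gen h b lam ∈ S)
    (hS : ∀ x : g, ∀ m ∈ S, ⁅x, m⁆ ∈ S) : S = ⊤ := by
  let T : Submodule K (UniversalEnvelopingAlgebra K g) :=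
    { carrier := {u | mk h b lam u ∈ S}
      zero_mem' := S.zero_mem
      add_mem' := fun hu hv => S.add_mem hu hv
      smul_mem' := fun c _ hu => S.smul_mem c hu }
  have hT : T = ⊤ := eq_top_of_one_mem_of_mul_mem T h1 fun y w hw => hS y _ hw
  refine top_le_iff.mp fun m _ => ?_
  obtain ⟨u, rfl⟩ := mk_surjective m
  exact (hT ▸ Submodule.mem_top : u ∈ T)

theorem hom_ext {φ ψ : Verma h b lam →ₗ⁅K,g⁆ M} (hφ : φ (gen h b lam) = ψ (gen h b lam)) :
    φ = ψ := by
  have : LinearMap.eqLocus (φ : Verma h b lam →ₗ[K] M) (ψ : Verma h b lam →ₗ[K] M) = ⊤ := by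
    refine eq_top_of_gen_mem hφ fun x m hm => ?_
    change φ ⁅x, m⁆ = ψ ⁅x, m⁆
    have hm' : φ m = ψ m := hm
    rw [LieModuleHom.map_lie, LieModuleHom.map_lie, hm']
  exact LieModuleHom.ext fun m => (this ▸ Submodule.mem_top : m ∈ LinearMap.eqLocus
    (φ : Verma h b lam →ₗ[K] M) (ψ : Verma h b lam →ₗ[K] M))

/-- A linear map on `U(g)` that vanishes on the left ideal of the Verma module descends to it. -/
theorem exists_linearMap_mk {V : Type*} [AddCommGroup V] [Module K V]
    (F : UniversalEnvelopingAlgebra K g →ₗ[K] V)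
    (hn : ∀ x ∈ nilPart b, ∀ u, F (u * UniversalEnvelopingAlgebra.ι K x) = 0)
    (ht : ∀ t : h, ∀ u, F (u * UniversalEnvelopingAlgebra.ι K (t : g)) = lam t • F u) :
    ∃ G : Verma h b lam →ₗ[K] V, ∀ u, G (mk h b lam u) = F u := by
  have hF : (vermaIdeal h b lam).restrictScalars K ≤ LinearMap.ker F := by
    intro z hz
    rw [LinearMap.mem_ker]
    -- Left multiples are included so that the induction survives the step of the left ideal.
    have key : ∀ z ∈ vermaIdeal h b lam, ∀ u, F (u * z) = 0 := by
      intro z hz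
      induction hz using Submodule.span_induction with
      | mem s hs =>
        intro u
        rcases hs with ⟨x, hx, rfl⟩ | ⟨t, rfl⟩
        · exact hn x hx u
        · rw [mul_sub, map_sub, ht, Algebra.algebraMap_eq_smul_one, mul_smul_comm, mul_one,
            map_smul, sub_self]
      | zero => intro u; rw [mul_zero, map_zero]
      | add x y _ _ hx hy => intro u; rw [mul_add, map_add, hx, hy, add_zero]
      | smul a x _ hx => intro u; rw [smul_eq_mul, ← mul_assoc]; exact hx _
    have := key z hz 1
    rwa [one_mul] at this
  exact ⟨(((vermaIdeal h b lam).restrictScalars K).liftQ F hF).comp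
    (Submodule.Quotient.restrictScalarsEquiv K (vermaIdeal h b lam)).symm.toLinearMap,
    fun u => rfl⟩

/-- The universal property of the Verma module. -/
theorem exists_hom {w : M} (hn : ∀ x ∈ nilPart b, ⁅x, w⁆ = 0) (hw : w ∈ weightSpace h M lam) :
    ∃ φ : Verma h b lam →ₗ⁅K,g⁆ M, φ (gen h b lam) = w := by
  have hι : ∀ x : g, UniversalEnvelopingAlgebra.lift K (LieModule.toEnd K g M)
      (UniversalEnvelopingAlgebra.ι K x) = LieModule.toEnd K g M x :=
    UniversalEnvelopingAlgebra.lift_ι_apply K _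
  obtain ⟨G, hG⟩ := exists_linearMap_mk (b := b) (lam := lam)
    ((UniversalEnvelopingAlgebra.lift K (LieModule.toEnd K g M)).toLinearMap.flip w)
    (fun x hx u => by
      change (UniversalEnvelopingAlgebra.lift K _ (_ * _) : Module.End K M) w = 0
      rw [map_mul, hι, Module.End.mul_apply, LieModule.toEnd_apply_apply, hn x hx, map_zero])
    (fun t u => by
      change (UniversalEnvelopingAlgebra.lift K _ (_ * _) : Module.End K M) w = _
      rw [map_mul, hι, Module.End.mul_apply, LieModule.toEnd_apply_apply, hw t, map_smul]
      rfl)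
  refine ⟨{ toLinearMap := G, map_lie' := fun {x m} => ?_ }, ?_⟩
  · obtain ⟨u, rfl⟩ := mk_surjective m
    change G ⁅x, mk h b lam u⁆ = ⁅x, G (mk h b lam u)⁆
    rw [lie_mk, hG, hG]
    change (UniversalEnvelopingAlgebra.lift K _ (_ * _) : Module.End K M) w = _
    rw [map_mul, hι]
    rfl
  · change G (gen h b lam) = w
    rw [gen, hG]
    change (UniversalEnvelopingAlgebra.lift K (LieModule.toEnd K g M) 1 : Module.End K M) w = _
    rw [map_one]
    rfl

/-- The Verma module is generated by its canonical generator under the negative root spaces. -/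
theorem eq_top_of_neg_stable (hh : IsSplittingMaximalToral h) (hb : IsBorel h b)
    (τ : Transpose h) {S : Submodule K (Verma h b lam)} (h1 : gen h b lam ∈ S)
    (hS : ∀ α, IsPosRoot h b α → ∀ y ∈ rootSpace h (-α), ∀ m ∈ S, ⁅y, m⁆ ∈ S) : S = ⊤ := by
  -- The smallest subspace containing the generator and stable under `n⁻`.
  let Y : Submodule K (Verma h b lam) :=
    sInf {S | gen h b lam ∈ S ∧ ∀ y ∈ negPart τ b, ∀ m ∈ S, ⁅y, m⁆ ∈ S}
  have hYg : gen h b lam ∈ Y := Submodule.mem_sInf.mpr fun S hS => hS.1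
  have hYn : ∀ y ∈ negPart τ b, ∀ m ∈ Y, ⁅y, m⁆ ∈ Y := fun y hy m hm =>
    Submodule.mem_sInf.mpr fun S hS => hS.2 y hy m (Submodule.mem_sInf.mp hm S hS)
  -- The vectors of `Y` that all of `g` keeps inside `Y`. This subspace contains the generator, and
  -- x(ym) = [x,y]m + y(xm) makes it `n⁻`-stable, so minimality gives `Y ≤ Y'`: thus `Y` is a
  -- `g`-submodule.
  let Y' : Submodule K (Verma h b lam) :=
    { carrier := {m | m ∈ Y ∧ ∀ x : g, ⁅x, m⁆ ∈ Y}
      zero_mem' := ⟨Y.zero_mem, fun x => by rw [lie_zero]; exact Y.zero_mem⟩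
      add_mem' := fun hu hv => ⟨Y.add_mem hu.1 hv.1, fun x => by
        rw [lie_add]; exact Y.add_mem (hu.2 x) (hv.2 x)⟩
      smul_mem' := fun c u hu => ⟨Y.smul_mem c hu.1, fun x => by
        rw [lie_smul]; exact Y.smul_mem c (hu.2 x)⟩ }
  have hY' : Y ≤ Y' := by
    refine sInf_le ⟨⟨hYg, fun x => ?_⟩, fun y hy m hm => ⟨hYn y hy m hm.1, fun x => ?_⟩⟩
    · obtain ⟨y, hy, z, hz, rfl⟩ := Submodule.mem_sup.mp
        ((codisjoint_iff.mp (hb.isCompl_negPart hh τ).codisjoint).symm ▸ Submodule.mem_top :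
          x ∈ (negPart τ b).toSubmodule ⊔ b.toSubmodule)
      rw [hb.eq_sum] at hz
      obtain ⟨t, ht, n, hn, rfl⟩ := Submodule.mem_sup.mp hz
      have hn' : n ∈ (nilPart b).toSubmodule := by rw [hb.nilPart_eq hh]; exact hn
      rw [add_lie, add_lie, lie_gen_of_mem_nilPart hn', add_zero,
        gen_mem_weightSpace (⟨t, ht⟩ : h)]
      exact Y.add_mem (hYn y hy _ hYg) (Y.smul_mem _ hYg)
    · rw [leibniz_lie]
      exact Y.add_mem (hm.2 _) (hYn y hy _ (hm.2 x))
  have hY : Y = ⊤ := eq_top_of_gen_mem hYg fun x m hm => (hY' hm).2 x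
  refine top_le_iff.mp (hY ▸ sInf_le ⟨h1, fun y hy m hm => ?_⟩)
  exact hb.lie_mem_of_mem_negPart hh τ (fun α hα y hy => hS α hα y hy m hm) hy

/-- The sum of these weight spaces contains the generator and is stable under negative root vectors,
which lower weights by elements of the cone. -/
theorem isWeight_and_cone (hh : IsSplittingMaximalToral h) (hb : IsDynkinBorel h b)
    (τ : Transpose h) :
    ⨆ ν ∈ {ν | lam - ν ∈ cone h b}, weightSpace h (Verma h b lam) ν = ⊤ := by
  have hle : ∀ ν, lam - ν ∈ cone h b → weightSpace h (Verma h b lam) ν ≤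
      ⨆ ν ∈ {ν | lam - ν ∈ cone h b}, weightSpace h (Verma h b lam) ν := fun ν hν =>
    le_iSup₂_of_le (f := fun (ν : Module.Dual K h)
      (_ : ν ∈ {ν | lam - ν ∈ cone h b}) => weightSpace h (Verma h b lam) ν) ν hν le_rfl
  refine eq_top_of_neg_stable hh hb.toIsBorel τ
    (hle lam (by rw [sub_self]; exact zero_mem _) gen_mem_weightSpace) ?_
  intro α hα y hy m hm
  have : ⨆ ν ∈ {ν | lam - ν ∈ cone h b}, weightSpace h (Verma h b lam) ν ≤
      (⨆ ν ∈ {ν | lam - ν ∈ cone h b}, weightSpace h (Verma h b lam) ν).comap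
        (LieModule.toEnd K g _ y) := by
    refine iSup₂_le fun ν hν m hm => hle (-α + ν) ?_ (lie_mem_weightSpace hy hm)
    have h2 := (cone h b).add_mem (hb.mem_cone hh hα) hν
    rwa [show α + (lam - ν) = lam - (-α + ν) by abel] at h2
  exact this hm

theorem isWeight (hh : IsSplittingMaximalToral h) (hb : IsDynkinBorel h b) (τ : Transpose h) :
    IsWeight h (Verma h b lam) :=
  top_le_iff.mp ((isWeight_and_cone hh hb τ).symm.le.trans
    (iSup₂_le fun ν _ => le_iSup (fun ν => weightSpace h (Verma h b lam) ν) ν))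

theorem sub_mem_cone (hh : IsSplittingMaximalToral h) (hb : IsDynkinBorel h b) (τ : Transpose h)
    {ν : Module.Dual K h} {m : Verma h b lam} (hm : m ∈ weightSpace h (Verma h b lam) ν)
    (h0 : m ≠ 0) : lam - ν ∈ cone h b :=
  exists_eq_of_mem_iSup (I := {ν | lam - ν ∈ cone h b}) hm h0
    (by rw [isWeight_and_cone hh hb τ]; trivial)

/-- A Verma module maps to the polynomial ring in one variable, with the negative root spaces
acting through a character times the variable. -/
theorem exists_polynomial_map (hh : IsSplittingMaximalToral h) (hb : IsBorel h b)
    (τ : Transpose h) (ξ : g →ₗ[K] K)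
    (hξ : ∀ y ∈ negPart τ b, ∀ z ∈ negPart τ b, ξ ⁅y, z⁆ = 0) :
    ∃ Θ : Verma h b lam →ₗ[K] Polynomial K, Θ (gen h b lam) = 1 ∧
      ∀ y ∈ negPart τ b, ∀ m, Θ ⁅y, m⁆ = Polynomial.C (ξ y) * Polynomial.X * Θ m := by
  obtain ⟨χ, hχ1, hχ2⟩ := hb.exists_character hh lam
  obtain ⟨Ψ, hΨ1, hΨy, hΨx⟩ := exists_enveloping_projection (hb.isCompl_negPart hh τ) χ
    fun x hx y hy => hχ2 _ (LieSubalgebra.subset_lieSpan ⟨x, hx, y, hy, rfl⟩)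
  -- A Lie homomorphism because polynomials commute and `ξ` kills brackets. Its extension to `U(n⁻)`
  -- follows the projection of `U(g)` onto `U(n⁻)`, and the composite descends to the Verma module.
  let e : negPart τ b →ₗ⁅K⁆ Polynomial K :=
    { toFun := fun y => Polynomial.C (ξ y) * Polynomial.X
      map_add' := fun x y => by
        change Polynomial.C (ξ ((x : g) + y)) * Polynomial.X = _
        rw [map_add, map_add, add_mul]
      map_smul' := fun c x => by
        change Polynomial.C (ξ (c • (x : g))) * Polynomial.X = _
        rw [map_smul, smul_eq_mul, map_mul, RingHom.id_apply, mul_assoc,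
          Polynomial.smul_eq_C_mul]
      map_lie' := fun {x y} => by
        rw [LieSubalgebra.coe_bracket, hξ _ x.2 _ y.2, map_zero, zero_mul,
          LieRing.of_associative_ring_bracket, mul_comm, sub_self] }
  have hle : ∀ x ∈ nilPart b, x ∈ b := by
    have : nilPart b ≤ b := by
      refine LieSubalgebra.lieSpan_le.mpr ?_
      rintro _ ⟨x, hx, y, hy, rfl⟩
      exact b.lie_mem hx hy
    exact fun x hx => this hx
  have hhb : ∀ t : h, (t : g) ∈ b := fun t => by
    have : (t : g) ∈ b.toSubmodule := by rw [hb.eq_sum]; exact Submodule.mem_sup_left t.2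
    exact this
  obtain ⟨Θ, hΘ⟩ := exists_linearMap_mk (b := b) (lam := lam)
    ((UniversalEnvelopingAlgebra.lift K e).toLinearMap.comp Ψ)
    (fun x hx u => by
      rw [LinearMap.comp_apply, hΨx x (hle x hx), hχ2 x hx, zero_smul, map_zero])
    (fun t u => by
      rw [LinearMap.comp_apply, hΨx _ (hhb t), hχ1, map_smul]; rfl)
  refine ⟨Θ, ?_, fun y hy m => ?_⟩
  · rw [gen, hΘ, LinearMap.comp_apply, hΨ1]
    exact map_one (UniversalEnvelopingAlgebra.lift K e)
  · obtain ⟨u, rfl⟩ := mk_surjective m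
    rw [lie_mk, hΘ, hΘ, LinearMap.comp_apply, LinearMap.comp_apply, hΨy ⟨y, hy⟩]
    change UniversalEnvelopingAlgebra.lift K e (_ * _) = _ * UniversalEnvelopingAlgebra.lift K e _
    rw [map_mul, UniversalEnvelopingAlgebra.lift_ι_apply]
    rfl

/-- The polynomial map for the zero character sends the generator to `1`. -/
theorem gen_ne_zero (hh : IsSplittingMaximalToral h) (hb : IsBorel h b) (τ : Transpose h) :
    gen h b lam ≠ 0 := by
  obtain ⟨Θ, h1, -⟩ := exists_polynomial_map (lam := lam) hh hb τ 0 (by simp)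
  intro h0
  rw [h0, map_zero] at h1
  exact zero_ne_one h1

/-- Lowering a vector of a Verma module by an element of the cone of simple roots. -/
theorem exists_lower (hb : IsBorel h b) (τ : Transpose h)
    {ξ : g →ₗ[K] K} (hξ : ∀ α, IsSimpleRoot h b α → ∃ y ∈ rootSpace h (-α), ξ y ≠ 0)
    {Θ : Verma h b lam →ₗ[K] Polynomial K}
    (hΘ : ∀ y ∈ negPart τ b, ∀ m, Θ ⁅y, m⁆ = Polynomial.C (ξ y) * Polynomial.X * Θ m)
    {γ : Module.Dual K h} (hγ : γ ∈ cone h b) :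
    ∀ (ν : Module.Dual K h) (m : Verma h b lam), m ∈ weightSpace h (Verma h b lam) ν → Θ m ≠ 0 →
      ∃ m' ∈ weightSpace h (Verma h b lam) (ν - γ), Θ m' ≠ 0 ∧
        (Θ m).natDegree ≤ (Θ m').natDegree ∧ (γ ≠ 0 → (Θ m).natDegree < (Θ m').natDegree) := by
  induction hγ using AddSubmonoid.closure_induction with
  | mem α hα =>
    intro ν m hm h0
    obtain ⟨y, hy, hy0⟩ := hξ α hα
    have e := hΘ y (hb.rootSpace_neg_le_negPart τ hα.1 hy) m
    -- A simple lowering operator multiplies the polynomial by a nonzero multiple of `X`. This keeps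
    -- it nonzero and raises its degree.
    have hd : (Θ ⁅y, m⁆).natDegree = (Θ m).natDegree + 1 := by
      rw [e, mul_assoc, Polynomial.natDegree_C_mul hy0, Polynomial.natDegree_X_mul h0]
    refine ⟨⁅y, m⁆, ?_, ?_, by omega, fun _ => by omega⟩
    · rw [sub_eq_neg_add]; exact lie_mem_weightSpace hy hm
    · intro hz
      rw [hz] at hd
      simp at hd
  | zero => exact fun ν m hm h0 => ⟨m, by rwa [sub_zero], h0, le_rfl, fun h => absurd rfl h⟩
  | add α β _ _ iα iβ =>
    intro ν m hm h0
    obtain ⟨m1, hm1, h01, hd1, hs1⟩ := iα ν m hm h0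
    obtain ⟨m2, hm2, h02, hd2, hs2⟩ := iβ _ m1 hm1 h01
    refine ⟨m2, by rwa [← sub_sub], h02, hd1.trans hd2, fun hne => ?_⟩
    by_cases hα : α = 0
    · rw [hα, zero_add] at hne
      exact hd1.trans_lt (hs2 hne)
    · exact (hs1 hα).trans_le hd2

/-- Simple lowering operators lead from the generator to any weight below `lam`, and the polynomial
attached to the vector never becomes zero. -/
theorem weightSpace_ne_bot (hh : IsSplittingMaximalToral h) (hb : IsBorel h b) (τ : Transpose h)
    {ν : Module.Dual K h} (hν : lam - ν ∈ cone h b) :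
    ∃ m ∈ weightSpace h (Verma h b lam) ν, m ≠ 0 := by
  obtain ⟨ξ, h1, h2⟩ := hb.exists_generic_character hh τ
  obtain ⟨Θ, h3, h4⟩ := exists_polynomial_map (lam := lam) hh hb τ ξ h2
  obtain ⟨m, hm, h0, -⟩ := exists_lower hb τ h1 h4 hν lam _ gen_mem_weightSpace
    (by rw [h3]; exact one_ne_zero)
  rw [sub_sub_cancel] at hm
  exact ⟨m, hm, fun h5 => h0 (by rw [h5, map_zero])⟩

/-- The cone of simple roots is pointed if a Verma module has a finite-dimensional top weight
space. -/
theorem cone_pointed (hh : IsSplittingMaximalToral h) (hb : IsBorel h b) (τ : Transpose h)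
    (hf : Module.Finite K (weightSpace h (Verma h b lam) lam)) :
    ∀ γ ∈ cone h b, -γ ∈ cone h b → γ = 0 := by
  intro γ hγ hγ'
  by_contra hne
  obtain ⟨ξ, h1, h2⟩ := hb.exists_generic_character hh τ
  obtain ⟨Θ, h3, h4⟩ := exists_polynomial_map (lam := lam) hh hb τ ξ h2
  -- Lowering by `γ` and then by `-γ` returns to weight `lam` with a polynomial of strictly larger
  -- degree.
  have key : ∀ k : ℕ, ∃ m ∈ weightSpace h (Verma h b lam) lam, Θ m ≠ 0 ∧ k ≤ (Θ m).natDegree := by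
    intro k
    induction k with
    | zero => exact ⟨_, gen_mem_weightSpace, by rw [h3]; exact one_ne_zero, Nat.zero_le _⟩
    | succ k ih =>
      obtain ⟨m, hm, h0, hk⟩ := ih
      obtain ⟨m1, hm1, h01, -, hk1⟩ := exists_lower hb τ h1 h4 hγ _ _ hm h0
      obtain ⟨m2, hm2, h02, hk2, -⟩ := exists_lower hb τ h1 h4 hγ' _ _ hm1 h01
      refine ⟨m2, ?_, h02, ?_⟩
      · rwa [sub_neg_eq_add, sub_add_cancel] at hm2
      · have := hk1 hne
        omega
  -- The image of a finite-dimensional space has bounded degree, a contradiction.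
  obtain ⟨s, hs⟩ := (Module.Finite.iff_fg.mp hf).map Θ
  obtain ⟨m, hm, h0, hk⟩ := key (s.sup Polynomial.natDegree + 1)
  have h5 : (weightSpace h (Verma h b lam) lam).map Θ ≤
      Polynomial.degreeLT K (s.sup Polynomial.natDegree + 1) := by
    rw [← hs, Submodule.span_le]
    intro p hp
    rw [SetLike.mem_coe, Polynomial.mem_degreeLT]
    refine lt_of_le_of_lt Polynomial.degree_le_natDegree ?_
    exact_mod_cast Nat.lt_succ_of_le (Finset.le_sup (f := Polynomial.natDegree) hp)
  have h6 := Polynomial.mem_degreeLT.mp (h5 (Submodule.mem_map_of_mem hm))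
  rw [Polynomial.degree_eq_natDegree h0] at h6
  have : (Θ m).natDegree < s.sup Polynomial.natDegree + 1 := by exact_mod_cast h6
  omega

end Verma

end VermaModules

end RootReductive

namespace RootReductive

/-! ### Singular functionals and their extension. -/

section SingularFunctionals

variable {K : Type*} [Field K] {g : Type*} [LieRing g] [LieAlgebra K g] {h b : LieSubalgebra K g}
  {X : Type*} [AddCommGroup X] [Module K X] [LieRingModule g X] [LieModule K g X]
  {A : Type*} [AddCommGroup A] [Module K A] [LieRingModule g A] [LieModule K g A]
  {B : Type*} [AddCommGroup B] [Module K B] [LieRingModule g B] [LieModule K g B]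
  {lam mu : Module.Dual K h}

/-- The functionals of weight `lam` on `X` that vanish on `g^{-α} X` for all positive roots `α`. -/
def singFunctionals (h b : LieSubalgebra K g) (lam : Module.Dual K h) (X : Type*)
    [AddCommGroup X] [Module K X] [LieRingModule g X] [LieModule K g X] : Submodule K (Module.Dual K X) where
  carrier := {F | (∀ t : h, ∀ x : X, F ⁅(t : g), x⁆ = lam t * F x) ∧
    ∀ α, IsPosRoot h b α → ∀ y ∈ rootSpace h (-α), ∀ x : X, F ⁅y, x⁆ = 0}
  zero_mem' := ⟨fun t x => by simp, fun α _ y _ x => rfl⟩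
  add_mem' := fun {F G} hF hG => ⟨fun t x => by
      rw [LinearMap.add_apply, LinearMap.add_apply, hF.1, hG.1, mul_add],
    fun α hα y hy x => by
      rw [LinearMap.add_apply, hF.2 α hα y hy, hG.2 α hα y hy, add_zero]⟩
  smul_mem' := fun c F hF => ⟨fun t x => by
      rw [LinearMap.smul_apply, LinearMap.smul_apply, hF.1, smul_eq_mul, smul_eq_mul,
        mul_left_comm],
    fun α hα y hy x => by rw [LinearMap.smul_apply, hF.2 α hα y hy, smul_zero]⟩

/-- A functional of weight `lam` vanishes on the other weight spaces. -/
theorem apply_eq_zero_of_weight {F : Module.Dual K X}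
    (hF : ∀ t : h, ∀ x : X, F ⁅(t : g), x⁆ = lam t * F x) {ν : Module.Dual K h} (hν : ν ≠ lam)
    {x : X} (hx : x ∈ weightSpace h X ν) : F x = 0 := by
  obtain ⟨t, ht⟩ : ∃ t : h, ν t - lam t ≠ 0 := by
    by_contra! hc
    exact hν (LinearMap.ext fun t => sub_eq_zero.mp (hc t))
  have h1 := hF t x
  rw [hx t, map_smul, smul_eq_mul, ← sub_eq_zero, ← sub_mul] at h1
  exact (mul_eq_zero.mp h1).resolve_left ht

theorem IsWeight.apply_lie (hX : IsWeight h X) {F : Module.Dual K X}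
    (hF : ∀ ν, ν ≠ lam → ∀ x ∈ weightSpace h X ν, F x = 0) (t : h) (x : X) :
    F ⁅(t : g), x⁆ = lam t * F x := by
  refine hX.induction (P := fun x => F ⁅(t : g), x⁆ = lam t * F x) (by simp) ?_ ?_ x
  · intro x y hx hy
    rw [lie_add, map_add, hx, hy, map_add, mul_add]
  · intro ν x hx
    rw [hx t, map_smul, smul_eq_mul]
    by_cases hν : ν = lam
    · rw [hν]
    · rw [hF ν hν x hx, mul_zero, mul_zero]

/-- Only vectors of weight `lam + α` need testing: elsewhere `y` lands outside weight `lam`, where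
`F` vanishes. -/
theorem IsWeight.mem_singFunctionals (hX : IsWeight h X) {F : Module.Dual K X}
    (hF : ∀ ν, ν ≠ lam → ∀ x ∈ weightSpace h X ν, F x = 0)
    (hF' : ∀ α, IsPosRoot h b α → ∀ y ∈ rootSpace h (-α), ∀ x ∈ weightSpace h X (lam + α),
      F ⁅y, x⁆ = 0) : F ∈ singFunctionals h b lam X := by
  refine ⟨hX.apply_lie hF, fun α hα y hy x => ?_⟩
  refine hX.induction (P := fun x => F ⁅y, x⁆ = 0) (by simp) ?_ ?_ x
  · intro x y hx hy
    rw [lie_add, map_add, hx, hy, add_zero]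
  · intro ν x hx
    by_cases hν : -α + ν = lam
    · rw [← hν] at hF'
      exact hF' α hα y hy x (by rwa [neg_add_cancel_comm])
    · exact hF _ hν _ (lie_mem_weightSpace hy hx)

theorem comp_mem_singFunctionals (p : A →ₗ⁅K,g⁆ B) {F : Module.Dual K B}
    (hF : F ∈ singFunctionals h b lam B) :
    F.comp (p : A →ₗ[K] B) ∈ singFunctionals h b lam A :=
  ⟨fun t x => by
    change F (p ⁅(t : g), x⁆) = _ * F (p x)
    rw [LieModuleHom.map_lie, hF.1], fun α hα y hy x => by
    change F (p ⁅y, x⁆) = 0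
    rw [LieModuleHom.map_lie, hF.2 α hα y hy]⟩

/-- Restriction of singular functionals along a homomorphism. -/
def singRestrict (p : A →ₗ⁅K,g⁆ B) :
    singFunctionals h b lam B →ₗ[K] singFunctionals h b lam A :=
  ((p : A →ₗ[K] B).dualMap).restrict fun _ hF => comp_mem_singFunctionals p hF

theorem singRestrict_apply (p : A →ₗ⁅K,g⁆ B) (F : singFunctionals h b lam B) (a : A) :
    (singRestrict p F).1 a = F.1 (p a) := rfl

/-- Vectors of weight other than `lam` are killed by every functional of weight `lam`. This also
bounds the dimension by that of the `lam`-weight space. -/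
theorem IsWeight.sing_ext (hX : IsWeight h X) {F G : singFunctionals h b lam X}
    (hFG : ∀ x ∈ weightSpace h X lam, F.1 x = G.1 x) : F = G :=
  Subtype.ext (hX.linearMap_ext fun ν x hx => by
    by_cases hν : ν = lam
    · subst hν; exact hFG x hx
    · rw [apply_eq_zero_of_weight F.2.1 hν hx, apply_eq_zero_of_weight G.2.1 hν hx])

theorem IsWeight.finite_singFunctionals (hX : IsWeight h X)
    [Module.Finite K (weightSpace h X lam)] : Module.Finite K (singFunctionals h b lam X) :=
  Module.Finite.of_injective
    ((weightSpace h X lam).subtype.dualMap.comp (singFunctionals h b lam X).subtype)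
    fun _ _ hFG => hX.sing_ext fun x hx => LinearMap.congr_fun hFG ⟨x, hx⟩

/-- Singular functionals extend to a module with the same weights above `lam`. -/
theorem exists_sing_extension_of_higher (hB : IsWeight h B) (i : A →ₗ⁅K,g⁆ B)
    (hi : Function.Injective i)
    (hα : ∀ α, IsPosRoot h b α → ∀ x ∈ weightSpace h B (lam + α), ∃ a, i a = x)
    {F : Module.Dual K A} (hF : F ∈ singFunctionals h b lam A) :
    ∃ G ∈ singFunctionals h b lam B, ∀ a, G (i a) = F a := by
  have hA := hB.of_injective i hi
  obtain ⟨j, hj⟩ := LinearMap.exists_leftInverse_of_injective (i : A →ₗ[K] B)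
    (LinearMap.ker_eq_bot.mpr hi)
  -- The extension at weight `lam` is arbitrary: singularity only involves vectors of weight `lam +
  -- α`, which all come from `A`.
  obtain ⟨G, h1, h2⟩ := hB.exists_linearMap_single lam (F.comp j)
  have hG : ∀ a, G (i a) = F a := by
    have : G.comp (i : A →ₗ[K] B) = F := by
      refine hA.linearMap_ext fun ν a ha => ?_
      change G (i a) = F a
      by_cases hν : ν = lam
      · subst hν
        rw [h1 _ (map_mem_weightSpace i ha)]
        exact congrArg F (LinearMap.congr_fun hj a)
      · rw [h2 ν hν _ (map_mem_weightSpace i ha), apply_eq_zero_of_weight hF.1 hν ha]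
    exact fun a => LinearMap.congr_fun this a
  refine ⟨G, hB.mem_singFunctionals h2 fun α hα' y hy x hx => ?_, hG⟩
  obtain ⟨a, rfl⟩ := hα α hα' x hx
  rw [← LieModuleHom.map_lie, hG, hF.2 α hα' y hy]

/-- A functional extends with prescribed vanishing. -/
theorem exists_dual_extension {V W : Type*} [AddCommGroup V] [Module K V] [AddCommGroup W]
    [Module K W] (i : V →ₗ[K] W) (F : Module.Dual K V) (S : Submodule K W)
    (hS : ∀ v, i v ∈ S → F v = 0) :
    ∃ G : Module.Dual K W, (∀ v, G (i v) = F v) ∧ ∀ w ∈ S, G w = 0 := by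
  have h1 : F ∈ (LinearMap.ker (S.mkQ.comp i)).dualAnnihilator := by
    rw [Submodule.mem_dualAnnihilator]
    intro v hv
    exact hS v ((Submodule.Quotient.mk_eq_zero S).mp hv)
  rw [← LinearMap.range_dualMap_eq_dualAnnihilator_ker] at h1
  obtain ⟨G, rfl⟩ := h1
  refine ⟨G.comp S.mkQ, fun v => rfl, fun w hw => ?_⟩
  rw [LinearMap.comp_apply, Submodule.mkQ_apply, (Submodule.Quotient.mk_eq_zero S).mpr hw, map_zero]

/-! ### Co-Verma modules and homomorphisms into them. -/

section CoVerma

variable {hh : IsSplittingMaximalToral h} {τ : Transpose h}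

theorem lie_dual_apply (x : g) (f : dual hh τ X) (m : X) : (⁅x, f⁆ : dual hh τ X).1 m =
    f.1 ⁅τ.toFun x, m⁆ := rfl

theorem dual_apply_add {Y : Type*} [AddCommGroup Y] [Module K Y]
    (f : TwistedDual τ Y) (m n : Y) : f (m + n) = f m + f n :=
  LinearMap.map_add (show Module.Dual K Y from f) m n

theorem dual_apply_smul {Y : Type*} [AddCommGroup Y] [Module K Y]
    (f : TwistedDual τ Y) (c : K) (m : Y) : f (c • m) = c * f m :=
  LinearMap.map_smul (show Module.Dual K Y from f) c m

theorem dual_apply_zero {Y : Type*} [AddCommGroup Y] [Module K Y]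
    (f : TwistedDual τ Y) : f 0 = 0 :=
  LinearMap.map_zero (show Module.Dual K Y from f)

theorem dual_ext {f f' : dual hh τ X} (hf : ∀ m, f.1 m = f'.1 m) : f = f' :=
  Subtype.ext (LinearMap.ext (f := (show Module.Dual K X from f.1)) hf)

/-- A weight vector of the dual vanishes on the other weight spaces. -/
theorem dual_apply_eq_zero {f : dual hh τ X} {ν κ : Module.Dual K h}
    (hf : f ∈ weightSpace h (dual hh τ X) ν) (hκ : κ ≠ ν) {m : X} (hm : m ∈ weightSpace h X κ) :
    f.1 m = 0 := by
  refine apply_eq_zero_of_weight (F := (show Module.Dual K X from f.1)) (lam := ν) ?_ hκ hm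
  intro t m
  have h1 : (⁅(t : g), f⁆ : dual hh τ X).1 m = (ν t • f).1 m := by rw [hf t]
  rw [lie_dual_apply, τ.fixes _ t.2] at h1
  exact h1

theorem mem_weightSpace_dual (hX : IsWeight h X) {f : dual hh τ X} {ν : Module.Dual K h}
    (hf : ∀ κ, κ ≠ ν → ∀ m ∈ weightSpace h X κ, f.1 m = 0) :
    f ∈ weightSpace h (dual hh τ X) ν := by
  intro t
  refine dual_ext fun m => ?_
  rw [lie_dual_apply, τ.fixes _ t.2]
  exact hX.apply_lie (F := (show Module.Dual K X from f.1)) hf t m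

theorem isWeight_dual (hX : IsWeight h X) : IsWeight h (dual hh τ X) := by
  refine top_le_iff.mp fun f _ => ?_
  have hf : f.1 ∈ ⨆ μ : Module.Dual K h, dualComponent τ X μ := f.2
  have h1 : ⨆ μ : Module.Dual K h, dualComponent τ X μ ≤
      (⨆ μ : Module.Dual K h, weightSpace h (dual hh τ X) μ).map
        (dual hh τ X).toSubmodule.subtype := by
    refine iSup_le fun μ f hf => ?_
    have hfd : f ∈ dual hh τ X := Submodule.mem_iSup_of_mem (p := dualComponent τ X) μ hf
    exact ⟨⟨f, hfd⟩, Submodule.mem_iSup_of_mem μ (mem_weightSpace_dual hX hf), rfl⟩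
  obtain ⟨f', hf', he⟩ := h1 hf
  have : f' = f := Subtype.ext he
  rwa [← this]

theorem exists_dual_apply_ne_zero (hX : IsWeight h X) {ν : Module.Dual K h} {m : X}
    (hm : m ∈ weightSpace h X ν) (h0 : m ≠ 0) :
    ∃ f ∈ weightSpace h (dual hh τ X) ν, f.1 m ≠ 0 := by
  obtain ⟨F, hF, hF'⟩ := hX.exists_dual_ne_zero hm h0
  have hfd : (show TwistedDual τ X from F) ∈ dual hh τ X :=
    Submodule.mem_iSup_of_mem (p := dualComponent τ X) ν hF'
  exact ⟨⟨F, hfd⟩, mem_weightSpace_dual hX hF', hF⟩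

/-- A vector of weight `ν` in the dual is a functional supported on the `ν`-weight space of the
Verma module. -/
theorem CoVerma.sub_mem_cone (hb : IsDynkinBorel h b) {ν : Module.Dual K h}
    {f : CoVerma hh b τ lam} (hf : f ∈ weightSpace h (CoVerma hh b τ lam) ν) (h0 : f ≠ 0) :
    lam - ν ∈ cone h b := by
  by_contra hν
  refine h0 (dual_ext fun m => ?_)
  have hV : IsWeight h (Verma h b lam) := Verma.isWeight hh hb τ
  refine hV.induction (P := fun m => f.1 m = 0) (dual_apply_zero _) ?_ ?_ m
  · intro x y hx hy
    rw [dual_apply_add, hx, hy, add_zero]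
  · intro κ m hm
    by_cases hκ : κ = ν
    · subst hκ
      by_cases hm0 : m = 0
      · rw [hm0]; exact dual_apply_zero _
      · exact absurd (Verma.sub_mem_cone hh hb τ hm hm0) hν
    · exact dual_apply_eq_zero hf hκ hm

/-- A singular functional of weight `lam` is a homomorphism to the co-Verma module. -/
theorem exists_hom_coVerma (hb : IsBorel h b) (hX : IsWeight h X) {F : Module.Dual K X}
    (hF : F ∈ singFunctionals h b lam X) :
    ∃ φ : X →ₗ⁅K,g⁆ CoVerma hh b τ lam, ∀ x, (φ x).1 (Verma.gen h b lam) = F x := by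
  -- In the twisted full dual of `X`, the functional `F` is killed by `n` and has weight `lam`,
  -- because `τ` exchanges `n` and `n⁻`. So it receives a map from the Verma module, and transposing
  -- that map gives the homomorphism sought.
  obtain ⟨Ψ, hΨ⟩ := Verma.exists_hom (b := b) (lam := lam)
    (w := (show TwistedDual τ X from F))
    (fun x hx => LinearMap.ext fun m => by
      change F ⁅τ.toFun x, m⁆ = 0
      refine hb.lie_mem_of_mem_negPart hh τ (S := LinearMap.ker F)
        (fun α hα y hy => hF.2 α hα y hy m) ?_
      rw [mem_negPart, τ.involutive]
      exact hx)
    (fun t => LinearMap.ext fun m => by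
      change F ⁅τ.toFun t, m⁆ = lam t * F m
      rw [τ.fixes _ t.2, hF.1])
  have hΨl : ∀ (y : g) (x : X) (δ : Verma h b lam), Ψ δ ⁅y, x⁆ = Ψ ⁅τ.toFun y, δ⁆ x := by
    intro y x δ
    rw [LieModuleHom.map_lie]
    change _ = Ψ δ ⁅τ.toFun (τ.toFun y), x⁆
    rw [τ.involutive]
  let Ψ₀ : Verma h b lam →ₗ[K] TwistedDual τ X := Ψ
  let φ₀ : X →ₗ[K] TwistedDual τ (Verma h b lam) :=
    LinearMap.flip (show Verma h b lam →ₗ[K] X →ₗ[K] K from Ψ₀)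
  -- The transpose a priori takes values in the full dual; a weight vector `x` goes to a functional
  -- supported on a single weight space.
  have hmem : ∀ x, φ₀ x ∈ dual hh τ (Verma h b lam) := by
    intro x
    refine hX.induction (P := fun x => φ₀ x ∈ dual hh τ (Verma h b lam)) ?_ ?_ ?_ x
    · rw [map_zero]; exact zero_mem _
    · intro x y hx hy
      rw [map_add]; exact add_mem hx hy
    · intro ν x hx
      refine Submodule.mem_iSup_of_mem (p := dualComponent τ (Verma h b lam)) ν ?_
      intro κ hκ δ hδ
      refine apply_eq_zero_of_weight (lam := ν)
        (F := (show Module.Dual K (Verma h b lam) from φ₀ x)) ?_ hκ hδ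
      intro t δ
      change Ψ ⁅(t : g), δ⁆ x = ν t * Ψ δ x
      have := hΨl t x δ
      rw [τ.fixes _ t.2] at this
      rw [← this, hx t]
      exact LinearMap.map_smul (show Module.Dual K X from Ψ δ) _ _
  refine ⟨{ toLinearMap := φ₀.codRestrict (dual hh τ (Verma h b lam)).toSubmodule hmem,
            map_lie' := fun {y x} => dual_ext fun δ => hΨl y x δ }, fun x => ?_⟩
  change Ψ (Verma.gen h b lam) x = F x
  rw [hΨ]
  rfl

/-- The action on the Verma side moves through `τ` to the argument in `X`, so values at the
generator determine all others. -/
theorem hom_coVerma_ext {φ ψ : X →ₗ⁅K,g⁆ CoVerma hh b τ lam}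
    (hφ : ∀ x, (φ x).1 (Verma.gen h b lam) = (ψ x).1 (Verma.gen h b lam)) : φ = ψ := by
  let S : Submodule K (Verma h b lam) :=
    { carrier := {δ | ∀ x, (φ x).1 δ = (ψ x).1 δ}
      zero_mem' := fun x => by rw [dual_apply_zero, dual_apply_zero]
      add_mem' := fun {u v} hu hv x => by rw [dual_apply_add, dual_apply_add, hu, hv]
      smul_mem' := fun c u hu x => by rw [dual_apply_smul, dual_apply_smul, hu] }
  have hS : S = ⊤ := by
    refine Verma.eq_top_of_gen_mem hφ fun y δ hδ x => ?_
    have h1 : ∀ φ : X →ₗ⁅K,g⁆ CoVerma hh b τ lam, (φ x).1 ⁅y, δ⁆ = (φ ⁅τ.toFun y, x⁆).1 δ := by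
      intro φ
      rw [LieModuleHom.map_lie, lie_dual_apply, τ.involutive]
    rw [h1, h1]
    exact hδ _
  exact LieModuleHom.ext fun x => dual_ext fun δ => (hS ▸ Submodule.mem_top : δ ∈ S) x

/-- Evaluation at the generator turns a negative root vector acting on `X` into a positive one
acting on the generator, which it kills. -/
theorem hom_coVerma_gen_mem (hb : IsBorel h b) (φ : X →ₗ⁅K,g⁆ CoVerma hh b τ lam)
    {F : Module.Dual K X} (hF : ∀ x, F x = (φ x).1 (Verma.gen h b lam)) :
    F ∈ singFunctionals h b lam X := by
  refine ⟨fun t x => ?_, fun α hα y hy x => ?_⟩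
  · rw [hF, hF, LieModuleHom.map_lie, lie_dual_apply, τ.fixes _ t.2,
      Verma.gen_mem_weightSpace t, dual_apply_smul]
  · rw [hF, LieModuleHom.map_lie, lie_dual_apply,
      Verma.lie_gen_of_mem_nilPart (hb.rootSpace_le_nilPart hα (τ.mem_rootSpace hy)),
      dual_apply_zero]

/-- Homomorphisms to a co-Verma module are the singular functionals. -/
theorem hom_coVerma_equiv (hb : IsBorel h b) (hX : IsWeight h X) :
    Nonempty ((X →ₗ⁅K,g⁆ CoVerma hh b τ lam) ≃ₗ[K] singFunctionals h b lam X) := by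
  let ev : (X →ₗ⁅K,g⁆ CoVerma hh b τ lam) →ₗ[K] singFunctionals h b lam X :=
    { toFun := fun φ => ⟨{ toFun := fun x => (φ x).1 (Verma.gen h b lam)
                           map_add' := fun x y => by rw [map_add]; rfl
                           map_smul' := fun c x => by rw [map_smul]; rfl },
        hom_coVerma_gen_mem hb φ fun _ => rfl⟩
      map_add' := fun φ ψ => rfl
      map_smul' := fun c φ => rfl }
  refine ⟨LinearEquiv.ofBijective ev ⟨fun φ ψ hφ => ?_, fun F => ?_⟩⟩
  · exact hom_coVerma_ext fun x => LinearMap.congr_fun (congrArg Subtype.val hφ) x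
  · obtain ⟨φ, hφ⟩ := exists_hom_coVerma (hh := hh) (τ := τ) hb hX F.2
    exact ⟨φ, Subtype.ext (LinearMap.ext hφ)⟩

end CoVerma

/-! ### Additivity of singular functionals along Verma quotients. -/

/-- Singular functionals of weight `lam` extend along an extension by a Verma module of higher
weight. -/
theorem exists_sing_extension_of_verma (hh : IsSplittingMaximalToral h) (hb : IsDynkinBorel h b)
    (τ : Transpose h) (hC : ∀ γ ∈ cone h b, -γ ∈ cone h b → γ = 0) (hB : IsWeight h B)
    (i : A →ₗ⁅K,g⁆ B) (hi : Function.Injective i) (p : B →ₗ⁅K,g⁆ Verma h b mu)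
    (hp : Function.Surjective p) (hip : ∀ x, p x = 0 ↔ ∃ a, i a = x)
    (hlt : mu - lam ∈ cone h b) {F : Module.Dual K A} (hF : F ∈ singFunctionals h b lam A) :
    ∃ G ∈ singFunctionals h b lam B, ∀ a, G (i a) = F a := by
  have hA := hB.of_injective i hi
  obtain ⟨φ, hφ⟩ := exists_hom_coVerma (hh := hh) (τ := τ) hb.toIsBorel hA hF
  obtain ⟨w, hw, hpw⟩ := hB.exists_of_surjective p hp Verma.gen_mem_weightSpace
  -- Modulo `D` the submodule `A` becomes its image in the co-Verma module of weight `lam`, whose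
  -- weights are all below `lam`.
  let D : LieSubmodule K g B := φ.ker.map i
  let q : B →ₗ⁅K,g⁆ B ⧸ D := LieSubmodule.Quotient.mk' D
  have hq : ∀ x, q x = 0 ↔ ∃ a, φ a = 0 ∧ i a = x := by
    intro x
    rw [LieSubmodule.Quotient.mk_eq_zero, LieSubmodule.mem_map]
    simp only [LieModuleHom.mem_ker]
  obtain ⟨ψ, hψ⟩ := Verma.exists_hom (b := b) (lam := mu) (w := q w)
    (fun x hx => by
      refine hb.lie_mem_of_mem_nilPart hh (S := ⊥) (fun α hα x hx => ?_) hx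
      rw [Submodule.mem_bot, ← LieModuleHom.map_lie, hq]
      have h1 : p ⁅x, w⁆ = 0 := by
        rw [LieModuleHom.map_lie, hpw,
          Verma.lie_gen_of_mem_nilPart (hb.rootSpace_le_nilPart hα hx)]
      obtain ⟨a, ha⟩ := (hip _).mp h1
      refine ⟨a, ?_, ha⟩
      have h2 : a ∈ weightSpace h A (α + mu) :=
        mem_weightSpace_of_map_mem i hi (by rw [ha]; exact lie_mem_weightSpace hx hw)
      -- The lift `w` of the generator is singular modulo `D`: otherwise `α + mu` is a weight below
      -- `lam`, and `lam ≤ mu` puts `-α` in the cone.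
      by_contra h0
      have h3 := CoVerma.sub_mem_cone hb (map_mem_weightSpace φ h2) h0
      have h4 := (cone h b).add_mem h3 hlt
      rw [show lam - (α + mu) + (mu - lam) = -α by abel] at h4
      exact hα.ne_zero (hC α (hb.mem_cone hh hα) h4))
    (map_mem_weightSpace q hw)
  let p' : (B ⧸ D) →ₗ⁅K,g⁆ Verma h b mu :=
    { toLinearMap := D.toSubmodule.liftQ (p : B →ₗ[K] Verma h b mu) (by
        intro x hx
        obtain ⟨a, -, ha⟩ := (LieSubmodule.mem_map _).mp hx
        exact (hip x).mpr ⟨a, ha⟩)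
      map_lie' := fun {y z} => by
        obtain ⟨x, rfl⟩ := LieSubmodule.Quotient.surjective_mk' D z
        exact LieModuleHom.map_lie p y x }
  have hp'q : ∀ x, p' (q x) = p x := fun _ => rfl
  have hp'ψ : ∀ δ, p' (ψ δ) = δ := by
    have : p'.comp ψ = LieModuleHom.id := Verma.hom_ext (by
      rw [LieModuleHom.comp_apply, hψ, hp'q, hpw]; rfl)
    exact fun δ => LieModuleHom.congr_fun this δ
  -- The preimage of the split copy of the Verma module. It is `g`-stable, spans `B` together with
  -- `A`, and meets `A` inside the kernel of `φ`, where `F` vanishes. So `F` extends by zero on it.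
  let S : Submodule K B := (LinearMap.range (ψ : Verma h b mu →ₗ[K] B ⧸ D)).comap
    (q : B →ₗ[K] B ⧸ D)
  have hS : ∀ x, x ∈ S ↔ ∃ δ, ψ δ = q x := fun _ => Iff.rfl
  have hSlie : ∀ y : g, ∀ x ∈ S, ⁅y, x⁆ ∈ S := by
    intro y x hx
    obtain ⟨δ, hδ⟩ := (hS x).mp hx
    exact (hS _).mpr ⟨⁅y, δ⁆, by rw [LieModuleHom.map_lie, LieModuleHom.map_lie, hδ]⟩
  have hdec : ∀ x, ∃ a, ∃ s ∈ S, x = i a + s := by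
    intro x
    obtain ⟨s, hs⟩ := LieSubmodule.Quotient.surjective_mk' D (ψ (p x))
    have hs' : q s = ψ (p x) := hs
    obtain ⟨a, ha⟩ := (hip (x - s)).mp (by rw [map_sub, ← hp'q s, hs', hp'ψ, sub_self])
    exact ⟨a, s, (hS s).mpr ⟨_, hs'.symm⟩, by rw [ha, sub_add_cancel]⟩
  obtain ⟨G, hG1, hG2⟩ := exists_dual_extension (i : A →ₗ[K] B) F S (fun a ha => by
    obtain ⟨δ, hδ⟩ := (hS _).mp ha
    have h1 : δ = 0 := by
      rw [← hp'ψ δ, hδ, hp'q]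
      exact (hip _).mpr ⟨a, rfl⟩
    rw [h1, map_zero] at hδ
    obtain ⟨a', ha', he⟩ := (hq _).mp hδ.symm
    rw [← hφ a, ← hi he, ha']
    rfl)
  have hG1' : ∀ a, G (i a) = F a := hG1
  refine ⟨G, ⟨fun t x => ?_, fun α hα y hy x => ?_⟩, hG1'⟩
  · obtain ⟨a, s, hs, rfl⟩ := hdec x
    rw [lie_add, map_add, map_add, hG2 s hs, hG2 _ (hSlie _ _ hs), add_zero, add_zero,
      ← LieModuleHom.map_lie, hG1', hG1', hF.1]
  · obtain ⟨a, s, hs, rfl⟩ := hdec x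
    rw [lie_add, map_add, hG2 _ (hSlie _ _ hs), add_zero, ← LieModuleHom.map_lie, hG1',
      hF.2 α hα y hy]

/-- Singular functionals form a left exact contravariant functor; `hext` supplies the surjectivity
at the right end. -/
theorem finrank_singFunctionals_of_exact {C : Type*} [AddCommGroup C] [Module K C]
    [LieRingModule g C] [LieModule K g C]
    (i : A →ₗ⁅K,g⁆ B) (p : B →ₗ⁅K,g⁆ C)
    (hp : Function.Surjective p) (hip : ∀ x, p x = 0 ↔ ∃ a, i a = x)
    (hext : ∀ F ∈ singFunctionals h b lam A, ∃ G ∈ singFunctionals h b lam B, ∀ a, G (i a) = F a)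
    [Module.Finite K (singFunctionals h b lam B)] :
    Module.finrank K (singFunctionals h b lam B) =
      Module.finrank K (singFunctionals h b lam A) +
        Module.finrank K (singFunctionals h b lam C) := by
  have h1 : LinearMap.range (singRestrict (h := h) (b := b) (lam := lam) i) = ⊤ := by
    refine LinearMap.range_eq_top.mpr fun F => ?_
    obtain ⟨G, hG, he⟩ := hext F.1 F.2
    exact ⟨⟨G, hG⟩, Subtype.ext (LinearMap.ext he)⟩
  have h2 : LinearMap.ker (singRestrict (h := h) (b := b) (lam := lam) i) =
      LinearMap.range (singRestrict (h := h) (b := b) (lam := lam) p) := by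
    ext G
    rw [LinearMap.mem_ker]
    constructor
    · intro hG
      have hker : LinearMap.ker (p : B →ₗ[K] C) ≤ LinearMap.ker G.1 := by
        intro x hx
        obtain ⟨a, rfl⟩ := (hip x).mp hx
        exact LinearMap.congr_fun (congrArg Subtype.val hG) a
      have h3 : G.1 ∈ (LinearMap.ker (p : B →ₗ[K] C)).dualAnnihilator :=
        (Submodule.mem_dualAnnihilator _).mpr fun x hx => hker hx
      rw [← LinearMap.range_dualMap_eq_dualAnnihilator_ker] at h3
      obtain ⟨F, hF⟩ := h3
      have hFp : ∀ x, F (p x) = G.1 x := fun x => LinearMap.congr_fun hF x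
      refine ⟨⟨F, fun t c => ?_, fun α hα y hy c => ?_⟩, Subtype.ext (LinearMap.ext hFp)⟩
      · obtain ⟨x, rfl⟩ := hp c
        rw [← LieModuleHom.map_lie, hFp, hFp, G.2.1]
      · obtain ⟨x, rfl⟩ := hp c
        rw [← LieModuleHom.map_lie, hFp, G.2.2 α hα y hy]
    · rintro ⟨F, rfl⟩
      refine Subtype.ext (LinearMap.ext fun a => ?_)
      rw [singRestrict_apply, singRestrict_apply, (hip _).mpr ⟨a, rfl⟩, map_zero]
      rfl
  have h3 : Function.Injective (singRestrict (h := h) (b := b) (lam := lam) p) := by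
    intro F G hFG
    refine Subtype.ext (LinearMap.ext fun c => ?_)
    obtain ⟨x, rfl⟩ := hp c
    exact LinearMap.congr_fun (congrArg Subtype.val hFG) x
  have h4 := LinearMap.finrank_range_add_finrank_ker (K := K)
    (V := singFunctionals h b lam B) (V₂ := singFunctionals h b lam A)
    (singRestrict (h := h) (b := b) (lam := lam) i)
  rw [h1, finrank_top, h2, LinearMap.finrank_range_of_inj h3] at h4
  exact h4.symm

/-- Restriction to a submodule with the same weights above `lam` preserves the singular
functionals. -/
theorem finrank_singFunctionals_eq (hB : IsWeight h B) (i : A →ₗ⁅K,g⁆ B)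
    (hi : Function.Injective i) (h0 : ∀ x ∈ weightSpace h B lam, ∃ a, i a = x)
    (hα : ∀ α, IsPosRoot h b α → ∀ x ∈ weightSpace h B (lam + α), ∃ a, i a = x) :
    Module.finrank K (singFunctionals h b lam B) =
      Module.finrank K (singFunctionals h b lam A) := by
  refine LinearEquiv.finrank_eq (LinearEquiv.ofBijective (singRestrict i) ⟨fun F G hFG => ?_,
    fun F => ?_⟩)
  · refine hB.sing_ext fun x hx => ?_
    obtain ⟨a, rfl⟩ := h0 x hx
    exact LinearMap.congr_fun (congrArg Subtype.val hFG) a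
  · obtain ⟨G, hG, he⟩ := exists_sing_extension_of_higher hB i hi hα F.2
    exact ⟨⟨G, hG⟩, Subtype.ext (LinearMap.ext he)⟩

-- A Verma module is spanned by its generator and the image of `n⁻`, so a singular functional is
-- determined by its value at the generator, which has weight `mu`.
open Classical in
theorem finrank_singFunctionals_verma (hh : IsSplittingMaximalToral h) (hb : IsDynkinBorel h b)
    (τ : Transpose h) (hC : ∀ γ ∈ cone h b, -γ ∈ cone h b → γ = 0) :
    Module.finrank K (singFunctionals h b lam (Verma h b mu)) = if mu = lam then 1 else 0 := by
  have hdet : ∀ F ∈ singFunctionals h b lam (Verma h b mu), F (Verma.gen h b mu) = 0 → F = 0 := by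
    intro F hF h0
    have : LinearMap.ker F = ⊤ := Verma.eq_top_of_neg_stable hh hb.toIsBorel τ h0
      fun α hα y hy m _ => hF.2 α hα y hy m
    exact LinearMap.ker_eq_top.mp this
  split_ifs with hmu
  · subst hmu
    have hV : IsWeight h (Verma h b mu) := Verma.isWeight hh hb τ
    obtain ⟨F, hF, hF'⟩ := hV.exists_dual_ne_zero Verma.gen_mem_weightSpace
      (Verma.gen_ne_zero hh hb.toIsBorel τ)
    -- Pointedness excludes the weights `mu + α`, so nothing of weight `mu` is reached by a negative
    -- root vector from above.
    have hFs : F ∈ singFunctionals h b mu (Verma h b mu) :=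
      hV.mem_singFunctionals hF' fun α hα y hy x hx => by
        by_cases hx0 : x = 0
        · rw [hx0, lie_zero, map_zero]
        · have h1 := Verma.sub_mem_cone hh hb τ hx hx0
          rw [show mu - (mu + α) = -α by abel] at h1
          exact absurd (hC α (hb.mem_cone hh hα) h1) hα.ne_zero
    refine finrank_eq_one (⟨F, hFs⟩ : singFunctionals h b mu (Verma h b mu)) (fun h0 => hF ?_) fun G => ?_
    · exact LinearMap.congr_fun (congrArg Subtype.val h0) _
    · refine ⟨G.1 (Verma.gen h b mu) * (F (Verma.gen h b mu))⁻¹, Subtype.ext ?_⟩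
      rw [← sub_eq_zero]
      refine hdet _ (Submodule.sub_mem _ (Submodule.smul_mem _ _ hFs) G.2) ?_
      change _ * _ * F (Verma.gen h b mu) - G.1 (Verma.gen h b mu) = 0
      rw [inv_mul_cancel_right₀ hF, sub_self]
  · have : singFunctionals h b lam (Verma h b mu) = ⊥ := by
      refine (Submodule.eq_bot_iff _).mpr fun F hF => hdet F hF ?_
      exact apply_eq_zero_of_weight hF.1 hmu Verma.gen_mem_weightSpace
    rw [this, finrank_bot]

open Classical in
/-- The number of singular functionals is additive on extensions by Verma modules. -/
theorem finrank_singFunctionals_add_verma (hh : IsSplittingMaximalToral h)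
    (hb : IsDynkinBorel h b) (τ : Transpose h) (hC : ∀ γ ∈ cone h b, -γ ∈ cone h b → γ = 0)
    (hB : IsWeight h B) [Module.Finite K (weightSpace h B lam)]
    (i : A →ₗ⁅K,g⁆ B) (hi : Function.Injective i) (p : B →ₗ⁅K,g⁆ Verma h b mu)
    (hp : Function.Surjective p) (hip : ∀ x, p x = 0 ↔ ∃ a, i a = x) :
    Module.finrank K (singFunctionals h b lam B) =
      Module.finrank K (singFunctionals h b lam A) + if mu = lam then 1 else 0 := by
  have := hB.finite_singFunctionals (b := b) (lam := lam)
  rw [← finrank_singFunctionals_verma hh hb τ hC]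
  refine finrank_singFunctionals_of_exact i p hp hip fun F hF => ?_
  -- Strictly above `lam` the splitting argument applies. Otherwise the Verma module has no weight
  -- `lam + α`: such a weight would force `mu` strictly above `lam`.
  by_cases hlt : mu - lam ∈ cone h b ∧ mu ≠ lam
  · exact exists_sing_extension_of_verma hh hb τ hC hB i hi p hp hip hlt.1 hF
  · refine exists_sing_extension_of_higher hB i hi (fun α hα x hx => (hip x).mp ?_) hF
    by_contra h0
    have h1 := Verma.sub_mem_cone hh hb τ (map_mem_weightSpace p hx) h0
    have hαc := hb.mem_cone hh hα
    refine hlt ⟨?_, ?_⟩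
    · have h2 := (cone h b).add_mem h1 hαc
      rwa [show mu - (lam + α) + α = mu - lam by abel] at h2
    · rintro rfl
      rw [show mu - (mu + α) = -α by abel] at h1
      exact hα.ne_zero (hC α hαc h1)

end SingularFunctionals

end RootReductive

namespace RootReductive

/-! ### Chains of submodules and the places where a weight space grows. -/

section ChainsOfSubmodules

variable {K : Type*} [Field K] {g : Type*} [LieRing g] [LieAlgebra K g] {h b : LieSubalgebra K g}
  {M : Type*} [AddCommGroup M] [Module K M] [LieRingModule g M] [LieModule K g M]
  {J : Type*} [LinearOrder J] {lam : Module.Dual K h}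

/-- The union of the members of a chain of submodules whose index lies in `D`. -/
def unionOver (N : J → LieSubmodule K g M) (D : Set J) : LieSubmodule K g M :=
  ⨆ k, ⨆ _ : k ∈ D, N k

theorem unionOver_Iio (N : J → LieSubmodule K g M) (j : J) :
    unionOver N (Set.Iio j) = before N j := rfl

theorem le_unionOver {N : J → LieSubmodule K g M} {D : Set J} {k : J} (hk : k ∈ D) :
    N k ≤ unionOver N D :=
  le_iSup₂_of_le (f := fun k (_ : k ∈ D) => N k) k hk le_rfl

theorem le_before {N : J → LieSubmodule K g M} {j k : J} (hk : k < j) : N k ≤ before N j :=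
  le_unionOver (D := Set.Iio j) hk

theorem before_le {N : J → LieSubmodule K g M} (hN : Monotone N) (j : J) : before N j ≤ N j :=
  iSup₂_le fun _ hk => hN hk.le

theorem unionOver_mono {N : J → LieSubmodule K g M} {D D' : Set J} (hD : D ⊆ D') :
    unionOver N D ≤ unionOver N D' :=
  iSup₂_le fun _ hk => le_unionOver (hD hk)

theorem unionOver_empty (N : J → LieSubmodule K g M) : unionOver N ∅ = ⊥ :=
  le_bot_iff.mp (iSup₂_le fun _ hk => hk.elim)

theorem unionOver_Iic {N : J → LieSubmodule K g M} (hN : Monotone N) (j : J) :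
    unionOver N (Set.Iic j) = N j :=
  le_antisymm (iSup₂_le fun _ hk => hN hk) (le_unionOver (Set.mem_Iic.mpr le_rfl))

theorem exists_of_mem_unionOver {N : J → LieSubmodule K g M} (hN : Monotone N) {D : Set J} {m : M}
    (hm : m ∈ unionOver N D) (h0 : m ≠ 0) : ∃ k ∈ D, m ∈ N k := by
  -- The union of a chain is a submodule; the disjunct `m = 0` covers an empty `D`.
  let T : LieSubmodule K g M :=
    { carrier := {m | m = 0 ∨ ∃ k ∈ D, m ∈ N k}
      zero_mem' := Or.inl rfl
      add_mem' := by
        rintro x y (rfl | ⟨k, hk, hx⟩) hy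
        · rwa [zero_add]
        · rcases hy with rfl | ⟨l, hl, hy⟩
          · rw [add_zero]; exact Or.inr ⟨k, hk, hx⟩
          · rcases le_total k l with hkl | hkl
            · exact Or.inr ⟨l, hl, add_mem (hN hkl hx) hy⟩
            · exact Or.inr ⟨k, hk, add_mem hx (hN hkl hy)⟩
      smul_mem' := by
        rintro c x (rfl | ⟨k, hk, hx⟩)
        · exact Or.inl (smul_zero c)
        · exact Or.inr ⟨k, hk, (N k).smul_mem c hx⟩
      lie_mem := by
        rintro y x (rfl | ⟨k, hk, hx⟩)
        · exact Or.inl (lie_zero y)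
        · exact Or.inr ⟨k, hk, (N k).lie_mem hx⟩ }
  have : unionOver N D ≤ T := iSup₂_le fun k hk x hx => Or.inr ⟨k, hk, hx⟩
  exact (this hm).resolve_left h0

/-- The places of a chain of submodules at which the weight space of weight `lam` grows. -/
def jumps (N : J → LieSubmodule K g M) (lam : Module.Dual K h) : Set J :=
  {j | ∃ m ∈ weightSpace h M lam, m ∈ N j ∧ m ∉ before N j}

/-- The dimension of the `lam`-weight space of `N j` strictly increases on reaching each jump, so it
is injective on jumps, and it is bounded by that of `M`. -/
theorem finite_jumps {N : J → LieSubmodule K g M} (hN : Monotone N)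
    [Module.Finite K (weightSpace h M lam)] : (jumps N lam).Finite := by
  let f : J → ℕ := fun j => Module.finrank K
    ((weightSpace h M lam ⊓ (N j).toSubmodule : Submodule K M))
  have hfin : ∀ j, Module.Finite K ((weightSpace h M lam ⊓ (N j).toSubmodule : Submodule K M)) :=
    fun j => Submodule.finiteDimensional_of_le inf_le_left
  have hlt : ∀ j k, k ∈ jumps N lam → j < k → f j < f k := by
    rintro j k ⟨m, hm, hmk, hmb⟩ hjk
    have := hfin k
    refine Submodule.finrank_lt_finrank_of_lt (lt_of_le_of_ne
      (inf_le_inf_left _ (hN hjk.le)) fun he => ?_)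
    have h1 : m ∈ (weightSpace h M lam ⊓ (N k).toSubmodule : Submodule K M) := ⟨hm, hmk⟩
    rw [← he] at h1
    exact hmb (le_before hjk h1.2)
  refine Set.Finite.of_injOn (f := f) (t := Set.Iic (Module.finrank K (weightSpace h M lam)))
    (fun j _ => Submodule.finrank_mono inf_le_left) (fun j hj k hk hjk => ?_) (Set.finite_Iic _)
  rcases lt_trichotomy j k with h1 | h1 | h1
  · exact absurd hjk (hlt j k hk h1).ne
  · exact h1
  · exact absurd hjk (hlt k j hj h1).ne'

/-- If every nonzero vector is first met at some place of the chain, and if no weight space of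
weight above `lam` grows outside of the jumps, then unions over lower sets that contain the same
jumps have the same weight spaces above `lam`. -/
theorem mem_unionOver_of_jumps {N : J → LieSubmodule K g M} (hN : Monotone N)
    (hgap : ∀ m : M, m ≠ 0 → ∃ j, m ∈ N j ∧ m ∉ before N j)
    {ν : Module.Dual K h}
    (hgood : ∀ j ∉ jumps N lam, ∀ m ∈ weightSpace h M ν, m ∈ N j → m ∈ before N j)
    {D D' : Set J} (hD' : IsLowerSet D') (hJ : jumps N lam ∩ D' ⊆ D) {m : M}
    (hm : m ∈ weightSpace h M ν) (hmD : m ∈ unionOver N D') : m ∈ unionOver N D := by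
  by_cases h0 : m = 0
  · rw [h0]; exact zero_mem _
  obtain ⟨j, hj, hjb⟩ := hgap m h0
  obtain ⟨k, hk, hmk⟩ := exists_of_mem_unionOver hN hmD h0
  have hjk : j ≤ k := not_lt.mp fun hlt => hjb (le_before hlt hmk)
  have hjJ : j ∈ jumps N lam := by
    by_contra hc
    exact hjb (hgood j hc m hm hj)
  exact le_unionOver (hJ ⟨hjJ, hD' hjk hk⟩) hj

end ChainsOfSubmodules

/-! ### Counting standard subquotients by singular functionals. -/

section Filtrations

variable {K : Type*} [Field K] {g : Type*} [LieRing g] [LieAlgebra K g] {h b : LieSubalgebra K g}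
  {M : Type*} [AddCommGroup M] [Module K M] [LieRingModule g M] [LieModule K g M]
  {J : Type*} [LinearOrder J] {lam : Module.Dual K h} {N : J → LieSubmodule K g M}
  {V : Module.Dual K h → Type*} [∀ μ, AddCommGroup (V μ)] [∀ μ, Module K (V μ)]
  [∀ μ, LieRingModule g (V μ)] [∀ μ, LieModule K g (V μ)]

/-- The projection to a graded piece, followed by an isomorphism. -/
theorem exists_proj_of_gradedPiece_equiv {W : Type*} [AddCommGroup W] [Module K W]
    [LieRingModule g W] [LieModule K g W] {j : J} (e : gradedPiece N j ≃ₗ⁅K,g⁆ W) :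
    ∃ p : N j →ₗ⁅K,g⁆ W, Function.Surjective p ∧ ∀ x, p x = 0 ↔ x.1 ∈ before N j := by
  refine ⟨(e : gradedPiece N j →ₗ⁅K,g⁆ W).comp (LieSubmodule.Quotient.mk' _),
    e.surjective.comp (LieSubmodule.Quotient.surjective_mk' _), fun x => ?_⟩
  change e (LieSubmodule.Quotient.mk' _ x) = 0 ↔ _
  rw [← map_zero (e : gradedPiece N j →ₗ⁅K,g⁆ W)]
  change e _ = e 0 ↔ _
  rw [e.injective.eq_iff, LieSubmodule.Quotient.mk_eq_zero]
  rfl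

/-- The member at a least index equals the intersection of the chain, which is zero, so no vector is
first met there. -/
theorem IsGeneralizedFiltration.not_isMin (hN : IsGeneralizedFiltration V N) {j : J} {m : M}
    (hm : m ∈ N j) (hb : m ∉ before N j) : ¬ IsMin j := by
  intro hj
  have h1 : m ∈ ⨅ j, N j := by
    rw [LieSubmodule.mem_iInf]
    exact fun k => hN.strictMono.monotone (isBot_iff_isMin.mpr hj k) hm
  rw [hN.iInf_eq_bot] at h1
  rw [(LieSubmodule.mem_bot m).mp h1] at hb
  exact hb (zero_mem _)

/-- A place of the filtration at which a vector is first met projects onto a member of the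
family. -/
theorem IsGeneralizedFiltration.exists_proj (hN : IsGeneralizedFiltration V N) {j : J} {m : M}
    (hm : m ∈ N j) (hb : m ∉ before N j) :
    ∃ μ, Nonempty (gradedPiece N j ≃ₗ⁅K,g⁆ V μ) ∧
      ∃ p : N j →ₗ⁅K,g⁆ V μ, Function.Surjective p ∧ ∀ x, p x = 0 ↔ x.1 ∈ before N j := by
  obtain ⟨μ, ⟨e⟩⟩ := hN.quotient j (hN.not_isMin hm hb)
  exact ⟨μ, ⟨e⟩, exists_proj_of_gradedPiece_equiv e⟩

theorem mem_jumps_of_proj (hM : IsWeight h M) {W : Type*} [AddCommGroup W] [Module K W]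
    [LieRingModule g W] [LieModule K g W] {j : J} {p : N j →ₗ⁅K,g⁆ W}
    (hp : Function.Surjective p) (hpb : ∀ x, p x = 0 ↔ x.1 ∈ before N j) {w : W}
    (hw : w ∈ weightSpace h W lam) (h0 : w ≠ 0) : j ∈ jumps N lam := by
  obtain ⟨x, hx, rfl⟩ := (hM.lieSubmodule (N j)).exists_of_surjective p hp hw
  exact ⟨x, map_mem_weightSpace (N j).incl hx, x.2, fun hc => h0 ((hpb x).mpr hc)⟩

/-- A subquotient with a weight above `lam` has its highest weight above `lam` too, hence has `lam`
itself as a weight. The hypothesis `hV`, that the weights are exactly those below the index, is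
shared by Verma and co-Verma modules. -/
theorem IsGeneralizedFiltration.good (hN : IsGeneralizedFiltration V N) (hM : IsWeight h M)
    (hV : ∀ μ ν : Module.Dual K h, μ - ν ∈ cone h b ↔ ∃ v ∈ weightSpace h (V μ) ν, v ≠ 0)
    {ν : Module.Dual K h} (hν : ν - lam ∈ cone h b) :
    ∀ j ∉ jumps N lam, ∀ m ∈ weightSpace h M ν, m ∈ N j → m ∈ before N j := by
  intro j hj m hm hmj
  by_contra hb
  obtain ⟨μ, -, p, hp, hpb⟩ := hN.exists_proj hmj hb
  have h1 : p ⟨m, hmj⟩ ∈ weightSpace h (V μ) ν :=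
    map_mem_weightSpace p (mem_weightSpace_of_map_mem (N j).incl Subtype.val_injective hm)
  have h2 := (hV μ ν).mpr ⟨_, h1, fun h0 => hb ((hpb _).mp h0)⟩
  have h3 := (cone h b).add_mem h2 hν
  rw [sub_add_sub_cancel] at h3
  obtain ⟨v, hv, h0⟩ := (hV μ lam).mp h3
  exact hj (mem_jumps_of_proj hM hp hpb hv h0)

/-- Isomorphic members have the same weights, so each index lies below the other, and pointedness
gives equality. -/
theorem eq_of_equiv (hC : ∀ γ ∈ cone h b, -γ ∈ cone h b → γ = 0)
    (hV : ∀ μ ν : Module.Dual K h, μ - ν ∈ cone h b ↔ ∃ v ∈ weightSpace h (V μ) ν, v ≠ 0)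
    {W : Type*} [AddCommGroup W] [Module K W] [LieRingModule g W] [LieModule K g W]
    {μ : Module.Dual K h} (e : W ≃ₗ⁅K,g⁆ V μ) (e' : W ≃ₗ⁅K,g⁆ V lam) : μ = lam := by
  have key : ∀ μ lam : Module.Dual K h, (V μ ≃ₗ⁅K,g⁆ V lam) → lam - μ ∈ cone h b := by
    intro μ lam e
    obtain ⟨v, hv, h0⟩ := (hV μ μ).mp (by rw [sub_self]; exact zero_mem _)
    exact (hV lam μ).mpr ⟨e v, map_mem_weightSpace (e : V μ →ₗ⁅K,g⁆ V lam) hv, fun hc =>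
      h0 (e.injective (hc.trans (map_zero (e : V μ →ₗ⁅K,g⁆ V lam)).symm))⟩
  have h1 := key _ _ (e.symm.trans e')
  have h2 := key _ _ (e'.symm.trans e)
  have h3 := hC _ h2 (by rwa [neg_sub])
  exact sub_eq_zero.mp h3

/-- The places at which the graded piece is the member of the family with index `lam`. -/
def places (N : J → LieSubmodule K g M) (W : Type*) [AddCommGroup W] [Module K W]
    [LieRingModule g W] [LieModule K g W] : Set J :=
  {j | Nonempty (gradedPiece N j ≃ₗ⁅K,g⁆ W)}

theorem places_subset_jumps (hM : IsWeight h M)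
    (hV : ∀ μ ν : Module.Dual K h, μ - ν ∈ cone h b ↔ ∃ v ∈ weightSpace h (V μ) ν, v ≠ 0) :
    places N (V lam) ⊆ jumps N lam := by
  rintro j ⟨e⟩
  obtain ⟨p, hp, hpb⟩ := exists_proj_of_gradedPiece_equiv e
  obtain ⟨v, hv, h0⟩ := (hV lam lam).mp (by rw [sub_self]; exact zero_mem _)
  exact mem_jumps_of_proj hM hp hpb hv h0

theorem Verma.sub_mem_cone_iff (hh : IsSplittingMaximalToral h) (hb : IsDynkinBorel h b)
    (τ : Transpose h) (μ ν : Module.Dual K h) :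
    μ - ν ∈ cone h b ↔ ∃ v ∈ weightSpace h (Verma h b μ) ν, v ≠ 0 :=
  ⟨fun hμ => Verma.weightSpace_ne_bot hh hb.toIsBorel τ hμ,
    fun ⟨_, hv, h0⟩ => Verma.sub_mem_cone hh hb τ hv h0⟩

open Classical in
/-- Counting standard subquotients of the union over a lower set by singular functionals. -/
theorem IsGeneralizedFiltration.finrank_sing_unionOver (hh : IsSplittingMaximalToral h)
    (hb : IsDynkinBorel h b) (τ : Transpose h) (hC : ∀ γ ∈ cone h b, -γ ∈ cone h b → γ = 0)
    (hN : IsGeneralizedFiltration (Verma h b) N) (hM : IsWeight h M)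
    [Module.Finite K (weightSpace h M lam)] (n : ℕ) :
    ∀ D : Set J, IsLowerSet D → (jumps N lam ∩ D).ncard = n →
      Module.finrank K (singFunctionals h b lam (unionOver N D)) =
        (places N (Verma h b lam) ∩ D).ncard := by
  have hV := Verma.sub_mem_cone_iff hh hb τ
  have hmono := hN.strictMono.monotone
  have hfin : (jumps N lam).Finite := finite_jumps hmono
  have hPJ : places N (Verma h b lam) ⊆ jumps N lam := places_subset_jumps hM hV
  induction n with
  | zero =>
    intro D hD hn
    have hJ : jumps N lam ∩ D = ∅ := (Set.ncard_eq_zero (hfin.inter_of_left D)).mp hn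
    rw [Set.subset_eq_empty (Set.inter_subset_inter_left D hPJ) hJ, Set.ncard_empty]
    have hw : ∀ x ∈ weightSpace h (unionOver N D) lam, x = 0 := by
      intro x hx
      have h1 := mem_unionOver_of_jumps hmono hN.no_gap (D := ∅)
        (hN.good hM hV (ν := lam) (by rw [sub_self]; exact zero_mem _)) hD
        (by rw [hJ]) (map_mem_weightSpace (unionOver N D).incl hx) x.2
      rw [unionOver_empty] at h1
      exact Subtype.ext ((LieSubmodule.mem_bot _).mp h1)
    have : Subsingleton (singFunctionals h b lam (unionOver N D)) :=
      ⟨fun F G => (hM.lieSubmodule _).sing_ext fun x hx => by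
        rw [hw x hx, map_zero, map_zero]⟩
    exact Module.finrank_zero_of_subsingleton
  | succ n ih =>
    intro D hD hn
    have hne : (jumps N lam ∩ D).Nonempty := Set.nonempty_of_ncard_ne_zero (by omega)
    -- At the last jump `k` in `D`, the union over `D` and `N k` agree in all weights above or equal
    -- to `lam`. Removing the subquotient at `k` leaves the union over the indices below `k`, with
    -- one jump fewer.
    obtain ⟨k, ⟨hkJ, hkD⟩, hkmax⟩ :=
      Set.exists_max_image _ (fun j : J => j) (hfin.inter_of_left D) hne
    have hkD' : Set.Iic k ⊆ D := fun j hj => hD hj hkD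
    have hle : N k ≤ unionOver N D := le_unionOver hkD
    have hmem : ∀ ν : Module.Dual K h, ν - lam ∈ cone h b →
        ∀ x ∈ weightSpace h (unionOver N D) ν, ∃ a, LieSubmodule.inclusion hle a = x := by
      intro ν hν x hx
      have h1 := mem_unionOver_of_jumps hmono hN.no_gap (D := Set.Iic k)
        (hN.good hM hV hν) hD (fun j hj => hkmax j hj)
        (map_mem_weightSpace (unionOver N D).incl hx) x.2
      rw [unionOver_Iic hmono] at h1
      exact ⟨⟨x.1, h1⟩, rfl⟩
    have e1 : Module.finrank K (singFunctionals h b lam (unionOver N D)) =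
        Module.finrank K (singFunctionals h b lam (N k)) := by
      refine finrank_singFunctionals_eq (hM.lieSubmodule _) (LieSubmodule.inclusion hle)
        (LieSubmodule.inclusion_injective hle)
        (hmem lam (by rw [sub_self]; exact zero_mem _)) fun α hα => hmem _ ?_
      rw [add_sub_cancel_left]
      exact hb.mem_cone hh hα
    have ⟨m, _, hmk, hmb⟩ := hkJ
    obtain ⟨μ, ⟨e⟩, p, hp, hpb⟩ := hN.exists_proj hmk hmb
    have hfk : Module.Finite K (weightSpace h (N k) lam) :=
      finite_weightSpace_of_injective (N k).incl Subtype.val_injective lam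
    have e2 := finrank_singFunctionals_add_verma (lam := lam) hh hb τ hC (hM.lieSubmodule (N k))
      (LieSubmodule.inclusion (before_le hmono k))
      (LieSubmodule.inclusion_injective (before_le hmono k)) p hp
      (fun x => (hpb x).trans ⟨fun hx => ⟨⟨x.1, hx⟩, rfl⟩, fun ⟨a, ha⟩ => ha ▸ a.2⟩)
    have hkk : k ∉ Set.Iio k := lt_irrefl k
    have hJD : jumps N lam ∩ D = insert k (jumps N lam ∩ Set.Iio k) := by
      ext j
      constructor
      · rintro ⟨h1, h2⟩
        rcases (hkmax j ⟨h1, h2⟩).lt_or_eq with h3 | h3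
        · exact Or.inr ⟨h1, h3⟩
        · exact Or.inl h3
      · rintro (rfl | ⟨h1, h2⟩)
        · exact ⟨hkJ, hkD⟩
        · exact ⟨h1, hkD' (Set.mem_Iic.mpr (le_of_lt h2))⟩
    have hcard : (jumps N lam ∩ Set.Iio k).ncard = n := by
      rw [hJD, Set.ncard_insert_of_notMem (fun hc => hkk hc.2) (hfin.inter_of_left _)] at hn
      omega
    have e3 := ih (Set.Iio k) (isLowerSet_Iio k) hcard
    rw [unionOver_Iio] at e3
    rw [e1, e2, e3]
    have hpl : ∀ j ∈ places N (Verma h b lam) ∩ D, j ≠ k →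
        j ∈ places N (Verma h b lam) ∩ Set.Iio k := fun j hj hjk =>
      ⟨hj.1, lt_of_le_of_ne (hkmax j ⟨hPJ hj.1, hj.2⟩) hjk⟩
    have hpl' : places N (Verma h b lam) ∩ Set.Iio k ⊆ places N (Verma h b lam) ∩ D :=
      fun j hj => ⟨hj.1, hkD' (Set.mem_Iic.mpr (le_of_lt hj.2))⟩
    by_cases hμ : μ = lam
    · rw [if_pos hμ]
      subst hμ
      have : places N (Verma h b μ) ∩ D = insert k (places N (Verma h b μ) ∩ Set.Iio k) := by
        ext j
        refine ⟨fun hj => ?_, ?_⟩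
        · by_cases hjk : j = k
          · exact Or.inl hjk
          · exact Or.inr (hpl j hj hjk)
        · rintro (rfl | hj)
          · exact ⟨⟨e⟩, hkD⟩
          · exact hpl' hj
      rw [this, Set.ncard_insert_of_notMem (fun hc => hkk hc.2)
        ((hfin.subset hPJ).inter_of_left _)]
    · rw [if_neg hμ, add_zero]
      congr 1
      refine Set.Subset.antisymm hpl' fun j hj => hpl j hj ?_
      rintro rfl
      obtain ⟨e'⟩ := hj.1
      exact hμ (eq_of_equiv hC hV e e')

end Filtrations

end RootReductive

namespace RootReductive

/-! ### Vectors singular modulo a submodule, and co-Verma subquotients. -/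

section RelativeSingularVectors

variable {K : Type*} [Field K] {g : Type*} [LieRing g] [LieAlgebra K g] {h b : LieSubalgebra K g}
  {M : Type*} [AddCommGroup M] [Module K M] [LieRingModule g M] [LieModule K g M]
  {lam mu : Module.Dual K h}

/-- The vectors of weight `lam` that are singular modulo the submodule `P`. -/
def singVectors (h b : LieSubalgebra K g) (lam : Module.Dual K h) (P : LieSubmodule K g M) :
    Submodule K M where
  carrier := {m | m ∈ weightSpace h M lam ∧
    ∀ α, IsPosRoot h b α → ∀ x ∈ rootSpace h α, ⁅x, m⁆ ∈ P}
  zero_mem' := ⟨zero_mem _, fun α _ x _ => by rw [lie_zero]; exact zero_mem _⟩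
  add_mem' := fun hm hn => ⟨add_mem hm.1 hn.1, fun α hα x hx => by
    rw [lie_add]; exact add_mem (hm.2 α hα x hx) (hn.2 α hα x hx)⟩
  smul_mem' := fun c m hm => ⟨Submodule.smul_mem _ c hm.1, fun α hα x hx => by
    rw [lie_smul]; exact P.smul_mem c (hm.2 α hα x hx)⟩

theorem singVectors_mono {P P' : LieSubmodule K g M} (hP : P ≤ P') :
    singVectors h b lam P ≤ singVectors h b lam P' :=
  fun _ hm => ⟨hm.1, fun α hα x hx => hP (hm.2 α hα x hx)⟩

theorem CoVerma.sub_mem_cone_iff (hh : IsSplittingMaximalToral h) (hb : IsDynkinBorel h b)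
    (τ : Transpose h) (μ ν : Module.Dual K h) :
    μ - ν ∈ cone h b ↔ ∃ v ∈ weightSpace h (CoVerma hh b τ μ) ν, v ≠ 0 := by
  refine ⟨fun hμ => ?_, fun ⟨_, hv, h0⟩ => CoVerma.sub_mem_cone hb hv h0⟩
  obtain ⟨m, hm, h0⟩ := Verma.weightSpace_ne_bot hh hb.toIsBorel τ hμ
  obtain ⟨f, hf, hfm⟩ := exists_dual_apply_ne_zero (hh := hh) (τ := τ)
    (Verma.isWeight hh hb τ) hm h0
  exact ⟨f, hf, fun hc => hfm (by rw [hc]; rfl)⟩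

/-- Vectors singular modulo `P'` lift to vectors singular modulo `P`, if `P' / P` is a co-Verma
module of higher weight. -/
theorem exists_lift_singVectors_of_lt {hh : IsSplittingMaximalToral h} (hb : IsDynkinBorel h b)
    {τ : Transpose h} (hC : ∀ γ ∈ cone h b, -γ ∈ cone h b → γ = 0) (hM : IsWeight h M)
    {P P' : LieSubmodule K g M} (q : P' →ₗ⁅K,g⁆ CoVerma hh b τ mu)
    (hq : Function.Surjective q) (hqP : ∀ x, q x = 0 ↔ x.1 ∈ P) (hlt : mu - lam ∈ cone h b)
    {m : M} (hm : m ∈ singVectors h b lam P') :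
    ∃ n ∈ P', n ∈ weightSpace h M lam ∧ m - n ∈ singVectors h b lam P := by
  have hP' := hM.lieSubmodule P'
  let π : M →ₗ⁅K,g⁆ M ⧸ P' := LieSubmodule.Quotient.mk' P'
  have hπ : ∀ x, π x = 0 ↔ x ∈ P' := fun x => LieSubmodule.Quotient.mk_eq_zero _
  obtain ⟨ψ, hψ⟩ := Verma.exists_hom (b := b) (lam := lam) (w := π m)
    (fun x hx => by
      refine hb.lie_mem_of_mem_nilPart hh (S := ⊥) (fun α hα x hx => ?_) hx
      rw [Submodule.mem_bot, ← LieModuleHom.map_lie, hπ]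
      exact hm.2 α hα x hx)
    (map_mem_weightSpace π hm.1)
  -- The submodule generated by `m` together with `P'`. Its quotient by `P'` is an image of a Verma
  -- module of highest weight `lam`.
  let B : LieSubmodule K g M := ψ.range.comap π
  have hB : ∀ x, x ∈ B ↔ ∃ δ, ψ δ = π x := by
    intro x
    rw [LieSubmodule.mem_comap, LieModuleHom.mem_range]
  have hle : P' ≤ B := fun x hx => (hB x).mpr ⟨0, by rw [map_zero, (hπ x).mpr hx]⟩
  have hmB : m ∈ B := (hB m).mpr ⟨_, hψ⟩
  have hFs : ({ toFun := fun x => (q x).1 (Verma.gen h b mu)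
                map_add' := fun x y => by rw [map_add]; rfl
                map_smul' := fun c x => by rw [map_smul]; rfl } : Module.Dual K P') ∈
      singFunctionals h b mu P' := hom_coVerma_gen_mem hb.toIsBorel q fun _ => rfl
  -- The aim is to extend `q` from `P'` to `B`. As a singular functional of weight `mu` it meets no
  -- obstruction: `lam ≤ mu`, so `B / P'` has no weight `mu + α`.
  obtain ⟨G, hG, hGF⟩ := exists_sing_extension_of_higher (hM.lieSubmodule B)
    (LieSubmodule.inclusion hle) (LieSubmodule.inclusion_injective hle) (fun α hα x hx => by
      suffices hx' : x.1 ∈ P' from ⟨⟨x.1, hx'⟩, rfl⟩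
      by_contra hc
      obtain ⟨δ, hδ⟩ := (hB _).mp x.2
      have hx2 : π x ∈ weightSpace h (M ⧸ P') (mu + α) :=
        map_mem_weightSpace π (map_mem_weightSpace B.incl hx)
      rw [← hδ] at hx2
      obtain ⟨δ', hδ', he⟩ := (Verma.isWeight hh hb τ).exists_of_map_mem
        (hM.of_surjective π (LieSubmodule.Quotient.surjective_mk' P')) ψ hx2
      have h0 : δ' ≠ 0 := by
        rintro rfl
        rw [map_zero, hδ] at he
        exact hc ((hπ _).mp he.symm)
      have h1 := (cone h b).add_mem (Verma.sub_mem_cone hh hb τ hδ' h0) hlt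
      rw [show lam - (mu + α) + (mu - lam) = -α by abel] at h1
      exact hα.ne_zero (hC α (hb.mem_cone hh hα) h1)) hFs
  obtain ⟨r, hr⟩ := exists_hom_coVerma (hh := hh) (τ := τ) hb.toIsBorel (hM.lieSubmodule B) hG
  have hrq : ∀ x : P', r (LieSubmodule.inclusion hle x) = q x := by
    have : r.comp (LieSubmodule.inclusion hle) = q := hom_coVerma_ext fun x => by
      rw [LieModuleHom.comp_apply, hr, hGF]
      rfl
    exact fun x => LieModuleHom.congr_fun this x
  have hrm : r ⟨m, hmB⟩ ∈ weightSpace h (CoVerma hh b τ mu) lam :=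
    map_mem_weightSpace r (mem_weightSpace_of_map_mem B.incl Subtype.val_injective hm.1)
  -- The correction `n` in `P'` has the same image as `m` under the extended map `r`, so `r` kills
  -- `x (m - n)`; on `P'` this means membership in `P`.
  obtain ⟨n, hn, hqn⟩ := hP'.exists_of_surjective q hq hrm
  have hnw := map_mem_weightSpace P'.incl hn
  refine ⟨n, n.2, hnw, Submodule.sub_mem _ hm.1 hnw, fun α hα x hx => ?_⟩
  have h1 : ⁅x, m - n.1⁆ ∈ P' := by
    rw [lie_sub]
    exact sub_mem (hm.2 α hα x hx) (P'.lie_mem n.2)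
  rw [← hqP ⟨_, h1⟩, ← hrq]
  have h2 : LieSubmodule.inclusion hle ⟨_, h1⟩ =
      ⁅x, (⟨m, hmB⟩ - LieSubmodule.inclusion hle n : B)⁆ := rfl
  rw [h2, LieModuleHom.map_lie, map_sub, hrq, hqn, sub_self, lie_zero]

/-- When `mu` is not strictly above `lam`, no weight `α + lam` occurs in the co-Verma module, and
`m` needs no correction. -/
theorem exists_lift_singVectors {hh : IsSplittingMaximalToral h} (hb : IsDynkinBorel h b)
    {τ : Transpose h} (hC : ∀ γ ∈ cone h b, -γ ∈ cone h b → γ = 0) (hM : IsWeight h M)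
    {P P' : LieSubmodule K g M} (q : P' →ₗ⁅K,g⁆ CoVerma hh b τ mu)
    (hq : Function.Surjective q) (hqP : ∀ x, q x = 0 ↔ x.1 ∈ P)
    {m : M} (hm : m ∈ singVectors h b lam P') :
    ∃ n ∈ P', n ∈ weightSpace h M lam ∧ m - n ∈ singVectors h b lam P := by
  by_cases hlt : mu - lam ∈ cone h b ∧ mu ≠ lam
  · exact exists_lift_singVectors_of_lt hb hC hM q hq hqP hlt.1 hm
  · refine ⟨0, zero_mem _, zero_mem _, ?_⟩
    rw [sub_zero]
    refine ⟨hm.1, fun α hα x hx => ?_⟩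
    by_contra h0
    have h1 : (⟨⁅x, m⁆, hm.2 α hα x hx⟩ : P') ∈ weightSpace h P' (α + lam) :=
      mem_weightSpace_of_map_mem P'.incl Subtype.val_injective (lie_mem_weightSpace hx hm.1)
    have h2 := CoVerma.sub_mem_cone hb (map_mem_weightSpace q h1) fun hc => h0 ((hqP _).mp hc)
    have hαc := hb.mem_cone hh hα
    refine hlt ⟨?_, ?_⟩
    · have h3 := (cone h b).add_mem h2 hαc
      rwa [show mu - (α + lam) + α = mu - lam by abel] at h3
    · rintro rfl
      rw [show mu - (α + mu) = -α by abel] at h2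
      exact hα.ne_zero (hC α hαc h2)

-- The map `q` sends this space onto the singular vectors of weight `lam` of the co-Verma module,
-- which are singular functionals on the Verma module; its kernel there is the `lam`-weight space of
-- `P`.
open Classical in
theorem finrank_singVectors_inf {hh : IsSplittingMaximalToral h} (hb : IsDynkinBorel h b)
    {τ : Transpose h} (hC : ∀ γ ∈ cone h b, -γ ∈ cone h b → γ = 0) (hM : IsWeight h M)
    [Module.Finite K (weightSpace h M lam)]
    {P P' : LieSubmodule K g M} (hPP' : P ≤ P') (q : P' →ₗ⁅K,g⁆ CoVerma hh b τ mu)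
    (hq : Function.Surjective q) (hqP : ∀ x, q x = 0 ↔ x.1 ∈ P) :
    Module.finrank K (singVectors h b lam P ⊓ P'.toSubmodule : Submodule K M) =
      Module.finrank K (weightSpace h M lam ⊓ P.toSubmodule : Submodule K M) +
        if mu = lam then 1 else 0 := by
  let Q : Submodule K M := singVectors h b lam P ⊓ P'.toSubmodule
  have hQ : Module.Finite K Q :=
    Submodule.finiteDimensional_of_le (inf_le_left.trans fun _ hm => hm.1 :
      Q ≤ weightSpace h M lam)
  let i : Q →ₗ[K] P' := Submodule.inclusion (inf_le_right : Q ≤ P'.toSubmodule)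
  have hsing : ∀ x : Q, (show Module.Dual K (Verma h b mu) from (q (i x)).1) ∈
      singFunctionals h b lam (Verma h b mu) := by
    intro x
    refine ⟨fun t δ => ?_, fun α hα y hy δ => ?_⟩
    · have h1 : ⁅(t : g), i x⁆ = lam t • i x := Subtype.ext (x.2.1.1 t)
      have h2 : (⁅(t : g), q (i x)⁆ : CoVerma hh b τ mu).1 δ = (lam t • q (i x)).1 δ := by
        rw [← LieModuleHom.map_lie, h1, map_smul]
      rw [lie_dual_apply, τ.fixes _ t.2] at h2
      exact h2
    · have h1 : q ⁅τ.toFun y, i x⁆ = 0 := (hqP _).mpr (x.2.1.2 α hα _ (τ.mem_rootSpace hy))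
      have h2 : (⁅τ.toFun y, q (i x)⁆ : CoVerma hh b τ mu).1 δ = 0 := by
        rw [← LieModuleHom.map_lie, h1]; rfl
      rw [lie_dual_apply, τ.involutive] at h2
      exact h2
  let ρ : Q →ₗ[K] singFunctionals h b lam (Verma h b mu) :=
    { toFun := fun x => ⟨_, hsing x⟩
      map_add' := fun x y => Subtype.ext (by
        change (q (i (x + y))).1 = (q (i x)).1 + (q (i y)).1
        rw [map_add, map_add]; rfl)
      map_smul' := fun c x => Subtype.ext (by
        change (q (i (c • x))).1 = c • (q (i x)).1
        rw [map_smul, map_smul]; rfl) }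
  have hρ : ∀ x, ρ x = 0 ↔ x.1 ∈ P := by
    intro x
    refine Iff.trans ?_ (hqP (i x))
    constructor
    · intro hx
      exact dual_ext fun δ => LinearMap.congr_fun (congrArg Subtype.val hx) δ
    · intro hx
      exact Subtype.ext (LinearMap.ext fun δ => by
        change (q (i x)).1 δ = 0
        rw [hx]; rfl)
  have hrange : LinearMap.range ρ = ⊤ := by
    refine LinearMap.range_eq_top.mpr fun F => ?_
    have hFd : (show TwistedDual τ (Verma h b mu) from F.1) ∈ dual hh τ (Verma h b mu) :=
      Submodule.mem_iSup_of_mem (p := dualComponent τ (Verma h b mu)) lam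
        fun ν hν m hm => apply_eq_zero_of_weight F.2.1 hν hm
    let f : CoVerma hh b τ mu := ⟨_, hFd⟩
    have hf : f ∈ weightSpace h (CoVerma hh b τ mu) lam :=
      mem_weightSpace_dual (Verma.isWeight hh hb τ)
        fun ν hν m hm => apply_eq_zero_of_weight F.2.1 hν hm
    obtain ⟨x, hx, hxf⟩ := (hM.lieSubmodule P').exists_of_surjective q hq hf
    have hxQ : x.1 ∈ Q := by
      refine ⟨⟨map_mem_weightSpace P'.incl hx, fun α hα y hy => ?_⟩, x.2⟩
      refine (hqP ⁅y, x⁆).mp ?_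
      rw [LieModuleHom.map_lie, hxf]
      exact dual_ext fun δ => F.2.2 α hα _ (τ.mem_rootSpace_neg hy) δ
    refine ⟨⟨x.1, hxQ⟩, Subtype.ext ?_⟩
    change (q x).1 = F.1
    rw [hxf]
  have hker : Module.finrank K (LinearMap.ker ρ) =
      Module.finrank K (weightSpace h M lam ⊓ P.toSubmodule : Submodule K M) := by
    have h1 : (LinearMap.ker ρ).map Q.subtype = weightSpace h M lam ⊓ P.toSubmodule := by
      ext m
      constructor
      · rintro ⟨x, hx, rfl⟩
        exact ⟨x.2.1.1, (hρ x).mp hx⟩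
      · rintro ⟨hm, hmP⟩
        have hmQ : m ∈ Q := ⟨⟨hm, fun α _ x _ => P.lie_mem hmP⟩, hPP' hmP⟩
        exact ⟨⟨m, hmQ⟩, (hρ _).mpr hmP, rfl⟩
    rw [← h1]
    exact (LinearEquiv.finrank_eq (Submodule.equivMapOfInjective _ Q.injective_subtype _))
  have h4 := LinearMap.finrank_range_add_finrank_ker (K := K) (V := Q)
    (V₂ := singFunctionals h b lam (Verma h b mu)) ρ
  rw [hrange, finrank_top, finrank_singFunctionals_verma hh hb τ hC, hker, add_comm] at h4
  exact h4.symm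

open Classical in
/-- The number of singular vectors is additive on extensions of co-Verma modules. -/
theorem finrank_singVectors_add_coVerma {hh : IsSplittingMaximalToral h}
    (hb : IsDynkinBorel h b) {τ : Transpose h} (hC : ∀ γ ∈ cone h b, -γ ∈ cone h b → γ = 0)
    (hM : IsWeight h M) [Module.Finite K (weightSpace h M lam)]
    {P P' : LieSubmodule K g M} (hPP' : P ≤ P') (q : P' →ₗ⁅K,g⁆ CoVerma hh b τ mu)
    (hq : Function.Surjective q) (hqP : ∀ x, q x = 0 ↔ x.1 ∈ P) :
    Module.finrank K (singVectors h b lam P) +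
        Module.finrank K (weightSpace h M lam ⊓ P'.toSubmodule : Submodule K M) =
      Module.finrank K (singVectors h b lam P') +
        Module.finrank K (weightSpace h M lam ⊓ P.toSubmodule : Submodule K M) +
          if mu = lam then 1 else 0 := by
  have hle : ∀ R : LieSubmodule K g M, singVectors h b lam R ≤ weightSpace h M lam :=
    fun _ _ hm => hm.1
  have : Module.Finite K (singVectors h b lam P) := Submodule.finiteDimensional_of_le (hle P)
  have : Module.Finite K (weightSpace h M lam ⊓ P'.toSubmodule : Submodule K M) :=
    Submodule.finiteDimensional_of_le inf_le_left
  have hsup : singVectors h b lam P ⊔ (weightSpace h M lam ⊓ P'.toSubmodule) =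
      singVectors h b lam P' := by
    refine le_antisymm (sup_le (singVectors_mono hPP') fun m hm => ⟨hm.1, fun α _ x _ =>
      P'.lie_mem hm.2⟩) fun m hm => ?_
    obtain ⟨n, hn, hnw, hmn⟩ := exists_lift_singVectors hb hC hM q hq hqP hm
    exact Submodule.mem_sup.mpr ⟨m - n, hmn, n, ⟨hnw, hn⟩, sub_add_cancel m n⟩
  have hinf : singVectors h b lam P ⊓ (weightSpace h M lam ⊓ P'.toSubmodule) =
      singVectors h b lam P ⊓ P'.toSubmodule := by
    rw [← inf_assoc, inf_eq_left.mpr (hle P)]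
  have h1 := Submodule.finrank_sup_add_finrank_inf_eq (singVectors h b lam P)
    (weightSpace h M lam ⊓ P'.toSubmodule)
  rw [hsup, hinf, finrank_singVectors_inf hb hC hM hPP' q hq hqP, ← add_assoc] at h1
  exact h1.symm

theorem singVectors_eq_of_higher {P P' : LieSubmodule K g M} (hPP' : P ≤ P')
    (hw : ∀ α, IsPosRoot h b α → ∀ x ∈ weightSpace h M (α + lam), x ∈ P' → x ∈ P) :
    singVectors h b lam P = singVectors h b lam P' :=
  le_antisymm (singVectors_mono hPP') fun _ hm => ⟨hm.1, fun α hα _ hx =>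
    hw α hα _ (lie_mem_weightSpace hx hm.1) (hm.2 α hα _ hx)⟩

/-- Singular functionals on the dual are singular vectors. -/
theorem singVectors_equiv_dual (hh : IsSplittingMaximalToral h) (τ : Transpose h)
    (hM : IsWeight h M) [Module.Finite K (weightSpace h M lam)] :
    Nonempty (singVectors h b lam (⊥ : LieSubmodule K g M) ≃ₗ[K]
      singFunctionals h b lam (dual hh τ M)) := by
  have hDM : IsWeight h (dual hh τ M) := isWeight_dual hM
  let F : M →ₗ[K] Module.Dual K (dual hh τ M) :=
    { toFun := fun m =>
        { toFun := fun f => f.1 m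
          map_add' := fun _ _ => rfl
          map_smul' := fun _ _ => rfl }
      map_add' := fun m n => LinearMap.ext fun f => dual_apply_add f.1 m n
      map_smul' := fun c m => LinearMap.ext fun f => dual_apply_smul f.1 c m }
  have hF : ∀ m f, F m f = f.1 m := fun _ _ => rfl
  have hFs : ∀ m ∈ singVectors h b lam (⊥ : LieSubmodule K g M),
      F m ∈ singFunctionals h b lam (dual hh τ M) := by
    intro m hm
    refine ⟨fun t f => ?_, fun α hα y hy f => ?_⟩
    · rw [hF, hF, lie_dual_apply, τ.fixes _ t.2, hm.1 t, dual_apply_smul]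
    · rw [hF, lie_dual_apply, (LieSubmodule.mem_bot _).mp (hm.2 α hα _ (τ.mem_rootSpace hy)),
        dual_apply_zero]
  refine ⟨LinearEquiv.ofBijective (F.restrict hFs) ⟨?_, fun G => ?_⟩⟩
  · refine (injective_iff_map_eq_zero (F.restrict hFs)).mpr fun m hm => ?_
    by_contra h0
    obtain ⟨f, -, hf⟩ := exists_dual_apply_ne_zero (hh := hh) (τ := τ) hM m.2.1
      (fun hc => h0 (Subtype.ext hc))
    exact hf (LinearMap.congr_fun (congrArg Subtype.val hm) f)
  · obtain ⟨s, hs⟩ := LinearMap.exists_leftInverse_of_injective (weightSpace h M lam).subtype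
      (Submodule.ker_subtype _)
    obtain ⟨π, hπ1, hπ2⟩ := hM.exists_linearMap_single lam s
    have hπ : ∀ m : weightSpace h M lam, π m = m := fun m => by
      rw [hπ1 _ m.2]
      exact LinearMap.congr_fun hs m
    have hvan : ∀ φ : Module.Dual K (weightSpace h M lam), ∀ ν, ν ≠ lam →
        ∀ m ∈ weightSpace h M ν, (φ.comp π) m = 0 := fun φ ν hν m hm => by
      rw [LinearMap.comp_apply, hπ2 ν hν m hm, map_zero]
    let ext : Module.Dual K (weightSpace h M lam) →ₗ[K] dual hh τ M :=
      { toFun := fun φ => ⟨(show TwistedDual τ M from φ.comp π),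
          Submodule.mem_iSup_of_mem (p := dualComponent τ M) lam (hvan φ)⟩
        map_add' := fun _ _ => rfl
        map_smul' := fun _ _ => rfl }
    have hext : ∀ φ m, (ext φ).1 m = φ (π m) := fun _ _ => rfl
    -- Reflexivity of the finite-dimensional weight space represents `G` there by evaluation at a
    -- vector; `ext` extends functionals by zero to the other weight spaces.
    let m := (Module.evalEquiv K (weightSpace h M lam)).symm (G.1.comp ext)
    have hm : ∀ φ : Module.Dual K (weightSpace h M lam), φ m = G.1 (ext φ) := fun φ =>
      LinearMap.congr_fun
        ((Module.evalEquiv K (weightSpace h M lam)).apply_symm_apply (G.1.comp ext)) φ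
    have hGm : F m.1 = G.1 := by
      refine hDM.linearMap_ext fun ν f hf => ?_
      by_cases hν : ν = lam
      · subst hν
        have h1 : f = ext ((show Module.Dual K M from f.1).comp (weightSpace h M ν).subtype) := by
          refine dual_ext fun x => ?_
          rw [hext]
          have h2 : (show Module.Dual K M from f.1) =
              ((show Module.Dual K M from f.1).comp (weightSpace h M ν).subtype).comp π := by
            refine hM.linearMap_ext fun κ x hx => ?_
            by_cases hκ : κ = ν
            · subst hκ
              rw [LinearMap.comp_apply, hπ ⟨x, hx⟩]
              rfl
            · rw [hvan _ κ hκ x hx]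
              exact dual_apply_eq_zero hf hκ hx
          exact LinearMap.congr_fun h2 x
        conv_rhs => rw [h1]
        rw [← hm]
        rfl
      · rw [apply_eq_zero_of_weight G.2.1 hν hf]
        exact dual_apply_eq_zero hf (Ne.symm hν) m.2
    refine ⟨⟨m.1, m.2, fun α hα x hx => ?_⟩, Subtype.ext hGm⟩
    rw [LieSubmodule.mem_bot]
    by_contra h0
    obtain ⟨f, -, hf⟩ := exists_dual_apply_ne_zero (hh := hh) (τ := τ) hM
      (lie_mem_weightSpace hx m.2) h0
    have h1 := G.2.2 α hα _ (τ.mem_rootSpace_neg hx) f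
    rw [← hGm, hF, lie_dual_apply, τ.involutive] at h1
    exact hf h1

end RelativeSingularVectors

/-! ### Counting costandard subquotients, and the final assembly. -/

section Counting

variable {K : Type*} [Field K] {g : Type*} [LieRing g] [LieAlgebra K g] {h b : LieSubalgebra K g}
  {M : Type*} [AddCommGroup M] [Module K M] [LieRingModule g M] [LieModule K g M]
  {J : Type*} [LinearOrder J] {lam : Module.Dual K h} {N : J → LieSubmodule K g M}

open Classical in
/-- Counting costandard subquotients above a lower set by singular vectors. -/
theorem IsGeneralizedFiltration.finrank_singVectors_unionOver {hh : IsSplittingMaximalToral h}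
    (hb : IsDynkinBorel h b) {τ : Transpose h} (hC : ∀ γ ∈ cone h b, -γ ∈ cone h b → γ = 0)
    (hN : IsGeneralizedFiltration (CoVerma hh b τ) N) (hM : IsWeight h M)
    [Module.Finite K (weightSpace h M lam)] (n : ℕ) :
    ∀ D : Set J, IsLowerSet D → (jumps N lam \ D).ncard = n →
      Module.finrank K (singVectors h b lam (unionOver N D)) =
        Module.finrank K (weightSpace h M lam ⊓ (unionOver N D).toSubmodule : Submodule K M) +
          (places N (CoVerma hh b τ lam) \ D).ncard := by
  have hV := CoVerma.sub_mem_cone_iff hh hb τ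
  have hmono := hN.strictMono.monotone
  have hfin : (jumps N lam).Finite := finite_jumps hmono
  have hPJ : places N (CoVerma hh b τ lam) ⊆ jumps N lam :=
    places_subset_jumps (V := CoVerma hh b τ) hM hV
  have hcone : ∀ α, IsPosRoot h b α → α + lam - lam ∈ cone h b := fun α hα => by
    rw [add_sub_cancel_right]
    exact hb.mem_cone hh hα
  have hcone0 : lam - lam ∈ cone h b := by rw [sub_self]; exact zero_mem _
  induction n with
  | zero =>
    intro D hD hn
    have hJ : jumps N lam \ D = ∅ := (Set.ncard_eq_zero (hfin.sdiff)).mp hn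
    rw [Set.subset_eq_empty (Set.sdiff_subset_sdiff_left hPJ) hJ, Set.ncard_empty, add_zero]
    -- With no jump left outside `D`, the union contains every weight space of weight above or equal
    -- to `lam`, so every vector of weight `lam` is singular modulo it and lies in it.
    have hw : ∀ ν : Module.Dual K h, ν - lam ∈ cone h b → ∀ m ∈ weightSpace h M ν,
        m ∈ unionOver N D := by
      intro ν hν m hm
      by_cases h0 : m = 0
      · rw [h0]; exact zero_mem _
      obtain ⟨j, hj, -⟩ := hN.no_gap m h0
      exact mem_unionOver_of_jumps hmono hN.no_gap (D' := Set.univ) (hN.good hM hV hν)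
        isLowerSet_univ (fun j hj => by
          by_contra hc
          exact Set.eq_empty_iff_forall_notMem.mp hJ j ⟨hj.1, hc⟩) hm
        (le_unionOver (Set.mem_univ j) hj)
    have he : singVectors h b lam (unionOver N D) =
        weightSpace h M lam ⊓ (unionOver N D).toSubmodule :=
      le_antisymm (fun m hm => ⟨hm.1, hw lam hcone0 m hm.1⟩) fun m hm =>
        ⟨hm.1, fun α hα x hx => hw _ (hcone α hα) _ (lie_mem_weightSpace hx hm.1)⟩
    rw [he]
  | succ n ih =>
    intro D hD hn
    have hne : (jumps N lam \ D).Nonempty := Set.nonempty_of_ncard_ne_zero (by omega)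
    -- At the first jump outside `D`, the unions over `D` and over the indices below `k` agree in
    -- the relevant weights. The induction hypothesis is used for `N k`, which leaves one jump fewer
    -- above it.
    obtain ⟨k, ⟨hkJ, hkD⟩, hkmin⟩ := Set.exists_min_image _ (fun j : J => j) hfin.sdiff hne
    have hDk : D ⊆ Set.Iio k := fun j hj => not_le.mp fun hc => hkD (hD hc hj)
    have hmem : ∀ ν : Module.Dual K h, ν - lam ∈ cone h b → ∀ x ∈ weightSpace h M ν,
        x ∈ before N k → x ∈ unionOver N D := fun ν hν x hx hxk =>
      mem_unionOver_of_jumps hmono hN.no_gap (D' := Set.Iio k) (hN.good hM hV hν)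
        (isLowerSet_Iio k) (fun j hj => by
          by_contra hc
          exact not_lt.mpr (hkmin j ⟨hj.1, hc⟩) hj.2) hx hxk
    have hDb : unionOver N D ≤ before N k := unionOver_mono hDk
    have e1 : singVectors h b lam (unionOver N D) = singVectors h b lam (before N k) :=
      singVectors_eq_of_higher hDb fun α hα => hmem _ (hcone α hα)
    have e1' : weightSpace h M lam ⊓ (unionOver N D).toSubmodule =
        weightSpace h M lam ⊓ (before N k).toSubmodule :=
      le_antisymm (inf_le_inf_left _ hDb) fun m hm => ⟨hm.1, hmem lam hcone0 m hm.1 hm.2⟩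
    have ⟨m, _, hmk, hmb⟩ := hkJ
    obtain ⟨μ, ⟨e⟩, p, hp, hpb⟩ := hN.exists_proj hmk hmb
    have e2 := finrank_singVectors_add_coVerma (lam := lam) hb hC hM (before_le hmono k) p hp hpb
    have hkk : k ∉ jumps N lam \ Set.Iic k := fun hc => hc.2 (Set.mem_Iic.mpr le_rfl)
    have hJD : jumps N lam \ D = insert k (jumps N lam \ Set.Iic k) := by
      ext j
      constructor
      · rintro ⟨h1, h2⟩
        rcases (hkmin j ⟨h1, h2⟩).lt_or_eq with h3 | h3
        · exact Or.inr ⟨h1, not_le.mpr h3⟩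
        · exact Or.inl h3.symm
      · rintro (rfl | ⟨h1, h2⟩)
        · exact ⟨hkJ, hkD⟩
        · exact ⟨h1, fun hc => h2 (le_of_lt (hDk hc))⟩
    have hcard : (jumps N lam \ Set.Iic k).ncard = n := by
      rw [hJD, Set.ncard_insert_of_notMem hkk hfin.sdiff] at hn
      omega
    have e3 := ih (Set.Iic k) (isLowerSet_Iic k) hcard
    rw [unionOver_Iic hmono] at e3
    have hpl : ∀ j ∈ places N (CoVerma hh b τ lam) \ D, j ≠ k →
        j ∈ places N (CoVerma hh b τ lam) \ Set.Iic k := fun j hj hjk =>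
      ⟨hj.1, fun hc => hjk (le_antisymm hc (hkmin j ⟨hPJ hj.1, hj.2⟩))⟩
    have hpl' : places N (CoVerma hh b τ lam) \ Set.Iic k ⊆ places N (CoVerma hh b τ lam) \ D :=
      fun j hj => ⟨hj.1, fun hc => hj.2 (le_of_lt (hDk hc))⟩
    have e4 : (places N (CoVerma hh b τ lam) \ D).ncard =
        (places N (CoVerma hh b τ lam) \ Set.Iic k).ncard + if μ = lam then 1 else 0 := by
      by_cases hμ : μ = lam
      · rw [if_pos hμ]
        subst hμ
        have : places N (CoVerma hh b τ μ) \ D =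
            insert k (places N (CoVerma hh b τ μ) \ Set.Iic k) := by
          ext j
          refine ⟨fun hj => ?_, ?_⟩
          · by_cases hjk : j = k
            · exact Or.inl hjk
            · exact Or.inr (hpl j hj hjk)
          · rintro (rfl | hj)
            · exact ⟨⟨e⟩, hkD⟩
            · exact hpl' hj
        rw [this, Set.ncard_insert_of_notMem (fun hc => hc.2 (Set.mem_Iic.mpr le_rfl))
          (hfin.subset hPJ).sdiff]
      · rw [if_neg hμ, add_zero]
        congr 1
        refine Set.Subset.antisymm (fun j hj => hpl j hj ?_) hpl'
        rintro rfl
        obtain ⟨e'⟩ := hj.1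
        exact hμ (eq_of_equiv (V := CoVerma hh b τ) hC hV e e')
    rw [e1, e1', e4]
    omega

/-- A co-Verma module with a finite-dimensional top weight space forces the cone of simple roots
to be pointed. -/
theorem CoVerma.cone_pointed {hh : IsSplittingMaximalToral h} (hb : IsDynkinBorel h b)
    {τ : Transpose h} (hf : Module.Finite K (weightSpace h (CoVerma hh b τ lam) lam)) :
    ∀ γ ∈ cone h b, -γ ∈ cone h b → γ = 0 := by
  refine Verma.cone_pointed (lam := lam) hh hb.toIsBorel τ ?_
  -- The `lam`-weight space of the co-Verma module surjects onto the dual of that of the Verma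
  -- module, so finiteness passes to the latter.
  rw [← Module.finite_dual_iff K]
  let r : weightSpace h (CoVerma hh b τ lam) lam →ₗ[K]
      Module.Dual K (weightSpace h (Verma h b lam) lam) :=
    { toFun := fun f => (show Module.Dual K (Verma h b lam) from f.1.1).comp
        (weightSpace h (Verma h b lam) lam).subtype
      map_add' := fun _ _ => rfl
      map_smul' := fun _ _ => rfl }
  refine Module.Finite.of_surjective r fun φ => ?_
  have hV : IsWeight h (Verma h b lam) := Verma.isWeight hh hb τ
  obtain ⟨f, hf⟩ := LinearMap.exists_extend φ
  obtain ⟨F, h1, h2⟩ := hV.exists_linearMap_single lam f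
  have hFd : (show TwistedDual τ (Verma h b lam) from F) ∈ dual hh τ (Verma h b lam) :=
    Submodule.mem_iSup_of_mem (p := dualComponent τ (Verma h b lam)) lam h2
  refine ⟨⟨⟨_, hFd⟩, mem_weightSpace_dual hV h2⟩, LinearMap.ext fun m => ?_⟩
  change F m = φ m
  rw [h1 _ m.2]
  exact LinearMap.congr_fun hf m

end Counting

end RootReductive

open RootReductive in
theorem RootReductive.IsGeneralizedFiltration.multiplicity_verma
    {K : Type*} [Field K] {g : Type*} [LieRing g] [LieAlgebra K g]
    {h b : LieSubalgebra K g} (hh : IsSplittingMaximalToral h) (hb : IsDynkinBorel h b)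
    (τ : Transpose h) {M : Type*} [AddCommGroup M] [Module K M] [LieRingModule g M]
    [LieModule K g M] (hM : InCategoryO h b M) {J : Type*} [LinearOrder J]
    {N : J → LieSubmodule K g M} (lam : Module.Dual K h)
    (hN : IsGeneralizedFiltration (Verma h b) N) :
    Module.Finite K (M →ₗ⁅K,g⁆ CoVerma hh b τ lam) ∧
      multiplicity N (Verma h b lam) =
        (Module.finrank K (M →ₗ⁅K,g⁆ CoVerma hh b τ lam) : ℕ∞) := by
  have hw : IsWeight h M := hM.weight
  have hfw := hM.finite
  have hV := Verma.sub_mem_cone_iff hh hb τ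
  have hfin := finite_jumps (lam := lam) hN.strictMono.monotone
  have hPJ : places N (Verma h b lam) ⊆ jumps N lam := places_subset_jumps hw hV
  obtain ⟨e⟩ := hom_coVerma_equiv (hh := hh) (τ := τ) (lam := lam) hb.toIsBorel hw
  have := hw.finite_singFunctionals (b := b) (lam := lam)
  refine ⟨Module.Finite.equiv e.symm, ?_⟩
  change (places N (Verma h b lam)).encard = _
  rw [e.finrank_eq, ← (hfin.subset hPJ).cast_ncard_eq, Nat.cast_inj]
  -- A nonzero vector provides a Verma subquotient, whose finite-dimensional top weight space gives
  -- pointedness of the cone. If `M` is zero, both numbers are zero.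
  by_cases hM0 : ∃ m : M, m ≠ 0
  · obtain ⟨m, h0⟩ := hM0
    obtain ⟨j, hj, hjb⟩ := hN.no_gap m h0
    obtain ⟨μ, -, p, hp, -⟩ := hN.exists_proj hj hjb
    have hfj : Module.Finite K (weightSpace h (N j) μ) :=
      finite_weightSpace_of_injective (N j).incl Subtype.val_injective μ
    have hC := Verma.cone_pointed hh hb.toIsBorel τ
      ((hw.lieSubmodule (N j)).finite_weightSpace_of_surjective p hp μ)
    have h1 := hN.finrank_sing_unionOver (lam := lam) hh hb τ hC hw _ Set.univ isLowerSet_univ rfl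
    rw [Set.inter_univ] at h1
    rw [← h1]
    refine (finrank_singFunctionals_eq hw (unionOver N Set.univ).incl Subtype.val_injective
      ?_ ?_).symm <;>
    · intros
      rename_i x _
      by_cases h0 : x = 0
      · exact ⟨0, by rw [map_zero, h0]⟩
      · obtain ⟨j, hj, -⟩ := hN.no_gap x h0
        exact ⟨⟨x, le_unionOver (Set.mem_univ j) hj⟩, rfl⟩
  · have hsub : Subsingleton M := ⟨fun x y => by
      by_contra hxy
      exact hM0 ⟨x - y, sub_ne_zero.mpr hxy⟩⟩
    have h1 : jumps N lam = ∅ := by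
      refine Set.eq_empty_iff_forall_notMem.mpr ?_
      rintro j ⟨m, -, -, hm⟩
      exact hm (Subsingleton.elim 0 m ▸ zero_mem _)
    have h2 : Subsingleton (singFunctionals h b lam M) :=
      ⟨fun F G => Subtype.ext (LinearMap.ext fun x => by
        rw [Subsingleton.elim x 0, map_zero, map_zero])⟩
    rw [Set.subset_eq_empty hPJ h1, Set.ncard_empty, Module.finrank_zero_of_subsingleton]

open RootReductive in
theorem RootReductive.IsGeneralizedFiltration.multiplicity_coVerma
    {K : Type*} [Field K] {g : Type*} [LieRing g] [LieAlgebra K g]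
    {h b : LieSubalgebra K g} (hh : IsSplittingMaximalToral h) (hb : IsDynkinBorel h b)
    (τ : Transpose h) {M : Type*} [AddCommGroup M] [Module K M] [LieRingModule g M]
    [LieModule K g M] (hM : InCategoryO h b M) {J : Type*} [LinearOrder J]
    {N : J → LieSubmodule K g M} (lam : Module.Dual K h)
    (hN : IsGeneralizedFiltration (CoVerma hh b τ) N) :
    Module.Finite K (dual hh τ M →ₗ⁅K,g⁆ CoVerma hh b τ lam) ∧
      multiplicity N (CoVerma hh b τ lam) =
        (Module.finrank K (dual hh τ M →ₗ⁅K,g⁆ CoVerma hh b τ lam) : ℕ∞) := by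
  have hw : IsWeight h M := hM.weight
  have hfw := hM.finite
  have hV := CoVerma.sub_mem_cone_iff hh hb τ
  have hfin := finite_jumps (lam := lam) hN.strictMono.monotone
  have hPJ : places N (CoVerma hh b τ lam) ⊆ jumps N lam :=
    places_subset_jumps (V := CoVerma hh b τ) hw hV
  obtain ⟨e⟩ := hom_coVerma_equiv (hh := hh) (τ := τ) (lam := lam) (X := dual hh τ M) hb.toIsBorel
    (isWeight_dual hw)
  obtain ⟨e'⟩ := singVectors_equiv_dual (b := b) (lam := lam) hh τ hw
  have : Module.Finite K (singVectors h b lam (⊥ : LieSubmodule K g M)) :=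
    Submodule.finiteDimensional_of_le fun _ hm => hm.1
  refine ⟨Module.Finite.equiv (e'.trans e.symm), ?_⟩
  change (places N (CoVerma hh b τ lam)).encard = _
  rw [e.finrank_eq, ← e'.finrank_eq, ← (hfin.subset hPJ).cast_ncard_eq, Nat.cast_inj]
  by_cases hM0 : ∃ m : M, m ≠ 0
  · obtain ⟨m, h0⟩ := hM0
    obtain ⟨j, hj, hjb⟩ := hN.no_gap m h0
    obtain ⟨μ, -, p, hp, -⟩ := hN.exists_proj hj hjb
    have hfj : Module.Finite K (weightSpace h (N j) μ) :=
      finite_weightSpace_of_injective (N j).incl Subtype.val_injective μ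
    have hC := CoVerma.cone_pointed hb
      ((hw.lieSubmodule (N j)).finite_weightSpace_of_surjective p hp μ)
    -- For the empty lower set the union is zero, so the vectors counted are the genuine singular
    -- vectors of `M`.
    have h1 := hN.finrank_singVectors_unionOver (lam := lam) hb hC hw _ ∅ isLowerSet_empty rfl
    rw [Set.sdiff_empty, unionOver_empty, LieSubmodule.bot_toSubmodule, inf_bot_eq, finrank_bot,
      zero_add] at h1
    exact h1.symm
  · have hsub : Subsingleton M := ⟨fun x y => by
      by_contra hxy
      exact hM0 ⟨x - y, sub_ne_zero.mpr hxy⟩⟩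
    have h1 : jumps N lam = ∅ := by
      refine Set.eq_empty_iff_forall_notMem.mpr ?_
      rintro j ⟨m, -, -, hm⟩
      exact hm (Subsingleton.elim 0 m ▸ zero_mem _)
    rw [Set.subset_eq_empty hPJ h1, Set.ncard_empty, Module.finrank_zero_of_subsingleton]

theorem mainTheorem10 {K : Type*} [Field K] [IsAlgClosed K] [CharZero K]
    {g : Type*} [LieRing g] [LieAlgebra K g] (hg : RootReductive.IsRootReductive K g)
    (h b : LieSubalgebra K g) (hh : RootReductive.IsSplittingMaximalToral h)
    (hb : RootReductive.IsDynkinBorel h b) (τ : RootReductive.Transpose h)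
    {M : Type*} [AddCommGroup M] [Module K M] [LieRingModule g M] [LieModule K g M]
    (hM : RootReductive.InCategoryO h b M)
    {J : Type*} [LinearOrder J] (N : J → LieSubmodule K g M) (lam : Module.Dual K h) :
    (RootReductive.IsGeneralizedFiltration (RootReductive.Verma h b) N →
      Module.Finite K (M →ₗ⁅K,g⁆ RootReductive.CoVerma hh b τ lam) ∧
      RootReductive.multiplicity N (RootReductive.Verma h b lam) =
        (Module.finrank K (M →ₗ⁅K,g⁆ RootReductive.CoVerma hh b τ lam) : ℕ∞)) ∧
    (RootReductive.IsGeneralizedFiltration (RootReductive.CoVerma hh b τ) N →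
      Module.Finite K (RootReductive.dual hh τ M →ₗ⁅K,g⁆ RootReductive.CoVerma hh b τ lam) ∧
      RootReductive.multiplicity N (RootReductive.CoVerma hh b τ lam) =
        (Module.finrank K
          (RootReductive.dual hh τ M →ₗ⁅K,g⁆ RootReductive.CoVerma hh b τ lam) : ℕ∞)) :=
  ⟨fun hN => hN.multiplicity_verma hh hb τ hM lam,
    fun hN => hN.multiplicity_coVerma hh hb τ hM lam⟩
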